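/- **Setting.** Let $M\ge 1$ and $L\ge 2$, and consider one qubit and $M$ bosonic modes $m_1,\dots,m_M$ (Hilbert space $\mathbb C^2\otimes L^2(\mathbb R^M)$). Put $D(\beta)=\exp(\beta m^\dagger-\beta^* m)$, $|\alpha\rangle=D(\alpha)|0\rangle$ and $|\boldsymbol\alpha\rangle=\bigotimes_j|\alpha^{(j)}\rangle$. Let $\mathcal N^{\rm C}_{v}$ be the centered complex Gaussian law with independent real and imaginary parts of variance $v/2$ each (the point mass at $0$ if $v=0$). For $E>0$ the ensemble $\mathcal U_{E,L,M}$ consists of the circuits $$U=\prod_{\ell=1}^L\prod_{j=1}^M U^{(j)}_{\rm ECD}(\beta^{(j)}_\ell)\,U_{\rm R}(\theta_{M(\ell-1)+j},\phi_{M(\ell-1)+j})$$ (factors with smaller index $M(\ell-1)+j$ act first), where $U_{\rm R}(\theta,\phi)=\exp[-i\tfrac\theta2(\cos\phi\,\sigma^x+\sin\phi\,\sigma^y)]$, where $U^{(j)}_{\rm ECD}(\beta)=D(\beta)\otimes|1\rangle\langle0|+D(-\beta)\otimes|0\rangle\langle1|$ acts on the qubit and mode $j$, and where all parameters are independent, $\beta^{(j)}_\ell\sim\mathcal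 N^{\rm C}_{E/L}$ and $\theta_n,\phi_n$ uniform on $[0,2\pi)$. Let $|\psi\rangle$ be a unit vector of the $M$ modes, $O=|0\rangle\langle0|\otimes|\psi\rangle\langle\psi|$, and $\mathcal C=\langle\Psi|O|\Psi\rangle$ with $|\Psi\rangle=U\,|0\rangle_q|0\rangle^{\otimes M}$. Fix $k\in\{1,\dots,ML\}$; the variance of $\partial_{\theta_k}\mathcal C$ is taken over $\mathcal U_{E,L,M}$. **Correlators.** For vectors $\boldsymbol z,\tilde{\boldsymbol z}$ with nonnegative entries and $z_j+\tilde z_j\le 1$, let $$C_1=\mathbb E|\langle\psi|\boldsymbol\alpha\rangle|^4,\qquad C_2(\boldsymbol z)=\mathbb E\prod_{h=0}^1|\langle\psi|\boldsymbol a+(-1)^h\boldsymbol b\rangle|^2,$$ $$C_3(\boldsymbol z,\tilde{\boldsymbol z})=\mathbb E\prod_{h=0}^1|\langle\psi|\boldsymbol a+(-1)^h\boldsymbol b+(-1)^h\boldsymbol c\rangle|\,|\langle\psi|\boldsymbol a+(-1)^h\boldsymbol b-(-1)^h\boldsymbol c\rangle|,$$ with all components independent: $\alpha^{(j)}\sim\mathcal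 N^{\rm C}_E$ in $C_1$; $a_j\sim\mathcal N^{\rm C}_{z_jE}$, $b_j\sim\mathcal N^{\rm C}_{(1-z_j)E}$ in $C_2$; $a_j\sim\mathcal N^{\rm C}_{z_jE}$, $b_j\sim\mathcal N^{\rm C}_{\tilde z_jE}$, $c_j\sim\mathcal N^{\rm C}_{(1-z_j-\tilde z_j)E}$ in $C_3$. Below, $\min_{\boldsymbol\ell}$ and $\max_{\boldsymbol\ell}$ run over $\boldsymbol\ell\in\{1,\dots,L-1\}^M$. **Degenerate terms.** For $q\in\{2,3\}$ let $P_q$ be the set of words $p\in\{0,\dots,q-1\}^{ML}$ with $p_{ML}=0$, and read indices cyclically, $p_0:=p_{ML}$. The letters at the positions $M(\ell-1)+j$, $1\le\ell\le L$, belong to mode $j$; $f_a(p)\in[0,1]^M$ is the vector of the fractions of the $L$ letters of each mode that equal $a$. Let $P_q^\partial\subset P_q$ be the set of words in which every symbol $0,\dots,q-1$ occurs, but in which some symbol is missing from some mode. Put $$w(p)=4^{-ML}\,3^{\#\{n\ne k\,:\,p_n=p_{n-1}\}},\qquad \bar w(p)=\begin{cases}2w(p)&\text{if }p_k=p_{k-1},\\0&\text{otherwise,}\end{cases}$$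 $$R_2(E)=\sum_{p\in P_2^\partial}\bar w(p)\,C_2(f_0(p)),\qquad R_3(E)=\sum_{p\in P_3^\partial}w(p)\,C_3(f_0(p),f_1(p)).$$ So $R_2$ contains only correlators $C_2(\boldsymbol z)$ with some $z_j\in\{0,1\}$, and $R_3$ only correlators $C_3(\boldsymbol z,\tilde{\boldsymbol z})$ for which some $z_j$, $\tilde z_j$ or $1-z_j-\tilde z_j$ vanishes. **Statement.** There is $E_0$, depending on $L,M,k,\psi$, such that for all $E\ge E_0$ $$\mathrm{Var}[\partial_{\theta_k}\mathcal C]\ \ge\ \frac12\left[\frac{3^{ML-1}}{4^{ML}}C_1+\left(\frac14-\frac{3^{ML}}{4^{ML}}\right)\min_{\boldsymbol\ell}C_2\!\left(\frac{\boldsymbol\ell}{L}\right)\right]-\frac12R_3(E),$$ $$\mathrm{Var}[\partial_{\theta_k}\mathcal C]\ \le\ \frac12\left[\frac{3^{ML-1}}{4^{ML}}C_1+\left(\frac14+\frac{2^{ML-1}}{4^{ML}}\right)\max_{\boldsymbol\ell}C_2\!\left(\frac{\boldsymbol\ell}{L}\right)\right]+\frac12\bigl(R_2(E)+R_3(E)\bigr).$$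 In particular the contribution of the $C_3$ correlators with all $z_j,\tilde z_j,1-z_j-\tilde z_j>0$ needs no error term at all. If $M=1$, then $R_2=R_3=0$ for all $E$, so both bounds hold without any error term. In general the weights of the degenerate terms are exponentially small in $L$, for $R_3$ relative to the total weight: $$\sum_{p\in P_2^\partial}\bar w(p)\le M\left(\tfrac34\right)^L,\qquad \sum_{p\in P_3^\partial}w(p)\le 8M\left(\tfrac45\right)^L\sum_{p\in P_3}w(p).$$ -/

import Mathlib

open MeasureTheory ProbabilityTheory

noncomputable section

namespace CVCircuit

/-! ### One qubit and `M` bosonic modes in the position representation -/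

/-- Position-space wavefunctions of `M` modes, `x_j = (m_j + m_j†) / √2`. -/
abbrev Wave (M : ℕ) : Type := (Fin M → ℝ) → ℂ

/-- The inner product `⟨f|g⟩` of `L²(ℝ^M)`, conjugate-linear in the first argument. -/
def braket {M : ℕ} (f g : Wave M) : ℂ := ∫ x, starRingEnd ℂ (f x) * g x

/-- The displacement operator `D(β) = exp(β m† - β* m) = exp(i√2 (Im β · x - Re β · p))` of one
mode, where `m = (x + i p) / √2` and `p = -i d/dx`. -/
def displace (β : ℂ) (f : ℝ → ℂ) : ℝ → ℂ := fun x =>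
  Complex.exp (Complex.I * ((√2 * β.im * x - β.re * β.im : ℝ) : ℂ)) * f (x - √2 * β.re)

/-- The displacement operator acting on mode `j` and trivially on the other modes. -/
def displaceMode {M : ℕ} (j : Fin M) (β : ℂ) (f : Wave M) : Wave M := fun x =>
  displace β (fun t => f (Function.update x j t)) (x j)

/-- The vacuum of one mode, `π^(-1/4) exp(-x²/2)`. -/
def vacuum : ℝ → ℂ := fun x => ((Real.pi ^ (-(1 / 4) : ℝ) * Real.exp (-x ^ 2 / 2) : ℝ) : ℂ)

/-- The product coherent state `⨂_j D(α_j)|0⟩`. -/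
def coherent {M : ℕ} (α : Fin M → ℂ) : Wave M := fun x => ∏ j, displace (α j) vacuum (x j)

/-- Vectors `|0⟩ ⊗ Ψ 0 + |1⟩ ⊗ Ψ 1` of the qubit and the `M` modes. -/
abbrev Register (M : ℕ) : Type := Fin 2 → Wave M

def pauliX : Matrix (Fin 2) (Fin 2) ℂ := !![0, 1; 1, 0]

def pauliY : Matrix (Fin 2) (Fin 2) ℂ := !![0, -Complex.I; Complex.I, 0]

/-- `U_R(θ, φ) = exp(-i θ/2 (cos φ σ^x + sin φ σ^y))`. -/
def qubitRotation (θ φ : ℝ) : Matrix (Fin 2) (Fin 2) ℂ :=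
  NormedSpace.exp ((-Complex.I * ((θ / 2 : ℝ) : ℂ)) •
    ((Real.cos φ : ℂ) • pauliX + (Real.sin φ : ℂ) • pauliY))

/-- A qubit operator acting on the register. -/
def applyQubit {M : ℕ} (R : Matrix (Fin 2) (Fin 2) ℂ) (Ψ : Register M) : Register M :=
  fun a x => ∑ b, R a b * Ψ b x

/-- The gate `D(β) ⊗ |1⟩⟨0| + D(-β) ⊗ |0⟩⟨1|` on the qubit and mode `j`. -/
def ecd {M : ℕ} (j : Fin M) (β : ℂ) (Ψ : Register M) : Register M :=
  ![displaceMode j (-β) (Ψ 1), displaceMode j β (Ψ 0)]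

/-! ### The circuit ensemble

The `L M` blocks are numbered `n = 0, …, L M - 1` in their order of application; block
`n = M (ℓ - 1) + (j - 1)` belongs to layer `ℓ` and acts on mode `j`, so that its mode is the
residue `n.modNat` of `n` modulo `M`. -/

/-- Displacements, angles `θ` and angles `φ` of all blocks. -/
abbrev Params (L M : ℕ) : Type := (Fin (L * M) → ℂ) × (Fin (L * M) → ℝ) × (Fin (L * M) → ℝ)

/-- The state `U |0⟩_q |0⟩^{⊗ M}`. -/
def outputState (L M : ℕ) (p : Params L M) : Register M :=
  (List.finRange (L * M)).foldl
    (fun Ψ n => ecd n.modNat (p.1 n) (applyQubit (qubitRotation (p.2.1 n) (p.2.2 n)) Ψ))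
    ![coherent 0, 0]

/-- The law `N^C_v`: independent real and imaginary parts, each centered Gaussian of variance
`v/2`. It is the point mass at `0` for `v = 0`. -/
def complexGaussian (v : ℝ) : Measure ℂ :=
  ((gaussianReal 0 (v / 2).toNNReal).prod (gaussianReal 0 (v / 2).toNNReal)).map
    (fun t => (t.1 : ℂ) + (t.2 : ℂ) * Complex.I)

/-- The uniform law on `[0, 2π)`. -/
def uniformAngle : Measure ℝ := cond volume (Set.Ico 0 (2 * Real.pi))

/-- The law of the parameters: all independent, displacements `N^C_{E/L}`, uniform angles. -/
def ensemble (E : ℝ) (L M : ℕ) : Measure (Params L M) :=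
  (Measure.pi fun _ => complexGaussian (E / L)).prod
    ((Measure.pi fun _ => uniformAngle).prod (Measure.pi fun _ => uniformAngle))

/-! ### Cost function and gradient -/

/-- The observable `|0⟩⟨0| ⊗ |ψ⟩⟨ψ|`. -/
def observable {M : ℕ} (ψ : Wave M) (Ψ : Register M) : Register M :=
  ![fun x => braket ψ (Ψ 0) * ψ x, 0]

/-- The cost `⟨Ψ|O|Ψ⟩` of the output state `Ψ`. -/
def cost {L M : ℕ} (ψ : Wave M) (p : Params L M) : ℝ :=
  (∑ a, braket (outputState L M p a) (observable ψ (outputState L M p) a)).re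

/-- The partial derivative of the cost with respect to the rotation angle `θ_k`. -/
def costGradient {L M : ℕ} (ψ : Wave M) (k : Fin (L * M)) (p : Params L M) : ℝ :=
  deriv (fun t => cost ψ ((p.1, Function.update p.2.1 k t, p.2.2) : Params L M)) (p.2.1 k)

/-- `Var[∂_{θ_k} C]` over the ensemble. -/
def gradientVariance (L M : ℕ) (ψ : Wave M) (k : Fin (L * M)) (E : ℝ) : ℝ :=
  variance (fun p : Params L M => costGradient ψ k p) (ensemble E L M)

/-! ### Coherent-state correlators -/

/-- The law of a vector of independent components `α_j ∼ N^C_{z_j E}`. -/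
def gaussianVector {M : ℕ} (E : ℝ) (z : Fin M → ℝ) : Measure (Fin M → ℂ) :=
  Measure.pi fun j => complexGaussian (z j * E)

def C₁ {M : ℕ} (ψ : Wave M) (E : ℝ) : ℝ :=
  ∫ α, ‖braket ψ (coherent α)‖ ^ 4 ∂(gaussianVector E fun _ => 1)

def C₂ {M : ℕ} (ψ : Wave M) (E : ℝ) (z : Fin M → ℝ) : ℝ :=
  ∫ α, ∏ h : Fin 2, ‖braket ψ (coherent (α.1 + (-1 : ℂ) ^ (h : ℕ) • α.2))‖ ^ 2
    ∂((gaussianVector E z).prod (gaussianVector E (1 - z)))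

def C₃ {M : ℕ} (ψ : Wave M) (E : ℝ) (z z' : Fin M → ℝ) : ℝ :=
  ∫ α, ∏ h : Fin 2,
      (‖braket ψ (coherent (α.1 + (-1 : ℂ) ^ (h : ℕ) • α.2.1 + (-1 : ℂ) ^ (h : ℕ) • α.2.2))‖ *
        ‖braket ψ (coherent (α.1 + (-1 : ℂ) ^ (h : ℕ) • α.2.1 - (-1 : ℂ) ^ (h : ℕ) • α.2.2))‖)
    ∂((gaussianVector E z).prod ((gaussianVector E z').prod (gaussianVector E (1 - z - z'))))

/-- The minimum of `C₂(ℓ/L)` over `ℓ ∈ {1, …, L-1}^M`. -/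
def minC₂ {M : ℕ} (ψ : Wave M) (E : ℝ) (L : ℕ) : ℝ :=
  ⨅ l : Fin M → Finset.Icc 1 (L - 1), C₂ ψ E fun j => ((l j : ℕ) : ℝ) / L

/-- The maximum of `C₂(ℓ/L)` over `ℓ ∈ {1, …, L-1}^M`. -/
def maxC₂ {M : ℕ} (ψ : Wave M) (E : ℝ) (L : ℕ) : ℝ :=
  ⨆ l : Fin M → Finset.Icc 1 (L - 1), C₂ ψ E fun j => ((l j : ℕ) : ℝ) / L

/-! ### Patterns: the terms with a degenerate mode

A pattern assigns a symbol to every block, the last block having symbol `0`. With two symbols it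
records where two sign vectors agree (`0`) or differ (`1`); with three symbols it records which of
the three relations `s = s' = r = r'`, `s = s' ≠ r = r'`, `s = r' ≠ s' = r` four sign vectors
satisfy at the block. -/

/-- All patterns with symbols `0, …, q - 1`. -/
def patterns (L M q : ℕ) [NeZero q] : Finset (Fin (L * M) → Fin q) :=
  {p | ∀ n : Fin (L * M), (n : ℕ) + 1 = L * M → p n = 0}

open Classical in
/-- The patterns in which all symbols occur, but some symbol is missing from some mode. -/
def degeneratePatterns (L M q : ℕ) [NeZero q] : Finset (Fin (L * M) → Fin q) :=
  {p ∈ patterns L M q | Function.Surjective p ∧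
    ∃ (j : Fin M) (a : Fin q), ∀ n : Fin (L * M), n.modNat = j → p n ≠ a}

/-- The fraction of the `L` blocks of mode `j` that carry the symbol `a`. -/
def fraction {L M q : ℕ} (p : Fin (L * M) → Fin q) (a : Fin q) (j : Fin M) : ℝ :=
  (Finset.card {n : Fin (L * M) | n.modNat = j ∧ p n = a} : ℝ) / L

/-- `4^{-LM} 3^r`, with `r` the number of blocks `n ≠ k` whose symbol equals that of the cyclically
preceding block. -/
def weight {L M q : ℕ} (k : Fin (L * M)) (p : Fin (L * M) → Fin q) : ℝ :=
  (∏ n ∈ Finset.univ.erase k, if p n = p ((finRotate (L * M)).symm n) then (3 : ℝ) else 1) /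
    4 ^ (L * M)

/-- Twice the weight if block `k` carries the symbol of the cyclically preceding block, else `0`. -/
def pairWeight {L M q : ℕ} (k : Fin (L * M)) (p : Fin (L * M) → Fin q) : ℝ :=
  if p k = p ((finRotate (L * M)).symm k) then 2 * weight k p else 0

/-- The contribution of the correlators `C₂(z)` for which some `z_j` is `0` or `1`. -/
def boundaryC₂ {L M : ℕ} (ψ : Wave M) (E : ℝ) (k : Fin (L * M)) : ℝ :=
  ∑ p ∈ degeneratePatterns L M 2, pairWeight k p * C₂ ψ E (fraction p 0)

/-- The contribution of the correlators `C₃(z, z')` for which some `z_j`, `z'_j` or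
`1 - z_j - z'_j` is `0`. -/
def boundaryC₃ {L M : ℕ} (ψ : Wave M) (E : ℝ) (k : Fin (L * M)) : ℝ :=
  ∑ p ∈ degeneratePatterns L M 3, weight k p * C₃ ψ E (fraction p 0) (fraction p 1)

end CVCircuit

end

open CVCircuit

noncomputable section

namespace CVCircuit

/-! ### Transfer sums over words -/

/-! Expanding every rotation in the qubit basis turns the amplitude of the output state on `ψ` into
a sum over bit strings, or paths. A path contributes a product of rotation matrix elements, a
unimodular Weyl phase, and the overlap of `ψ` with a coherent state displaced by a signed sum of the
`β`'s (`runCircuit_eq_sum_paths`, `exists_pathCoefficients`). The gradient is then a double sum over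
paths of mean zero, and its variance is a sum over quadruples of paths (`gradientVariance_eq_sum`).

The average over the `φ`'s imposes a conservation law on the four bits at each block. It leaves
three possible relations between them, so a surviving quadruple is a three-letter word together with
its first path (`mem_range_patternQuad`). The average over the `θ`'s attaches to the word its weight
and a sign (`blockValue_pattern`). For the average over displacements, the signed sums over blocks
with equal letters are independent Gaussian vectors (`map_groupSums`). If the word uses only the
letters `0, 1` or only `0, 2`, the four paths coincide in pairs, the Weyl phases cancel, and the
correlator is exactly `C₂`. The two families carry equal weights; their signs agree if the letter
does not change at block `k` and are opposite otherwise, which produces `pairWeight`. The constant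
word lies in both families but counts once, and gives `C₁`. For words with all three letters only
the modulus is controlled, by `C₃`. The outcome, `abs_gradientVariance_sub_le`, holds for every `E ≥
0`.

The rest is a comparison of decay rates. A nondegenerate Gaussian vector has density at most a
constant times `E^{-M}`, and the Husimi function of `ψ` is integrable
(`lintegral_braket_sq_lt_top`), so nondegenerate `C₂` are `O(E^{-2M})` (`C₂_le`). Conversely `C₂` is
at least a constant times `E^{-2M}`, with a smaller exponent when some mode is degenerate (`le_C₂`);
this needs a point where the amplitude and a reflected amplitude are both nonzero, which analyticity
supplies. Nondegenerate `C₃` are `o(E^{-2M})`: their third Gaussian argument escapes to infinity,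
where the autocorrelation of the amplitude vanishes (`eventually_C₃_le`). Hence for large `E` the
nondegenerate `C₃` terms cost at most one multiple `s = 3^(LM-1)/4^(LM)` of the minimal `C₂`, and
degenerate `C₂` terms only help the lower bound. The total pair weight `1/4 + 2^(LM-1)/4^(LM)`
leaves exactly enough room for that.

All sums of weights are entries of products of transition matrices, computed by common eigenvectors
or bounded by row sums (`chainSum_eigenvector`, `chainSum_le`). -/

/-- The sum over words `p` of the products of the transition weights `g i (p (i - 1)) (p i)`, the
letter before the first one being `x`, with final weight `h`. -/
def chainSum {α R : Type*} [Fintype α] [CommRing R] {N : ℕ} (g : Fin N → α → α → R) (h : α → R)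
    (x : α) : R :=
  ∑ p : Fin N → α, (∏ i, g i ((Fin.cons x p : Fin (N + 1) → α) i.castSucc) (p i)) *
    h ((Fin.cons x p : Fin (N + 1) → α) (Fin.last N))

lemma chainSum_zero {α R : Type*} [Fintype α] [CommRing R] (g : Fin 0 → α → α → R) (h : α → R)
    (x : α) : chainSum g h x = h x := by
  simp [chainSum]

lemma chainSum_succ {α R : Type*} [Fintype α] [CommRing R] {N : ℕ}
    (g : Fin (N + 1) → α → α → R) (h : α → R) (x : α) :
    chainSum g h x = ∑ y, g 0 x y * chainSum (fun i => g i.succ) h y := by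
  unfold chainSum
  rw [← (Fin.consEquiv (fun _ : Fin (N + 1) => α)).sum_comp, Fintype.sum_prod_type]
  refine Finset.sum_congr rfl fun y _ => ?_
  rw [Finset.mul_sum]
  refine Finset.sum_congr rfl fun p _ => ?_
  rw [Fin.prod_univ_succ, mul_assoc]
  simp only [Fin.consEquiv_apply, Fin.castSucc_zero, Fin.cons_zero, ← Fin.succ_castSucc,
    Fin.cons_succ, ← Fin.succ_last]

/-- The transition matrices may differ from block to block; a common right eigenvector makes each
contribute only its eigenvalue. -/
lemma chainSum_eigenvector {α R : Type*} [Fintype α] [CommRing R] {N : ℕ}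
    (g : Fin N → α → α → R) (h : α → R) (c : Fin N → R)
    (hg : ∀ i x, ∑ y, g i x y * h y = c i * h x) (x : α) :
    chainSum g h x = (∏ i, c i) * h x := by
  induction N generalizing x with
  | zero => simp [chainSum_zero]
  | succ N ih =>
    rw [chainSum_succ]
    simp_rw [ih (fun i => g i.succ) (fun i => c i.succ) (fun i => hg i.succ)]
    rw [Fin.prod_univ_succ, mul_comm (c 0), mul_assoc, ← hg 0 x, Finset.mul_sum]
    exact Finset.sum_congr rfl fun y _ => by ring

lemma chainSum_add {α R : Type*} [Fintype α] [CommRing R] {N : ℕ}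
    (g : Fin N → α → α → R) (h h' : α → R) (x : α) :
    chainSum g (fun y => h y + h' y) x = chainSum g h x + chainSum g h' x := by
  simp only [chainSum, mul_add, Finset.sum_add_distrib]

lemma chainSum_le {α : Type*} [Fintype α] {N : ℕ} (g : Fin N → α → α → ℝ) (c : Fin N → ℝ)
    (hg0 : ∀ i x y, 0 ≤ g i x y) (hc : ∀ i, 0 ≤ c i) (hg : ∀ i x, ∑ y, g i x y ≤ c i) (x : α) :
    chainSum g (fun _ => 1) x ≤ ∏ i, c i := by
  induction N generalizing x with
  | zero => simp [chainSum_zero]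
  | succ N ih =>
    rw [chainSum_succ, Fin.prod_univ_succ]
    calc ∑ y, g 0 x y * chainSum (fun i => g i.succ) (fun _ => 1) y
        ≤ ∑ y, g 0 x y * ∏ i : Fin N, c i.succ :=
          Finset.sum_le_sum fun y _ => mul_le_mul_of_nonneg_left
            (ih _ _ (fun i => hg0 i.succ) (fun i => hc i.succ) (fun i => hg i.succ) y) (hg0 0 x y)
      _ ≤ _ := by
          rw [← Finset.sum_mul]
          exact mul_le_mul_of_nonneg_right (hg 0 x) (Finset.prod_nonneg fun i _ => hc _)

/-- The last of `N` blocks. -/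
def lastBlock {N : ℕ} (hN : 0 < N) : Fin N := ⟨N - 1, by omega⟩

lemma eq_lastBlock_iff {N : ℕ} (hN : 0 < N) (n : Fin N) : (n : ℕ) + 1 = N ↔ n = lastBlock hN := by
  rw [Fin.ext_iff, show ((lastBlock hN : Fin N) : ℕ) = N - 1 from rfl]
  omega

lemma cons_last_eq {α : Type*} {N : ℕ} (hN : 0 < N) (p : Fin N → α) (x : α) :
    (Fin.cons x p : Fin (N + 1) → α) (Fin.last N) = p (lastBlock hN) := by
  cases N with
  | zero => omega
  | succ N => rw [← Fin.succ_last, Fin.cons_succ]; rfl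

/-- Once the last letter is fixed to be `x`, the cyclic convention for the predecessor of the first
block amounts to starting an open chain at `x`. -/
lemma cyclic_pred_eq {α : Type*} {N : ℕ} (hN : 0 < N) (p : Fin N → α) (x : α)
    (hp : p (lastBlock hN) = x) (n : Fin N) :
    p ((finRotate N).symm n) = (Fin.cons x p : Fin (N + 1) → α) n.castSucc := by
  cases N with
  | zero => omega
  | succ N =>
    refine Fin.cases ?_ (fun i => ?_) n
    · rw [Fin.castSucc_zero, Fin.cons_zero, ← hp]
      congr 1
    · rw [← Fin.succ_castSucc, Fin.cons_succ]
      congr 1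
      rw [Equiv.symm_apply_eq]
      rw [finRotate_apply, Fin.coeSucc_eq_succ]

/-- A sum over closed words through `x` is a diagonal entry of the product of the transition
matrices. -/
lemma sum_cyclic_eq_chainSum {α R : Type*} [Fintype α] [DecidableEq α] [CommRing R] {N : ℕ}
    (hN : 0 < N) (g : Fin N → α → α → R) (x : α) :
    ∑ p : Fin N → α with p (lastBlock hN) = x, ∏ n, g n (p ((finRotate N).symm n)) (p n)
      = chainSum g (fun y => if y = x then 1 else 0) x := by
  rw [chainSum, Finset.sum_filter]
  refine Finset.sum_congr rfl fun p _ => ?_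
  rw [cons_last_eq hN]
  split_ifs with h
  · rw [mul_one]
    exact Finset.prod_congr rfl fun n _ => by rw [cyclic_pred_eq hN p x h]
  · simp

/-! ### Total weights of all patterns and of the degenerate ones -/

lemma patterns_eq {L M q : ℕ} [NeZero q] (hN : 0 < L * M) :
    patterns L M q = Finset.univ.filter fun p => p (lastBlock hN) = 0 := by
  ext p
  simp only [patterns, eq_lastBlock_iff hN, Finset.mem_filter, Finset.mem_univ, true_and,
    forall_eq]

/-- The factor of `weight` from block `n`. -/
def stepWeight {N q : ℕ} (k n : Fin N) (x y : Fin q) : ℝ :=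
  (if n = k then 1 else if y = x then 3 else 1) / 4

/-- The factor of `pairWeight` from block `n`. -/
def pairStepWeight {N q : ℕ} (k n : Fin N) (x y : Fin q) : ℝ :=
  if n = k then if y = x then 1 / 2 else 0 else if y = x then 3 / 4 else 1 / 4

lemma weight_eq_prod {L M q : ℕ} (k : Fin (L * M)) (p : Fin (L * M) → Fin q) :
    weight k p = ∏ n, stepWeight k n (p ((finRotate (L * M)).symm n)) (p n) := by
  simp only [weight, stepWeight]
  rw [Finset.prod_div_distrib, Finset.prod_const, Finset.card_univ, Fintype.card_fin,
    ← Finset.mul_prod_erase _ _ (Finset.mem_univ k), if_pos rfl, one_mul]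
  congr 1
  exact Finset.prod_congr rfl fun n hn => by rw [if_neg (Finset.ne_of_mem_erase hn)]

lemma pairWeight_eq_prod {L M q : ℕ} (k : Fin (L * M)) (p : Fin (L * M) → Fin q) :
    pairWeight k p = ∏ n, pairStepWeight k n (p ((finRotate (L * M)).symm n)) (p n) := by
  rw [pairWeight, weight_eq_prod, ← Finset.mul_prod_erase _ _ (Finset.mem_univ k),
    ← Finset.mul_prod_erase _ _ (Finset.mem_univ k)]
  have : ∏ n ∈ Finset.univ.erase k, stepWeight k n (p ((finRotate (L * M)).symm n)) (p n)
      = ∏ n ∈ Finset.univ.erase k, pairStepWeight k n (p ((finRotate (L * M)).symm n)) (p n) :=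
    Finset.prod_congr rfl fun n hn => by
      rw [stepWeight, pairStepWeight, if_neg (Finset.ne_of_mem_erase hn),
        if_neg (Finset.ne_of_mem_erase hn)]
      split_ifs <;> norm_num
  rw [this, stepWeight, pairStepWeight, if_pos rfl, if_pos rfl]
  split_ifs <;> ring

lemma stepWeight_pos {N q : ℕ} (k n : Fin N) (x y : Fin q) : 0 < stepWeight k n x y := by
  rw [stepWeight]; split_ifs <;> norm_num

lemma pairStepWeight_nonneg {N q : ℕ} (k n : Fin N) (x y : Fin q) :
    0 ≤ pairStepWeight k n x y := by
  rw [pairStepWeight]; split_ifs <;> norm_num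

lemma weight_pos {L M q : ℕ} (k : Fin (L * M)) (p : Fin (L * M) → Fin q) : 0 < weight k p := by
  rw [weight_eq_prod]; exact Finset.prod_pos fun n _ => stepWeight_pos _ _ _ _

lemma pairWeight_nonneg {L M q : ℕ} (k : Fin (L * M)) (p : Fin (L * M) → Fin q) :
    0 ≤ pairWeight k p := by
  rw [pairWeight_eq_prod]; exact Finset.prod_nonneg fun n _ => pairStepWeight_nonneg _ _ _ _

lemma prod_ite_eq_single {N : ℕ} (k : Fin N) (a b : ℝ) :
    ∏ n, (if n = k then a else b) = a * b ^ (N - 1) := by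
  rw [← Finset.mul_prod_erase _ _ (Finset.mem_univ k), if_pos rfl,
    Finset.prod_congr rfl fun n hn => if_neg (Finset.ne_of_mem_erase hn), Finset.prod_const,
    Finset.card_erase_of_mem (Finset.mem_univ k), Finset.card_univ, Fintype.card_fin]

/-- Both `(1, 1)` and `(1, -1)` are eigenvectors of all two-letter transition matrices. Their
eigenvalues are `1` and `1/2` away from block `k`, and both are `1/2` at block `k`. The indicator of
the letter `0` is half the sum of the two vectors. -/
lemma sum_pairWeight_patterns {L M : ℕ} (k : Fin (L * M)) :
    ∑ p ∈ patterns L M 2, pairWeight k p = 1 / 4 + 2 ^ (L * M - 1) / 4 ^ (L * M) := by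
  have hN : 0 < L * M := k.pos
  have hd : (fun y : Fin 2 => if y = 0 then (1 : ℝ) else 0)
      = fun y => (fun _ => 1 / 2) y + (fun y => if y = 0 then 1 / 2 else -1 / 2) y := by
    funext y; fin_cases y <;> norm_num
  simp_rw [pairWeight_eq_prod]
  rw [patterns_eq hN, sum_cyclic_eq_chainSum hN (pairStepWeight k), hd, chainSum_add,
    chainSum_eigenvector _ _ (fun n => if n = k then 1 / 2 else 1),
    chainSum_eigenvector _ _ (fun n => if n = k then 1 / 2 else 1 / 2),
    prod_ite_eq_single, prod_ite_eq_single]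
  · obtain ⟨m, hm⟩ : ∃ m, L * M = m + 1 := ⟨L * M - 1, by omega⟩
    rw [hm, Nat.add_sub_cancel, if_pos rfl, pow_succ, show (4 : ℝ) = 2 * 2 by norm_num, mul_pow]
    field_simp
    rw [one_pow, add_mul, ← mul_pow]; norm_num
  · intro n x
    clear hd
    by_cases hk : n = k <;> fin_cases x <;> simp [pairStepWeight, Fin.sum_univ_two, hk] <;> norm_num
  · intro n x
    clear hd
    by_cases hk : n = k <;> fin_cases x <;> simp [pairStepWeight, Fin.sum_univ_two, hk] <;> norm_num

/-- The indicator of `0` splits into a constant vector and a vector of sum zero. Block `k` has all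
transition weights equal, so it annihilates the second one, and only the constant vector, with
eigenvalue `5/4` per block and `3/4` at `k`, contributes. -/
lemma sum_weight_patterns_three {L M : ℕ} (k : Fin (L * M)) :
    ∑ p ∈ patterns L M 3, weight k p = 5 ^ (L * M - 1) / 4 ^ (L * M) := by
  have hN : 0 < L * M := k.pos
  have hd : (fun y : Fin 3 => if y = 0 then (1 : ℝ) else 0)
      = fun y => (fun _ => 1 / 3) y + (fun y => if y = 0 then 2 / 3 else -1 / 3) y := by
    funext y; fin_cases y <;> norm_num
  simp_rw [weight_eq_prod]
  rw [patterns_eq hN, sum_cyclic_eq_chainSum hN (stepWeight k), hd, chainSum_add,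
    chainSum_eigenvector _ _ (fun n => if n = k then 3 / 4 else 5 / 4),
    chainSum_eigenvector _ _ (fun n => if n = k then 0 else 1 / 2),
    prod_ite_eq_single, prod_ite_eq_single]
  · obtain ⟨m, hm⟩ : ∃ m, L * M = m + 1 := ⟨L * M - 1, by omega⟩
    rw [hm, Nat.add_sub_cancel, pow_succ, div_pow]
    ring
  · intro n x
    clear hd
    by_cases hk : n = k <;> fin_cases x <;> simp [stepWeight, Fin.sum_univ_three, hk] <;> norm_num
  · intro n x
    clear hd
    by_cases hk : n = k <;> fin_cases x <;> simp [stepWeight, Fin.sum_univ_three, hk] <;> norm_num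

lemma card_filter_modNat {L M : ℕ} (j : Fin M) :
    Finset.card {n : Fin (L * M) | n.modNat = j} = L := by
  rw [← Fintype.card_subtype]
  refine (Fintype.card_congr ⟨fun n => n.1.divNat,
    fun l => ⟨finProdFinEquiv (l, j), ?_⟩, fun n => ?_, fun l => ?_⟩ :
    Fintype.card {n : Fin (L * M) // n.modNat = j} = Fintype.card (Fin L)).trans (Fintype.card_fin L)
  · exact congrArg Prod.snd (finProdFinEquiv.symm_apply_apply (l, j))
  · ext1
    have h := finProdFinEquiv.apply_symm_apply n.1
    rw [finProdFinEquiv_symm_apply, n.2] at h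
    exact h
  · exact congrArg Prod.fst (finProdFinEquiv.symm_apply_apply (l, j))

/-- The patterns without symbol `a` in mode `j`. -/
def patternsWithout (L M q : ℕ) [NeZero q] (j : Fin M) (a : Fin q) :
    Finset (Fin (L * M) → Fin q) :=
  {p ∈ patterns L M q | ∀ n : Fin (L * M), n.modNat = j → p n ≠ a}

/-- Union bound over the mode and the symbol missing from it. -/
lemma sum_degeneratePatterns_le {L M q : ℕ} [NeZero q] (w : (Fin (L * M) → Fin q) → ℝ)
    (hw : ∀ p, 0 ≤ w p) :
    ∑ p ∈ degeneratePatterns L M q, w p ≤ ∑ j, ∑ a, ∑ p ∈ patternsWithout L M q j a, w p := by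
  classical
  have h1 : ∀ j a, ∑ p ∈ patternsWithout L M q j a, w p
      = ∑ p, if p ∈ patternsWithout L M q j a then w p else 0 := fun j a => by
    rw [Finset.sum_ite_mem, Finset.univ_inter]
  have h2 : ∀ j a p, 0 ≤ if p ∈ patternsWithout L M q j a then w p else 0 := fun j a p => by
    split_ifs <;> simp [hw]
  simp_rw [h1, Finset.sum_comm (s := Finset.univ (α := Fin q)) (t := Finset.univ
    (α := Fin (L * M) → Fin q))]
  rw [Finset.sum_comm, ← Finset.univ_inter (degeneratePatterns L M q), ← Finset.sum_ite_mem]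
  refine Finset.sum_le_sum fun p _ => ?_
  split_ifs with hp
  · simp only [degeneratePatterns, Finset.mem_filter] at hp
    obtain ⟨hp, -, j, a, hja⟩ := hp
    refine le_trans ?_ (Finset.single_le_sum
      (fun j _ => Finset.sum_nonneg fun a _ => h2 j a p) (Finset.mem_univ j))
    refine le_trans ?_ (Finset.single_le_sum (fun a _ => h2 j a p) (Finset.mem_univ a))
    rw [if_pos (show p ∈ patternsWithout L M q j a from Finset.mem_filter.2 ⟨hp, hja⟩)]
  · exact Finset.sum_nonneg fun j _ => Finset.sum_nonneg fun a _ => h2 j a p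

/-- Whether the letter `y` is allowed at block `n` in `patternsWithout`. -/
def Allowed {L M q : ℕ} [NeZero q] (j : Fin M) (a : Fin q) (n : Fin (L * M)) (y : Fin q) : Prop :=
  (n.modNat = j → y ≠ a) ∧ ((n : ℕ) + 1 = L * M → y = 0)

open Classical in
-- Forbidden letters become vanishing columns of the transition matrices, and the remaining chain is
-- bounded by the product of the row sums.
lemma sum_patternsWithout_le {L M q : ℕ} [NeZero q] (hN : 0 < L * M) (j : Fin M) (a : Fin q)
    (g : Fin (L * M) → Fin q → Fin q → ℝ) (hg : ∀ n x y, 0 ≤ g n x y) (c : Fin (L * M) → ℝ)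
    (hc : ∀ n x, ∑ y, (if Allowed j a n y then g n x y else 0) ≤ c n) :
    ∑ p ∈ patternsWithout L M q j a, ∏ n, g n (p ((finRotate (L * M)).symm n)) (p n)
      ≤ ∏ n, c n := by
  have hg' : ∀ n x y, 0 ≤ (if Allowed j a n y then g n x y else 0) := fun n x y => by
    split_ifs <;> simp [hg]
  refine le_trans ?_ (chainSum_le (fun n x y => if Allowed j a n y then g n x y else 0) c hg'
    (fun n => (Finset.sum_nonneg fun y _ => hg' n 0 y).trans (hc n 0)) hc 0)
  rw [chainSum, patternsWithout, patterns_eq hN, Finset.filter_filter, Finset.sum_filter]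
  refine Finset.sum_le_sum fun p _ => ?_
  split_ifs with h
  · rw [mul_one]
    refine le_of_eq (Finset.prod_congr rfl fun n _ => ?_)
    rw [cyclic_pred_eq hN p 0 h.1, if_pos]
    exact ⟨h.2 n, fun hn => by rw [(eq_lastBlock_iff hN n).1 hn]; exact h.1⟩
  · rw [mul_one]
    exact Finset.prod_nonneg fun n _ => hg' _ _ _

lemma sum_pairWeight_patternsWithout_le {L M : ℕ} (k : Fin (L * M)) (j : Fin M) :
    ∑ a, ∑ p ∈ patternsWithout L M 2 j a, pairWeight k p ≤ (3 / 4 : ℝ) ^ L := by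
  classical
  have hN : 0 < L * M := k.pos
  have hL : 0 < L := Nat.pos_of_mul_pos_right hN
  -- At these blocks some letter is forbidden, so at most one of the two survives and the row sum
  -- drops from `1` to at most `3/4`. Block `k` is kept apart, with row sum at most `1/2`.
  set S : Finset (Fin (L * M)) := {n | n ≠ k ∧ (n.modNat = j ∨ n = lastBlock hN)} with hS
  have key : ∀ a, ∑ p ∈ patternsWithout L M 2 j a, pairWeight k p
      ≤ 1 / 2 * (3 / 4 : ℝ) ^ S.card := fun a => by
    simp_rw [pairWeight_eq_prod]
    refine (sum_patternsWithout_le hN j a (pairStepWeight k) (pairStepWeight_nonneg k)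
      (fun n => if n = k then 1 / 2 else if n ∈ S then 3 / 4 else 1) fun n x => ?_).trans ?_
    · by_cases hk : n = k
      · rw [if_pos hk]
        refine (Finset.sum_le_sum (g := fun y => pairStepWeight k n x y) fun y _ => ?_).trans ?_
        · split_ifs
          exacts [le_rfl, pairStepWeight_nonneg _ _ _ _]
        · fin_cases x <;> simp [pairStepWeight, hk]
      · rw [if_neg hk]
        split_ifs with hn
        · have h3 : ∀ y : Fin 2, pairStepWeight k n x y ≤ 3 / 4 := fun y => by
            simp only [pairStepWeight, if_neg hk]; split_ifs <;> norm_num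
          have hy : ∃ y : Fin 2, ¬ Allowed j a n y := by
            rcases (Finset.mem_filter.1 hn).2.2 with h | h
            · exact ⟨a, fun h' => h'.1 h rfl⟩
            · exact ⟨1, fun h' => by simpa using h'.2 ((eq_lastBlock_iff hN n).2 h)⟩
          obtain ⟨y, hy⟩ := hy
          have h0 : (0 : ℝ) ≤ 3 / 4 := by norm_num
          rw [Fin.sum_univ_two]
          fin_cases y
          · simp only [Fin.zero_eta] at hy
            rw [if_neg hy, zero_add]; split_ifs
            exacts [h3 1, h0]
          · simp only [Fin.mk_one] at hy
            rw [if_neg hy, add_zero]; split_ifs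
            exacts [h3 0, h0]
        · refine (Finset.sum_le_sum (g := fun y => pairStepWeight k n x y) fun y _ => ?_).trans ?_
          · split_ifs
            exacts [le_rfl, pairStepWeight_nonneg _ _ _ _]
          · fin_cases x <;> simp [pairStepWeight, hk, Fin.sum_univ_two] <;> norm_num
    · rw [← Finset.mul_prod_erase _ _ (Finset.mem_univ k), if_pos rfl]
      refine le_of_eq (congrArg _ ?_)
      rw [Finset.prod_congr rfl fun n hn => if_neg (Finset.ne_of_mem_erase hn),
        Finset.prod_ite, Finset.prod_const, Finset.prod_const_one, mul_one]
      congr 2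
      ext n
      simp only [hS, Finset.mem_filter, Finset.mem_erase, Finset.mem_univ, true_and, and_true]
      tauto
  have hmode := card_filter_modNat (L := L) j
  by_cases hl : (lastBlock hN).modNat = j
  · have hcard : L - 1 ≤ S.card := by
      have h2 := Finset.pred_card_le_card_erase
        (s := ({n | n.modNat = j} : Finset (Fin (L * M)))) (a := k)
      rw [hmode] at h2
      refine h2.trans (Finset.card_le_card fun n hn => ?_)
      simp only [hS, Finset.mem_filter, Finset.mem_erase, Finset.mem_univ, true_and] at hn ⊢
      exact ⟨hn.1, Or.inl hn.2⟩
    -- The last block lies in mode `j` and carries the letter `0`, so `0` cannot be missing there;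
    -- only one of the two symbols contributes.
    have h0 : ∑ p ∈ patternsWithout L M 2 j 0, pairWeight k p = 0 := by
      refine Finset.sum_eq_zero fun p hp => ?_
      simp only [patternsWithout, patterns_eq hN, Finset.mem_filter] at hp
      exact absurd hp.1.2 (hp.2 _ hl)
    rw [Fin.sum_univ_two, h0, zero_add]
    refine (key 1).trans ?_
    calc 1 / 2 * (3 / 4 : ℝ) ^ S.card ≤ 3 / 4 * (3 / 4 : ℝ) ^ (L - 1) := by
          gcongr ?_ * ?_
          · norm_num
          · exact pow_le_pow_of_le_one (by norm_num) (by norm_num) hcard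
      _ = (3 / 4 : ℝ) ^ L := by rw [← pow_succ', Nat.sub_add_cancel hL]
  · have hcard : L ≤ S.card := by
      have h1 : (insert (lastBlock hN) ({n | n.modNat = j} : Finset (Fin (L * M)))).card
          = L + 1 := by
        rw [Finset.card_insert_of_notMem (by simpa using hl), hmode]
      have h2 := Finset.pred_card_le_card_erase
        (s := insert (lastBlock hN) ({n | n.modNat = j} : Finset (Fin (L * M)))) (a := k)
      rw [h1, Nat.add_sub_cancel] at h2
      refine h2.trans (Finset.card_le_card fun n hn => ?_)
      simp only [hS, Finset.mem_filter, Finset.mem_erase, Finset.mem_insert, Finset.mem_univ,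
        true_and] at hn ⊢
      exact ⟨hn.1, hn.2.symm⟩
    rw [Fin.sum_univ_two]
    refine (add_le_add (key 0) (key 1)).trans ?_
    rw [← add_mul, add_halves, one_mul]
    exact pow_le_pow_of_le_one (by norm_num) (by norm_num) hcard

/-- Relative to the unrestricted row sums, a forbidden letter costs a factor at most `4/5`, and the
fixed last letter another `3/4`. The exact outcome has the constant `9/4`; it is relaxed to `8/3` so
that three symbols give `8`. -/
lemma sum_weight_patternsWithout_le {L M : ℕ} (k : Fin (L * M)) (j : Fin M) (a : Fin 3) :
    ∑ p ∈ patternsWithout L M 3 j a, weight k p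
      ≤ 8 / 3 * (4 / 5 : ℝ) ^ L * (5 ^ (L * M - 1) / 4 ^ (L * M)) := by
  classical
  have hN : 0 < L * M := k.pos
  simp_rw [weight_eq_prod]
  refine (sum_patternsWithout_le hN j a (stepWeight k) (fun n x y => (stepWeight_pos k n x y).le)
    (fun n => (if n = k then 3 / 4 else 5 / 4) * ((if n = lastBlock hN then 3 / 4 else 1) *
      (if n.modNat = j then 4 / 5 else 1))) fun n x => ?_).trans ?_
  · simp only [Allowed, eq_lastBlock_iff hN n, stepWeight]
    rcases Classical.propComplete (n = k) with h1 | h1 <;>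
    rcases Classical.propComplete (n = lastBlock hN) with h2 | h2 <;>
    rcases Classical.propComplete (n.modNat = j) with h3 | h3 <;>
      simp only [h1, h2, h3, if_true, if_false, true_imp_iff, false_imp_iff, and_true] <;>
      fin_cases x <;> fin_cases a <;> simp [Fin.sum_univ_three] <;> norm_num
  · rw [Finset.prod_mul_distrib, Finset.prod_mul_distrib, prod_ite_eq_single, prod_ite_eq_single,
      one_pow, mul_one, Finset.prod_ite, Finset.prod_const, Finset.prod_const_one, mul_one,
      card_filter_modNat]
    obtain ⟨m, hm⟩ : ∃ m, L * M = m + 1 := ⟨L * M - 1, by omega⟩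
    rw [hm, Nat.add_sub_cancel, div_pow, div_pow, pow_succ]
    have : (0 : ℝ) < 4 ^ L / 5 ^ L * 5 ^ m / 4 ^ m := by positivity
    field_simp
    norm_num

lemma sum_pairWeight_degeneratePatterns_le {L M : ℕ} (k : Fin (L * M)) :
    ∑ p ∈ degeneratePatterns L M 2, pairWeight k p ≤ M * (3 / 4 : ℝ) ^ L := by
  refine (sum_degeneratePatterns_le _ (pairWeight_nonneg k)).trans ?_
  refine (Finset.sum_le_sum fun j _ => sum_pairWeight_patternsWithout_le k j).trans ?_
  rw [Finset.sum_const, Finset.card_univ, Fintype.card_fin, nsmul_eq_mul]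

lemma sum_weight_degeneratePatterns_le {L M : ℕ} (k : Fin (L * M)) :
    ∑ p ∈ degeneratePatterns L M 3, weight k p
      ≤ 8 * M * (4 / 5 : ℝ) ^ L * ∑ p ∈ patterns L M 3, weight k p := by
  refine (sum_degeneratePatterns_le _ fun p => (weight_pos k p).le).trans ?_
  refine (Finset.sum_le_sum fun j _ => Finset.sum_le_sum fun a _ =>
    sum_weight_patternsWithout_le k j a).trans (le_of_eq ?_)
  rw [sum_weight_patterns_three]
  simp only [Finset.sum_const, Finset.card_univ, Fintype.card_fin, nsmul_eq_mul]
  push_cast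
  ring

/-- With a single mode, a symbol missing from that mode does not occur at all. -/
lemma degeneratePatterns_one (L q : ℕ) [NeZero q] : degeneratePatterns L 1 q = ∅ := by
  refine Finset.filter_eq_empty_iff.2 fun p _ h => ?_
  obtain ⟨hs, j, a, hja⟩ := h
  obtain ⟨n, hn⟩ := hs a
  exact hja n (Subsingleton.elim _ _) hn

/-! ### Single gates -/

lemma matrix_two_eq_iff (a b c d a' b' c' d' : ℂ) :
    !![a, b; c, d] = !![a', b'; c', d'] ↔ a = a' ∧ b = b' ∧ c = c' ∧ d = d' := by
  refine ⟨fun h => ⟨congrFun₂ h 0 0, congrFun₂ h 0 1, congrFun₂ h 1 0, congrFun₂ h 1 1⟩, ?_⟩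
  rintro ⟨rfl, rfl, rfl, rfl⟩
  rfl

/-- The generator is diagonalized by `U = !![1, e⁻¹; e, -1]` with `e = exp(iφ)`. This matrix squares
to `2`, so its inverse is `U / 2`; the eigenvalues are `∓iθ/2`. -/
lemma qubitRotation_eq (θ φ : ℝ) : qubitRotation θ φ =
    !![(Real.cos (θ / 2) : ℂ), -Complex.I * Real.sin (θ / 2) * Complex.exp (-(φ * Complex.I));
      -Complex.I * Real.sin (θ / 2) * Complex.exp (φ * Complex.I), Real.cos (θ / 2)] := by
  set e := Complex.exp (φ * Complex.I) with he
  set e' := Complex.exp (-(φ * Complex.I)) with he'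
  have hee : e * e' = 1 := by rw [he, he', ← Complex.exp_add, add_neg_cancel, Complex.exp_zero]
  have hcos : (Real.cos φ : ℂ) = (e + e') / 2 := by
    rw [Complex.ofReal_cos, Complex.cos, he, he', neg_mul]
  have hsin : (Real.sin φ : ℂ) = (e' - e) * Complex.I / 2 := by
    rw [Complex.ofReal_sin, Complex.sin, he, he', neg_mul]
  set U : Matrix (Fin 2) (Fin 2) ℂ := !![1, e'; e, -1] with hU
  set V : Matrix (Fin 2) (Fin 2) ℂ := !![1 / 2, e' / 2; e / 2, -1 / 2] with hV
  have hUV : U * V = 1 := by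
    rw [hU, hV, Matrix.mul_fin_two, Matrix.one_fin_two, matrix_two_eq_iff]
    exact ⟨by linear_combination hee / 2, by ring, by ring, by linear_combination hee / 2⟩
  have hinv : U⁻¹ = V := Matrix.inv_eq_right_inv hUV
  have hunit : IsUnit U := IsUnit.of_mul_eq_one _ hUV
  set d : Fin 2 → ℂ := ![-Complex.I * ((θ / 2 : ℝ) : ℂ), Complex.I * ((θ / 2 : ℝ) : ℂ)] with hd
  have hdiag : ∀ u v : ℂ, Matrix.diagonal ![u, v] = !![u, 0; 0, v] := fun u v => by
    ext i j
    fin_cases i <;> fin_cases j <;> rfl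
  have hgen : (-Complex.I * ((θ / 2 : ℝ) : ℂ)) •
      ((Real.cos φ : ℂ) • pauliX + (Real.sin φ : ℂ) • pauliY) = U * Matrix.diagonal d * U⁻¹ := by
    have h2 : Complex.I * Complex.I = -1 := Complex.I_mul_I
    rw [hinv, hU, hV, hd, hcos, hsin, pauliX, pauliY, hdiag, Matrix.mul_fin_two,
      Matrix.mul_fin_two, Matrix.smul_of, Matrix.smul_of, Matrix.of_add_of, Matrix.smul_of]
    simp only [Matrix.smul_cons, Matrix.smul_empty, Matrix.cons_add_cons, Matrix.empty_add_empty,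
      smul_eq_mul]
    rw [matrix_two_eq_iff]
    push_cast
    refine ⟨?_, ?_, ?_, ?_⟩
    · linear_combination (-Complex.I * θ / 4) * hee
    · linear_combination (Complex.I * θ / 4 * (e' - e)) * h2
    · linear_combination (-Complex.I * θ / 4 * (e' - e)) * h2
    · linear_combination (Complex.I * θ / 4) * hee
  rw [qubitRotation, hgen, Matrix.exp_conj _ _ hunit, Matrix.exp_diagonal, hinv, hU, hV]
  have hexp : NormedSpace.exp d = ![Complex.cos ((θ / 2 : ℝ) : ℂ) - Complex.sin ((θ / 2 : ℝ) : ℂ) *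
      Complex.I, Complex.cos ((θ / 2 : ℝ) : ℂ) + Complex.sin ((θ / 2 : ℝ) : ℂ) * Complex.I] := by
    have h := congrFun (Pi.exp_def d)
    ext i
    rw [h i, ← Complex.exp_eq_exp_ℂ]
    fin_cases i
    · simp only [hd, Fin.zero_eta, Matrix.cons_val_zero]
      rw [sub_eq_add_neg, ← neg_mul, ← Complex.sin_neg, ← Complex.cos_neg, ← Complex.exp_mul_I]
      congr 1; ring
    · simp only [hd, Fin.mk_one, Matrix.cons_val_one, Matrix.cons_val_fin_one]
      rw [← Complex.exp_mul_I]
      congr 1; ring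
  rw [hexp, Complex.ofReal_cos, Complex.ofReal_sin, hdiag, Matrix.mul_fin_two, Matrix.mul_fin_two,
    matrix_two_eq_iff]
  refine ⟨?_, ?_, ?_, ?_⟩
  · linear_combination (Complex.cos ((θ / 2 : ℝ) : ℂ) +
      Complex.sin ((θ / 2 : ℝ) : ℂ) * Complex.I) / 2 * hee
  · ring
  · ring
  · linear_combination (Complex.cos ((θ / 2 : ℝ) : ℂ) -
      Complex.sin ((θ / 2 : ℝ) : ℂ) * Complex.I) / 2 * hee

/-- The Weyl relation. The extra phase is the exponential of `i` times a real number, which is all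
that the path sum needs to know about it. -/
lemma displace_displace (a β : ℂ) (f : ℝ → ℂ) (x : ℝ) :
    displace β (displace a f) x
      = Complex.exp (Complex.I * ((a.re * β.im - a.im * β.re : ℝ) : ℂ)) * displace (a + β) f x := by
  simp only [displace]
  have h : (√2 : ℂ) * √2 = 2 := by
    rw [← Complex.ofReal_mul, Real.mul_self_sqrt (by norm_num)]; norm_num
  rw [show x - √2 * (a + β).re = x - √2 * β.re - √2 * a.re by rw [Complex.add_re]; ring]
  simp only [← mul_assoc, ← Complex.exp_add, Complex.add_re, Complex.add_im]
  congr 2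
  push_cast
  linear_combination (-Complex.I * a.im * β.re) * h

lemma displaceMode_apply {M : ℕ} (j : Fin M) (β : ℂ) (f : Wave M) (x : Fin M → ℝ) :
    displaceMode j β f x
      = Complex.exp (Complex.I * ((√2 * β.im * x j - β.re * β.im : ℝ) : ℂ)) *
        f (Function.update x j (x j - √2 * β.re)) := rfl

lemma displaceMode_sum {M : ℕ} {ι : Type*} (s : Finset ι) (j : Fin M) (β : ℂ) (c : ι → ℂ)
    (f : ι → Wave M) :
    displaceMode j β (fun x => ∑ i ∈ s, c i * f i x)
      = fun x => ∑ i ∈ s, c i * displaceMode j β (f i) x := by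
  funext x
  simp only [displaceMode_apply, Finset.mul_sum]
  exact Finset.sum_congr rfl fun i _ => by ring

lemma displaceMode_coherent {M : ℕ} (j : Fin M) (β : ℂ) (α : Fin M → ℂ) (x : Fin M → ℝ) :
    displaceMode j β (coherent α) x
      = Complex.exp (Complex.I * (((α j).re * β.im - (α j).im * β.re : ℝ) : ℂ)) *
        coherent (Function.update α j (α j + β)) x := by
  rw [displaceMode_apply, coherent, coherent, ← Finset.mul_prod_erase _ _ (Finset.mem_univ j),
    ← Finset.mul_prod_erase _ _ (Finset.mem_univ j), Function.update_self, Function.update_self,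
    ← mul_assoc, ← mul_assoc]
  congr 1
  · exact displace_displace (α j) β vacuum (x j)
  · refine Finset.prod_congr rfl fun i hi => ?_
    rw [Function.update_of_ne (Finset.ne_of_mem_erase hi),
      Function.update_of_ne (Finset.ne_of_mem_erase hi)]

/-! ### The path sum -/

/-- The sign of the displacement for the qubit value `b`. -/
def bitSign (b : Fin 2) : ℝ := if b = 0 then 1 else -1

/-- The total displacement of each mode. -/
def totalDisplacement {N M : ℕ} (μ : Fin N → Fin M) (s : Fin N → ℝ) (β : Fin N → ℂ) : Fin M → ℂ :=
  fun j => ∑ n, if μ n = j then (s n : ℂ) * β n else 0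

/-- The register after the blocks `ecd (μ n) (β n) ∘ R n`. -/
def runCircuit {N M : ℕ} (μ : Fin N → Fin M) (R : Fin N → Matrix (Fin 2) (Fin 2) ℂ)
    (β : Fin N → ℂ) (Ψ : Register M) : Register M :=
  (List.finRange N).foldl (fun Ψ n => ecd (μ n) (β n) (applyQubit (R n) Ψ)) Ψ

lemma runCircuit_succ {N M : ℕ} (μ : Fin (N + 1) → Fin M)
    (R : Fin (N + 1) → Matrix (Fin 2) (Fin 2) ℂ) (β : Fin (N + 1) → ℂ) (Ψ : Register M) :
    runCircuit μ R β Ψ = ecd (μ (Fin.last N)) (β (Fin.last N)) (applyQubit (R (Fin.last N))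
      (runCircuit (fun n => μ n.castSucc) (fun n => R n.castSucc) (fun n => β n.castSucc) Ψ)) := by
  rw [runCircuit, List.finRange_succ_last, List.foldl_append, List.foldl_map]
  rfl

lemma ecd_applyQubit {M : ℕ} (j : Fin M) (β : ℂ) (R : Matrix (Fin 2) (Fin 2) ℂ) (Ψ : Register M)
    (a : Fin 2) :
    ecd j β (applyQubit R Ψ) a
      = displaceMode j ((bitSign (1 - a) : ℂ) * β) (fun x => ∑ c, R (1 - a) c * Ψ c x) := by
  rw [show (fun x => ∑ c, R (1 - a) c * Ψ c x) = applyQubit R Ψ (1 - a) from rfl]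
  fin_cases a <;> simp [ecd, bitSign]

/-- The product of the rotation matrix elements along the path `b` of qubit values after the
rotations. The qubit value before rotation `n` is the flip of the value after rotation `n - 1`. -/
def pathAmplitude {N : ℕ} (R : Fin N → Matrix (Fin 2) (Fin 2) ℂ) (b : Fin N → Fin 2) : ℂ :=
  ∏ n, R n (b n) (1 - (Fin.cons 1 b : Fin (N + 1) → Fin 2) n.castSucc)

lemma sum_snoc {N : ℕ} {α : Type*} [Fintype α] (F : (Fin (N + 1) → α) → ℂ) :
    ∑ b, F b = ∑ y, ∑ b : Fin N → α, F (Fin.snoc (α := fun _ => α) b y) := by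
  rw [← (Fin.snocEquiv (fun _ : Fin (N + 1) => α)).sum_comp, Fintype.sum_prod_type]
  rfl

lemma pathAmplitude_snoc {N : ℕ} (R : Fin (N + 1) → Matrix (Fin 2) (Fin 2) ℂ) (b : Fin N → Fin 2)
    (y : Fin 2) :
    pathAmplitude R (Fin.snoc (α := fun _ => Fin 2) b y)
      = R (Fin.last N) y (1 - (Fin.cons 1 b : Fin (N + 1) → Fin 2) (Fin.last N)) *
        pathAmplitude (fun n => R n.castSucc) b := by
  rw [pathAmplitude, Fin.prod_univ_castSucc, mul_comm, pathAmplitude]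
  simp only [Fin.cons_snoc_eq_snoc_cons, Fin.snoc_castSucc, Fin.snoc_last]

lemma totalDisplacement_snoc {N M : ℕ} (μ : Fin (N + 1) → Fin M) (b : Fin N → Fin 2) (y : Fin 2)
    (β : Fin (N + 1) → ℂ) :
    totalDisplacement μ (fun n => bitSign (Fin.snoc (α := fun _ => Fin 2) b y n)) β
      = Function.update (totalDisplacement (fun n => μ n.castSucc) (fun n => bitSign (b n))
          (fun n => β n.castSucc)) (μ (Fin.last N))
        (totalDisplacement (fun n => μ n.castSucc) (fun n => bitSign (b n))
          (fun n => β n.castSucc) (μ (Fin.last N)) + bitSign y * β (Fin.last N)) := by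
  funext j
  by_cases hj : j = μ (Fin.last N)
  · subst hj
    rw [Function.update_self]
    simp [totalDisplacement, Fin.sum_univ_castSucc]
  · rw [Function.update_of_ne hj]
    simp [totalDisplacement, Fin.sum_univ_castSucc, Ne.symm hj]

lemma continuous_totalDisplacement {N M : ℕ} (μ : Fin N → Fin M) (s : Fin N → ℝ) :
    Continuous (totalDisplacement μ s) := by
  refine continuous_pi fun j => continuous_finsetSum _ fun n _ => ?_
  split_ifs
  · fun_prop
  · exact continuous_const

/-- Induction over the blocks: a rotation branches each path, and the following gate displaces one
coherent state by `±β` and adds a Weyl phase. That `χ` does not depend on the rotations is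
essential, since all dependence on the angles then sits in `pathAmplitude`. The initial letter `1`
encodes the initial qubit state `0`, because the value before a rotation is the flip of the stored
bit. -/
lemma runCircuit_eq_sum_paths {N M : ℕ} (μ : Fin N → Fin M) :
    ∃ χ : (Fin N → Fin 2) → (Fin N → ℂ) → ℝ, (∀ b, Continuous (χ b)) ∧
      ∀ (R : Fin N → Matrix (Fin 2) (Fin 2) ℂ) (β : Fin N → ℂ) (a : Fin 2),
        runCircuit μ R β ![coherent 0, 0] a = fun x => ∑ b : Fin N → Fin 2,
          (if (Fin.cons 1 b : Fin (N + 1) → Fin 2) (Fin.last N) = 1 - a then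
            pathAmplitude R b * Complex.exp (Complex.I * χ b β) else 0) *
          coherent (totalDisplacement μ (fun n => bitSign (b n)) β) x := by
  induction N with
  | zero =>
    refine ⟨fun _ _ => 0, fun _ => continuous_const, fun R β a => ?_⟩
    funext x
    have h : ∀ b : Fin 0 → Fin 2, totalDisplacement μ (fun n => bitSign (b n)) β = 0 :=
      fun b => by funext j; simp [totalDisplacement]
    rw [Fintype.sum_unique, h]
    fin_cases a <;> simp [runCircuit, pathAmplitude]
  | succ N ih =>
    obtain ⟨χ, hχ, h⟩ := ih (fun n => μ n.castSucc)
    let D : (Fin N → Fin 2) → (Fin (N + 1) → ℂ) → ℂ := fun b β =>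
      totalDisplacement (fun n => μ n.castSucc) (fun n => bitSign (b n)) (fun n => β n.castSucc)
        (μ (Fin.last N))
    have hD : ∀ b, Continuous (D b) := fun b =>
      (continuous_apply (μ (Fin.last N))).comp ((continuous_totalDisplacement _ _).comp
        (by fun_prop))
    refine ⟨fun b β => χ (fun n => b n.castSucc) (fun n => β n.castSucc) +
      ((D (fun n => b n.castSucc) β).re * ((bitSign (b (Fin.last N)) : ℂ) * β (Fin.last N)).im -
      (D (fun n => b n.castSucc) β).im * ((bitSign (b (Fin.last N)) : ℂ) * β (Fin.last N)).re),
      fun b => ?_, fun R β a => ?_⟩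
    · have h1 := hχ (fun n => b n.castSucc)
      have h2 := hD (fun n => b n.castSucc)
      refine (h1.comp (by fun_prop)).add (Continuous.sub ?_ ?_)
      · exact (Complex.continuous_re.comp h2).mul (Complex.continuous_im.comp (by fun_prop))
      · exact (Complex.continuous_im.comp h2).mul (Complex.continuous_re.comp (by fun_prop))
    · rw [runCircuit_succ, ecd_applyQubit]
      simp only [h, Finset.mul_sum, ← mul_assoc]
      have hcomm : (fun x : Fin M → ℝ => ∑ c : Fin 2, ∑ b : Fin N → Fin 2,
          R (Fin.last N) (1 - a) c *
            (if (Fin.cons 1 b : Fin (N + 1) → Fin 2) (Fin.last N) = 1 - c then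
              pathAmplitude (fun n => R n.castSucc) b *
                Complex.exp (Complex.I * χ b (fun n => β n.castSucc)) else 0) *
          coherent (totalDisplacement (fun n => μ n.castSucc) (fun n => bitSign (b n))
            (fun n => β n.castSucc)) x)
          = fun x => ∑ b : Fin N → Fin 2,
            (pathAmplitude R (Fin.snoc (α := fun _ => Fin 2) b (1 - a)) *
              Complex.exp (Complex.I * χ b (fun n => β n.castSucc))) *
            coherent (totalDisplacement (fun n => μ n.castSucc) (fun n => bitSign (b n))
              (fun n => β n.castSucc)) x := by
        funext x
        rw [Finset.sum_comm]
        refine Finset.sum_congr rfl fun b _ => ?_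
        rw [← Finset.sum_mul, pathAmplitude_snoc]
        congr 1
        have hflip : ∀ y c : Fin 2, y = 1 - c ↔ c = 1 - y := by decide
        simp only [hflip ((Fin.cons 1 b : Fin (N + 1) → Fin 2) (Fin.last N)), mul_ite, mul_zero, Finset.sum_ite_eq',
          Finset.mem_univ, if_true, mul_assoc]
      rw [hcomm, displaceMode_sum]
      funext x
      -- The gate flips the qubit, so only paths whose last bit is `1 - a` reach the component `a`.
      rw [sum_snoc, Finset.sum_eq_single (1 - a)]
      · refine Finset.sum_congr rfl fun b _ => ?_
        rw [displaceMode_coherent, totalDisplacement_snoc]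
        simp only [Fin.cons_snoc_eq_snoc_cons, Fin.snoc_last, if_true, Fin.snoc_castSucc, ← mul_assoc]
        congr 1
        rw [mul_assoc, ← Complex.exp_add, ← mul_add, ← Complex.ofReal_add]
      · intro y _ hy
        refine Finset.sum_eq_zero fun b _ => ?_
        rw [Fin.cons_snoc_eq_snoc_cons, Fin.snoc_last, if_neg hy, zero_mul]
      · simp

/-! ### Coherent-state amplitudes -/

/-- A Gaussian dominating all coherent states up to constants. -/
def gaussEnvelope {M : ℕ} (x : Fin M → ℝ) : ℝ := ∏ j, Real.exp (-x j ^ 2 / 4)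

lemma gaussEnvelope_nonneg {M : ℕ} (x : Fin M → ℝ) : 0 ≤ gaussEnvelope x :=
  Finset.prod_nonneg fun _ _ => (Real.exp_pos _).le

lemma continuous_gaussEnvelope {M : ℕ} : Continuous (gaussEnvelope (M := M)) := by
  unfold gaussEnvelope; fun_prop

lemma memLp_gaussEnvelope {M : ℕ} : MemLp (gaussEnvelope (M := M)) 2 volume := by
  rw [memLp_two_iff_integrable_sq continuous_gaussEnvelope.aestronglyMeasurable]
  have h : Integrable (fun x : Fin M → ℝ => ∏ j, Real.exp (-(1 / 2) * x j ^ 2)) volume :=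
    Integrable.fintype_prod (f := fun (_ : Fin M) (t : ℝ) => Real.exp (-(1 / 2) * t ^ 2))
      fun _ => integrable_exp_neg_mul_sq (by norm_num)
  refine h.congr (Filter.Eventually.of_forall fun x => ?_)
  simp only [gaussEnvelope, ← Finset.prod_pow, ← Real.exp_nat_mul]
  refine Finset.prod_congr rfl fun j _ => ?_
  congr 1; push_cast; ring

lemma norm_displace_vacuum (α : ℂ) (x : ℝ) :
    ‖displace α vacuum x‖ = Real.pi ^ (-(1 / 4) : ℝ) * Real.exp (-(x - √2 * α.re) ^ 2 / 2) := by
  rw [displace, vacuum, norm_mul, mul_comm Complex.I, Complex.norm_exp_ofReal_mul_I, one_mul,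
    Complex.norm_real, Real.norm_of_nonneg (by positivity)]

lemma norm_coherent {M : ℕ} (α : Fin M → ℂ) (x : Fin M → ℝ) :
    ‖coherent α x‖
      = ∏ j, Real.pi ^ (-(1 / 4) : ℝ) * Real.exp (-(x j - √2 * (α j).re) ^ 2 / 2) := by
  simp only [coherent, norm_prod, norm_displace_vacuum]

/-- The constant in the Gaussian bound of a coherent state. -/
def envelopeConst {M : ℕ} (α : Fin M → ℂ) : ℝ :=
  ∏ j, Real.pi ^ (-(1 / 4) : ℝ) * Real.exp ((α j).re ^ 2)

lemma continuous_envelopeConst {M : ℕ} : Continuous (envelopeConst (M := M)) := by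
  unfold envelopeConst
  refine continuous_finsetProd _ fun j _ => continuous_const.mul (Real.continuous_exp.comp ?_)
  exact (Complex.continuous_re.comp (continuous_apply j)).pow 2

lemma norm_coherent_le {M : ℕ} (α : Fin M → ℂ) (x : Fin M → ℝ) :
    ‖coherent α x‖ ≤ envelopeConst α * gaussEnvelope x := by
  rw [norm_coherent, envelopeConst, gaussEnvelope, ← Finset.prod_mul_distrib]
  refine Finset.prod_le_prod (fun j _ => by positivity) fun j _ => ?_
  rw [mul_assoc, ← Real.exp_add]
  gcongr
  have h : √2 ^ 2 = 2 := Real.sq_sqrt (by norm_num)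
  -- The difference of the two exponents is a quarter of this square.
  nlinarith [sq_nonneg (x j - 2 * (√2 * (α j).re))]

lemma continuous_coherent_uncurry {M : ℕ} :
    Continuous fun p : (Fin M → ℂ) × (Fin M → ℝ) => coherent p.1 p.2 := by
  unfold coherent displace vacuum
  refine continuous_finsetProd _ fun j _ => ?_
  have h1 : Continuous fun p : (Fin M → ℂ) × (Fin M → ℝ) => (p.1 j).re :=
    Complex.continuous_re.comp ((continuous_apply j).comp continuous_fst)
  have h2 : Continuous fun p : (Fin M → ℂ) × (Fin M → ℝ) => (p.1 j).im :=
    Complex.continuous_im.comp ((continuous_apply j).comp continuous_fst)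
  fun_prop

lemma continuous_coherent {M : ℕ} (α : Fin M → ℂ) : Continuous (coherent α) :=
  continuous_coherent_uncurry.comp (g := fun p : (Fin M → ℂ) × (Fin M → ℝ) => coherent p.1 p.2)
    (f := fun x => (α, x)) (continuous_const.prodMk continuous_id)

lemma integrable_norm_mul_gaussEnvelope {M : ℕ} {ψ : Wave M} (hψ : MemLp ψ 2 volume) :
    Integrable fun x => ‖ψ x‖ * gaussEnvelope x :=
  hψ.norm.integrable_mul memLp_gaussEnvelope

lemma integrable_conj_mul_coherent {M : ℕ} {ψ : Wave M} (hψ : MemLp ψ 2 volume)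
    (α : Fin M → ℂ) : Integrable fun x => starRingEnd ℂ (ψ x) * coherent α x := by
  refine ((integrable_norm_mul_gaussEnvelope hψ).const_mul (envelopeConst α)).mono'
    ((Complex.continuous_conj.comp_aestronglyMeasurable hψ.1).mul
      (continuous_coherent α).aestronglyMeasurable) (Filter.Eventually.of_forall fun x => ?_)
  rw [norm_mul, RCLike.norm_conj]
  nlinarith [norm_coherent_le α x, norm_nonneg (ψ x),
    mul_le_mul_of_nonneg_left (norm_coherent_le α x) (norm_nonneg (ψ x))]

/-- Dominated convergence: near `α` the constants of the Gaussian bounds stay below `envelopeConst α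
+ 1`. -/
lemma continuous_braket_coherent {M : ℕ} {ψ : Wave M} (hψ : MemLp ψ 2 volume) :
    Continuous fun α => braket ψ (coherent α) := by
  rw [continuous_iff_continuousAt]
  intro α
  refine continuousAt_of_dominated
    (bound := fun x => (envelopeConst α + 1) * (‖ψ x‖ * gaussEnvelope x))
    (Filter.Eventually.of_forall fun β => (integrable_conj_mul_coherent hψ β).1) ?_
    ((integrable_norm_mul_gaussEnvelope hψ).const_mul _)
    (Filter.Eventually.of_forall fun x => ?_)
  · have h := continuous_envelopeConst.continuousAt (x := α) |>.eventually
      (gt_mem_nhds (lt_add_one (envelopeConst α)))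
    filter_upwards [h] with β hβ
    refine Filter.Eventually.of_forall fun x => ?_
    rw [norm_mul, RCLike.norm_conj]
    have h1 := (norm_coherent_le β x).trans
      (mul_le_mul_of_nonneg_right hβ.le (gaussEnvelope_nonneg x))
    nlinarith [mul_le_mul_of_nonneg_left h1 (norm_nonneg (ψ x))]
  · exact (continuous_const.mul (continuous_coherent_uncurry.comp
      (by fun_prop : Continuous fun β : Fin M → ℂ => (β, x)))).continuousAt

lemma integral_norm_coherent_sq {M : ℕ} (α : Fin M → ℂ) : ∫ x, ‖coherent α x‖ ^ 2 = 1 := by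
  have h : ∀ x : Fin M → ℝ, ‖coherent α x‖ ^ 2
      = ∏ j, (√Real.pi)⁻¹ * Real.exp (-1 * (x j - √2 * (α j).re) ^ 2) := fun x => by
    rw [norm_coherent, ← Finset.prod_pow]
    refine Finset.prod_congr rfl fun j _ => ?_
    have hpi : (√Real.pi)⁻¹ = Real.pi ^ (-(1 / 2) : ℝ) := by
      rw [Real.sqrt_eq_rpow, ← Real.rpow_neg Real.pi_pos.le]
    rw [mul_pow, ← Real.rpow_natCast, ← Real.rpow_mul Real.pi_pos.le, ← Real.exp_nat_mul, hpi]
    congr 2 <;> push_cast <;> ring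
  simp_rw [h]
  rw [integral_fintype_prod_volume_eq_prod
    (f := fun j (t : ℝ) => (√Real.pi)⁻¹ * Real.exp (-1 * (t - √2 * (α j).re) ^ 2))]
  refine Finset.prod_eq_one fun j _ => ?_
  rw [integral_const_mul, integral_sub_right_eq_self (fun t => Real.exp (-1 * t ^ 2)),
    integral_gaussian, div_one, inv_mul_cancel₀ (Real.sqrt_ne_zero'.2 Real.pi_pos)]

lemma integrable_norm_coherent_sq {M : ℕ} (α : Fin M → ℂ) :
    Integrable fun x => ‖coherent α x‖ ^ 2 :=
  Integrable.of_integral_ne_zero (by rw [integral_norm_coherent_sq]; norm_num)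

/-- A uniform bound of all amplitudes `⟨ψ|α⟩`. -/
def amplitudeBound {M : ℕ} (ψ : Wave M) : ℝ := ((∫ x, ‖ψ x‖ ^ 2) + 1) / 2

lemma amplitudeBound_pos {M : ℕ} (ψ : Wave M) : 0 < amplitudeBound ψ := by
  have : 0 ≤ ∫ x, ‖ψ x‖ ^ 2 := integral_nonneg fun x => by positivity
  unfold amplitudeBound; positivity

lemma norm_braket_coherent_le {M : ℕ} {ψ : Wave M} (hψ : MemLp ψ 2 volume) (α : Fin M → ℂ) :
    ‖braket ψ (coherent α)‖ ≤ amplitudeBound ψ := by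
  have h2 : Integrable fun x => ‖ψ x‖ ^ 2 := hψ.norm.integrable_sq
  calc ‖braket ψ (coherent α)‖ ≤ ∫ x, (‖ψ x‖ ^ 2 + ‖coherent α x‖ ^ 2) / 2 := by
        refine norm_integral_le_of_norm_le ((h2.add (integrable_norm_coherent_sq α)).div_const 2)
          (Filter.Eventually.of_forall fun x => ?_)
        rw [norm_mul, RCLike.norm_conj]
        nlinarith [sq_nonneg (‖ψ x‖ - ‖coherent α x‖)]
    _ = amplitudeBound ψ := by
        rw [integral_div, integral_add h2 (integrable_norm_coherent_sq α),
          integral_norm_coherent_sq, amplitudeBound]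

lemma braket_conj {M : ℕ} (f g : Wave M) : starRingEnd ℂ (braket f g) = braket g f := by
  rw [braket, braket, ← integral_conj]
  congr 1; funext x
  rw [map_mul, Complex.conj_conj, mul_comm]

/-- The observable has rank one, so only a single amplitude of the output state matters. -/
lemma cost_eq_norm_sq {L M : ℕ} (ψ : Wave M) (p : Params L M) :
    cost ψ p = ‖braket ψ (outputState L M p 0)‖ ^ 2 := by
  have h : ∀ (c : ℂ) (f g : Wave M), braket f (fun x => c * g x) = c * braket f g :=
    fun c f g => by
      rw [braket, braket, ← integral_const_mul]
      congr 1; funext x; ring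
  have h0 : braket (outputState L M p 1) 0 = 0 := by simp [braket]
  rw [cost, Fin.sum_univ_two]
  simp only [observable, Matrix.cons_val_zero, Matrix.cons_val_one, Matrix.cons_val_fin_one, h0,
    add_zero, h]
  rw [← braket_conj ψ, Complex.mul_conj, Complex.ofReal_re, Complex.normSq_eq_norm_sq]

/-! ### Products of two rotation matrix elements

`x` is the qubit value after the rotation and `z` the value after the preceding rotation, which the
gate between them flips. -/

/-- The mean over `θ` of a product of two rotation matrix elements without its `φ` phase. -/
def trigMean (x z x' z' : Fin 2) : ℂ :=
  if x = z then (if x' = z' then 1 / 2 else 0) else (if x' = z' then 0 else 1 / 2)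

/-- The coefficient of `cos θ`. -/
def trigCos (x z x' z' : Fin 2) : ℂ :=
  if x = z then (if x' = z' then -1 / 2 else 0) else (if x' = z' then 0 else 1 / 2)

/-- The coefficient of `sin θ`. -/
def trigSin (x z x' z' : Fin 2) : ℂ :=
  if x = z then (if x' = z' then 0 else -Complex.I / 2) else (if x' = z' then Complex.I / 2 else 0)

/-- The product of two rotation matrix elements without its `φ` phase. -/
def trigPart (x z x' z' : Fin 2) (θ : ℝ) : ℂ :=
  trigMean x z x' z' + trigCos x z x' z' * Real.cos θ + trigSin x z x' z' * Real.sin θ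

/-- The derivative of `trigPart`. -/
def trigPartDeriv (x z x' z' : Fin 2) (θ : ℝ) : ℂ :=
  trigSin x z x' z' * Real.cos θ - trigCos x z x' z' * Real.sin θ

/-- The multiple of `φ` in the phase of the product of two rotation matrix elements. -/
def phaseIndex (x z x' z' : Fin 2) : ℤ := ((x : ℕ) + (z : ℕ) : ℤ) - ((x' : ℕ) + (z' : ℕ) : ℤ)

/-- Since the incoming value is `1 - z`, the case `x = z` is the off-diagonal one. Writing the phase
through `x + z`, up to a common factor, makes it additive along a path. -/
lemma qubitRotation_apply (θ φ : ℝ) (x z : Fin 2) :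
    qubitRotation θ φ x (1 - z)
      = (if x = z then -Complex.I * Real.sin (θ / 2) else (Real.cos (θ / 2) : ℂ)) *
        Complex.exp ((((x : ℕ) + (z : ℕ) : ℤ) : ℂ) * φ * Complex.I) *
        Complex.exp (-(φ * Complex.I)) := by
  rw [mul_assoc, ← Complex.exp_add, qubitRotation_eq]
  fin_cases x <;> fin_cases z <;> simp <;> ring_nf <;> simp

/-- Products of two half-angle functions are trigonometric polynomials of degree one in `θ`, and the
common phase cancels against its conjugate. -/
lemma qubitRotation_mul_conj (θ φ : ℝ) (x z x' z' : Fin 2) :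
    qubitRotation θ φ x (1 - z) * starRingEnd ℂ (qubitRotation θ φ x' (1 - z'))
      = trigPart x z x' z' θ * Complex.exp ((phaseIndex x z x' z' : ℂ) * φ * Complex.I) := by
  have hexp : Complex.exp ((phaseIndex x z x' z' : ℂ) * φ * Complex.I)
      = Complex.exp ((((x : ℕ) + (z : ℕ) : ℤ) : ℂ) * φ * Complex.I) *
        Complex.exp (-(φ * Complex.I)) *
        starRingEnd ℂ (Complex.exp ((((x' : ℕ) + (z' : ℕ) : ℤ) : ℂ) * φ * Complex.I) *
        Complex.exp (-(φ * Complex.I))) := by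
    rw [map_mul, ← Complex.exp_conj, ← Complex.exp_conj, ← Complex.exp_add, ← Complex.exp_add,
      ← Complex.exp_add]
    congr 1
    simp only [map_mul, map_neg, Complex.conj_I, Complex.conj_ofReal, phaseIndex, map_intCast]
    push_cast
    ring
  have hs : (Real.sin θ : ℂ) = 2 * Real.sin (θ / 2) * Real.cos (θ / 2) := by
    rw [← Complex.ofReal_ofNat, ← Complex.ofReal_mul, ← Complex.ofReal_mul, ← Real.sin_two_mul]
    congr 2; ring
  have hc : (Real.cos θ : ℂ) = 2 * (Real.cos (θ / 2) : ℂ) ^ 2 - 1 := by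
    have : Real.cos θ = 2 * Real.cos (θ / 2) ^ 2 - 1 := by rw [← Real.cos_two_mul]; congr 1; ring
    rw [this]; push_cast; ring
  have h1 : (Real.sin (θ / 2) : ℂ) ^ 2 + (Real.cos (θ / 2) : ℂ) ^ 2 = 1 := by
    rw [← Complex.ofReal_pow, ← Complex.ofReal_pow, ← Complex.ofReal_add, Real.sin_sq_add_cos_sq,
      Complex.ofReal_one]
  have hI : Complex.I * Complex.I = -1 := Complex.I_mul_I
  have htrig : (if x = z then -Complex.I * Real.sin (θ / 2) else (Real.cos (θ / 2) : ℂ)) *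
      starRingEnd ℂ (if x' = z' then -Complex.I * Real.sin (θ / 2) else (Real.cos (θ / 2) : ℂ))
      = trigPart x z x' z' θ := by
    rw [trigPart, trigMean, trigCos, trigSin, hs, hc]
    split_ifs <;> simp only [map_mul, map_neg, Complex.conj_I, Complex.conj_ofReal]
    · linear_combination -(Real.sin (θ / 2) : ℂ) ^ 2 * hI + h1
    · ring
    · ring
    · ring
  rw [qubitRotation_apply, qubitRotation_apply, hexp, ← htrig]
  simp only [map_mul]
  ring

lemma hasDerivAt_trigPart (x z x' z' : Fin 2) (θ : ℝ) :
    HasDerivAt (trigPart x z x' z') (trigPartDeriv x z x' z' θ) θ := by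
  have hc : HasDerivAt (fun t : ℝ => (Real.cos t : ℂ)) (-Real.sin θ : ℝ) θ :=
    (Real.hasDerivAt_cos θ).ofReal_comp
  have hs : HasDerivAt (fun t : ℝ => (Real.sin t : ℂ)) (Real.cos θ : ℝ) θ :=
    (Real.hasDerivAt_sin θ).ofReal_comp
  refine (((hc.const_mul (trigCos x z x' z')).const_add (trigMean x z x' z')).add
    (hs.const_mul (trigSin x z x' z'))).congr_deriv ?_
  rw [trigPartDeriv]; push_cast; ring

lemma continuous_trigPart (x z x' z' : Fin 2) : Continuous (trigPart x z x' z') := by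
  unfold trigPart; fun_prop

lemma continuous_trigPartDeriv (x z x' z' : Fin 2) : Continuous (trigPartDeriv x z x' z') := by
  unfold trigPartDeriv; fun_prop

/-! ### Averages over the angles -/

instance : IsProbabilityMeasure uniformAngle := by
  refine cond_isProbabilityMeasure_of_finite ?_ ?_
  · simp [Real.volume_Ico, Real.pi_pos]
  · rw [Real.volume_Ico]; exact ENNReal.ofReal_ne_top

lemma uniformAngle_eq : uniformAngle
    = (ENNReal.ofReal (2 * Real.pi))⁻¹ • volume.restrict (Set.Ico 0 (2 * Real.pi)) := by
  rw [uniformAngle, ProbabilityTheory.cond, Real.volume_Ico, sub_zero]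

lemma integral_uniformAngle (f : ℝ → ℂ) :
    ∫ t, f t ∂uniformAngle = ((2 * Real.pi : ℝ) : ℂ)⁻¹ * ∫ t in (0)..(2 * Real.pi), f t := by
  have hpi := Real.pi_pos
  rw [uniformAngle_eq, integral_smul_measure, intervalIntegral.integral_of_le (by positivity),
    restrict_Ico_eq_restrict_Ioc, ENNReal.toReal_inv, ENNReal.toReal_ofReal (by positivity),
    Complex.real_smul, Complex.ofReal_inv]

lemma integrable_uniformAngle {f : ℝ → ℂ} (hf : Continuous f) :
    Integrable f uniformAngle := by
  rw [uniformAngle_eq]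
  refine Integrable.smul_measure ?_ (by simp [Real.pi_pos])
  exact (hf.integrableOn_Icc (a := 0) (b := 2 * Real.pi)).mono_set Set.Ico_subset_Icc_self

lemma integral_uniformAngle_exp (m : ℤ) :
    ∫ t, Complex.exp ((m : ℂ) * (t : ℝ) * Complex.I) ∂uniformAngle = if m = 0 then 1 else 0 := by
  have hpi : ((2 * Real.pi : ℝ) : ℂ) ≠ 0 := Complex.ofReal_ne_zero.2 (by positivity)
  rw [integral_uniformAngle]
  split_ifs with h
  · simp only [h, Int.cast_zero, zero_mul, Complex.exp_zero]
    rw [intervalIntegral.integral_const, sub_zero, Complex.real_smul, mul_one, inv_mul_cancel₀ hpi]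
  · have hm : (m : ℂ) * Complex.I ≠ 0 := by simp [h]
    have := integral_exp_mul_complex (a := 0) (b := 2 * Real.pi) hm
    rw [intervalIntegral.integral_congr (g := fun t : ℝ => Complex.exp ((m : ℂ) * Complex.I * t))
      fun t _ => by ring_nf, this]
    have h1 : Complex.exp ((m : ℂ) * Complex.I * ((2 * Real.pi : ℝ) : ℂ)) = 1 := by
      rw [← Complex.exp_int_mul_two_pi_mul_I m]; congr 1; push_cast; ring
    rw [h1]; simp

lemma integral_uniformAngle_ofReal (f : ℝ → ℝ) (c : ℝ)
    (h : ∫ t in (0)..(2 * Real.pi), f t = c * (2 * Real.pi)) :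
    ∫ t, (f t : ℂ) ∂uniformAngle = c := by
  have hpi : ((2 * Real.pi : ℝ) : ℂ) ≠ 0 := Complex.ofReal_ne_zero.2 (by positivity)
  rw [integral_uniformAngle, intervalIntegral.integral_ofReal, h, Complex.ofReal_mul c, mul_comm,
    mul_inv_cancel_right₀ hpi]

lemma integral_uniformAngle_trig (a b c : ℂ) (a' b' c' : ℂ) :
    ∫ t, (a + b * Real.cos t + c * Real.sin t) * (a' + b' * Real.cos t + c' * Real.sin t)
      ∂uniformAngle = a * a' + (b * b' + c * c') / 2 := by
  have hcos := integral_uniformAngle_ofReal Real.cos 0 (by simp)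
  have hsin := integral_uniformAngle_ofReal Real.sin 0 (by simp)
  have hcc := integral_uniformAngle_ofReal (fun t => Real.cos t ^ 2) (1 / 2)
    (by rw [integral_cos_sq]; simp)
  have hss := integral_uniformAngle_ofReal (fun t => Real.sin t ^ 2) (1 / 2)
    (by rw [integral_sin_sq]; simp)
  have hsc := integral_uniformAngle_ofReal (fun t => Real.sin t * Real.cos t) 0
    (by rw [integral_sin_mul_cos₁]; simp)
  have e : (fun t : ℝ => (a + b * Real.cos t + c * Real.sin t) *
      (a' + b' * Real.cos t + c' * Real.sin t))
      = fun t : ℝ => a * a' + ((a * b' + b * a') * (Real.cos t : ℂ) +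
        ((a * c' + c * a') * (Real.sin t : ℂ) + (b * b' * ((Real.cos t ^ 2 : ℝ) : ℂ) +
        (c * c' * ((Real.sin t ^ 2 : ℝ) : ℂ) +
        (b * c' + c * b') * ((Real.sin t * Real.cos t : ℝ) : ℂ))))) := by
    funext t; push_cast; ring
  have i : ∀ f : ℝ → ℂ, Continuous f → Integrable f uniformAngle :=
    fun f hf => integrable_uniformAngle hf
  rw [e, integral_add (i _ (by fun_prop)) (i _ (by fun_prop)),
    integral_add (i _ (by fun_prop)) (i _ (by fun_prop)),
    integral_add (i _ (by fun_prop)) (i _ (by fun_prop)),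
    integral_add (i _ (by fun_prop)) (i _ (by fun_prop)),
    integral_add (i _ (by fun_prop)) (i _ (by fun_prop))]
  simp only [integral_const_mul, hcos, hsin, hcc, hss, hsc, integral_const, probReal_univ]
  simp
  ring

/-! ### Second moments of the gradient as a sum over quadruples of paths -/

/-- The qubit value after the rotation preceding rotation `n` along the path `b`. -/
def prevBit {N : ℕ} (b : Fin N → Fin 2) (n : Fin N) : Fin 2 :=
  (Fin.cons 1 b : Fin (N + 1) → Fin 2) n.castSucc

/-- The `θ`-dependent factor of block `n` in the gradient with respect to `θ_k`. -/
def gradFactor {N : ℕ} (k n : Fin N) (b b' : Fin N → Fin 2) (θ : ℝ) : ℂ :=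
  if n = k then trigPartDeriv (b n) (prevBit b n) (b' n) (prevBit b' n) θ
  else trigPart (b n) (prevBit b n) (b' n) (prevBit b' n) θ

/-- The `φ`-dependent factor of block `n`. -/
def phaseFactor {N : ℕ} (n : Fin N) (b b' : Fin N → Fin 2) (φ : ℝ) : ℂ :=
  Complex.exp ((phaseIndex (b n) (prevBit b n) (b' n) (prevBit b' n) : ℂ) * φ * Complex.I)

lemma continuous_gradFactor {N : ℕ} (k n : Fin N) (b b' : Fin N → Fin 2) :
    Continuous (gradFactor k n b b') := by
  unfold gradFactor
  split_ifs
  exacts [continuous_trigPartDeriv _ _ _ _, continuous_trigPart _ _ _ _]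

lemma continuous_phaseFactor {N : ℕ} (n : Fin N) (b b' : Fin N → Fin 2) :
    Continuous (phaseFactor n b b') := by
  unfold phaseFactor; fun_prop

/-- The coefficients `G b` depend on the displacements only. Their modulus is all that later
arguments use; the vanishing case records that the observable projects onto qubit value `0`, so the
last bit must be `1`. -/
lemma exists_pathCoefficients (L M : ℕ) {ψ : Wave M} (hψ : MemLp ψ 2 volume) :
    ∃ G : (Fin (L * M) → Fin 2) → (Fin (L * M) → ℂ) → ℂ, (∀ b, Continuous (G b)) ∧
      (∀ b β, ‖G b β‖ = if (Fin.cons 1 b : Fin (L * M + 1) → Fin 2) (Fin.last _) = 1 then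
        ‖braket ψ (coherent (totalDisplacement Fin.modNat (fun n => bitSign (b n)) β))‖ else 0) ∧
      ∀ p : Params L M, braket ψ (outputState L M p 0)
        = ∑ b, pathAmplitude (fun n => qubitRotation (p.2.1 n) (p.2.2 n)) b * G b p.1 := by
  obtain ⟨χ, hχ, h⟩ := runCircuit_eq_sum_paths (N := L * M) (M := M) Fin.modNat
  refine ⟨fun b β => if (Fin.cons 1 b : Fin (L * M + 1) → Fin 2) (Fin.last _) = 1 then
      Complex.exp (Complex.I * χ b β) *
        braket ψ (coherent (totalDisplacement Fin.modNat (fun n => bitSign (b n)) β)) else 0,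
    fun b => ?_, fun b β => ?_, fun p => ?_⟩
  · beta_reduce
    split_ifs
    · have h1 := hχ b
      exact Continuous.mul (by fun_prop)
        ((continuous_braket_coherent hψ).comp (continuous_totalDisplacement _ _))
    · exact continuous_const
  · beta_reduce
    split_ifs
    · rw [norm_mul, mul_comm Complex.I, Complex.norm_exp_ofReal_mul_I, one_mul]
    · exact norm_zero
  · have ho : outputState L M p 0 = runCircuit Fin.modNat
        (fun n => qubitRotation (p.2.1 n) (p.2.2 n)) p.1 ![coherent 0, 0] 0 := rfl
    rw [ho, h, braket]
    simp only [Finset.mul_sum]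
    rw [integral_finsetSum]
    · refine Finset.sum_congr rfl fun b _ => ?_
      rw [sub_zero]
      split_ifs
      · simp only [mul_left_comm (starRingEnd ℂ (ψ _))]
        rw [integral_const_mul, braket]
        ring
      · simp
    · intro b _
      refine ((integrable_conj_mul_coherent hψ (totalDisplacement Fin.modNat
        (fun n => bitSign (b n)) p.1)).const_mul
        (if (Fin.cons 1 b : Fin (L * M + 1) → Fin 2) (Fin.last _) = 1 - 0 then
            pathAmplitude (fun n => qubitRotation (p.2.1 n) (p.2.2 n)) b *
              Complex.exp (Complex.I * χ b p.1) else 0)).congr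
        (Filter.Eventually.of_forall fun x => ?_)
      simp only
      ring

lemma cost_eq_sum {L M : ℕ} {ψ : Wave M} {G : (Fin (L * M) → Fin 2) → (Fin (L * M) → ℂ) → ℂ}
    (hG : ∀ p : Params L M, braket ψ (outputState L M p 0)
        = ∑ b, pathAmplitude (fun n => qubitRotation (p.2.1 n) (p.2.2 n)) b * G b p.1)
    (p : Params L M) :
    (cost ψ p : ℂ) = ∑ b, ∑ b', (∏ n, trigPart (b n) (prevBit b n) (b' n) (prevBit b' n) (p.2.1 n)) *
      ((∏ n, phaseFactor n b b' (p.2.2 n)) * (G b p.1 * starRingEnd ℂ (G b' p.1))) := by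
  rw [cost_eq_norm_sq, ← Complex.normSq_eq_norm_sq, ← Complex.mul_conj, hG, map_sum,
    Finset.sum_mul_sum]
  refine Finset.sum_congr rfl fun b _ => Finset.sum_congr rfl fun b' _ => ?_
  have h : pathAmplitude (fun n => qubitRotation (p.2.1 n) (p.2.2 n)) b *
      starRingEnd ℂ (pathAmplitude (fun n => qubitRotation (p.2.1 n) (p.2.2 n)) b')
      = (∏ n, trigPart (b n) (prevBit b n) (b' n) (prevBit b' n) (p.2.1 n)) *
        ∏ n, phaseFactor n b b' (p.2.2 n) := by
    rw [pathAmplitude, pathAmplitude, map_prod, ← Finset.prod_mul_distrib,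
      ← Finset.prod_mul_distrib]
    exact Finset.prod_congr rfl fun n _ => qubitRotation_mul_conj _ _ _ _ _ _
  rw [map_mul]
  linear_combination (G b p.1 * starRingEnd ℂ (G b' p.1)) * h

lemma hasDerivAt_prod_update {N : ℕ} (k : Fin N) (F : Fin N → ℝ → ℂ) (F' : ℂ) (θ : Fin N → ℝ)
    (hF : HasDerivAt (F k) F' (θ k)) :
    HasDerivAt (fun t => ∏ n, F n (Function.update θ k t n))
      (F' * ∏ n ∈ Finset.univ.erase k, F n (θ n)) (θ k) := by
  have h : (fun t => ∏ n, F n (Function.update θ k t n))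
      = fun t => F k t * ∏ n ∈ Finset.univ.erase k, F n (θ n) := by
    funext t
    rw [← Finset.mul_prod_erase _ _ (Finset.mem_univ k), Function.update_self]
    congr 1
    exact Finset.prod_congr rfl fun n hn => by
      rw [Function.update_of_ne (Finset.ne_of_mem_erase hn)]
  rw [h]
  exact hF.mul_const _

/-- The gradient as a double sum over paths. -/
def gradientSum {L M : ℕ} (G : (Fin (L * M) → Fin 2) → (Fin (L * M) → ℂ) → ℂ) (k : Fin (L * M))
    (p : Params L M) : ℂ :=
  ∑ b, ∑ b', (G b p.1 * starRingEnd ℂ (G b' p.1)) *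
    ((∏ n, gradFactor k n b b' (p.2.1 n)) * ∏ n, phaseFactor n b b' (p.2.2 n))

lemma costGradient_eq {L M : ℕ} {ψ : Wave M} {G : (Fin (L * M) → Fin 2) → (Fin (L * M) → ℂ) → ℂ}
    (hG : ∀ p : Params L M, braket ψ (outputState L M p 0)
        = ∑ b, pathAmplitude (fun n => qubitRotation (p.2.1 n) (p.2.2 n)) b * G b p.1)
    (k : Fin (L * M)) (p : Params L M) :
    (costGradient ψ k p : ℂ) = gradientSum G k p := by
  have h : HasDerivAt
      (fun t => ((cost ψ ((p.1, Function.update p.2.1 k t, p.2.2) : Params L M) : ℝ) : ℂ))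
      (gradientSum G k p) (p.2.1 k) := by
    simp only [cost_eq_sum hG]
    unfold gradientSum
    refine HasDerivAt.fun_sum fun b _ => HasDerivAt.fun_sum fun b' _ => ?_
    refine ((hasDerivAt_prod_update k
      (fun n => trigPart (b n) (prevBit b n) (b' n) (prevBit b' n)) _ p.2.1
      (hasDerivAt_trigPart _ _ _ _ _)).mul_const _).congr_deriv ?_
    have h1 : ∏ n, gradFactor k n b b' (p.2.1 n)
        = trigPartDeriv (b k) (prevBit b k) (b' k) (prevBit b' k) (p.2.1 k) *
          ∏ n ∈ Finset.univ.erase k,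
            trigPart (b n) (prevBit b n) (b' n) (prevBit b' n) (p.2.1 n) := by
      rw [← Finset.mul_prod_erase _ _ (Finset.mem_univ k), gradFactor, if_pos rfl]
      congr 1
      exact Finset.prod_congr rfl fun n hn => by
        rw [gradFactor, if_neg (Finset.ne_of_mem_erase hn)]
    rw [h1]
    ring
  -- The derivative was computed for the complex-valued cost. Its real part is the gradient, and its
  -- imaginary part vanishes because the cost is real.
  have hre := (Complex.reCLM.hasFDerivAt.comp_hasDerivAt (p.2.1 k) h).deriv
  have him := (Complex.imCLM.hasFDerivAt.comp_hasDerivAt (p.2.1 k) h).deriv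
  have him0 : (Complex.imCLM ∘ fun t =>
      ((cost ψ ((p.1, Function.update p.2.1 k t, p.2.2) : Params L M) : ℝ) : ℂ)) = fun _ => 0 := by
    funext t; simp
  rw [him0, deriv_const] at him
  apply Complex.ext
  · rw [Complex.ofReal_re]
    exact hre
  · rw [Complex.ofReal_im]
    exact him

instance (v : ℝ) : IsProbabilityMeasure (complexGaussian v) :=
  Measure.isProbabilityMeasure_map (by fun_prop)

instance (E : ℝ) (L M : ℕ) : IsProbabilityMeasure (ensemble E L M) := by
  unfold ensemble; infer_instance

lemma integral_ensemble_prod (E : ℝ) (L M : ℕ) (Γ : (Fin (L * M) → ℂ) → ℂ)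
    (u v : Fin (L * M) → ℝ → ℂ) :
    ∫ p : Params L M, Γ p.1 * ((∏ n, u n (p.2.1 n)) * ∏ n, v n (p.2.2 n)) ∂(ensemble E L M)
      = (∫ β, Γ β ∂(Measure.pi fun _ => complexGaussian (E / L))) *
        ((∏ n, ∫ t, u n t ∂uniformAngle) * ∏ n, ∫ t, v n t ∂uniformAngle) := by
  rw [ensemble, integral_prod_mul (f := Γ)
    (g := fun q : (Fin (L * M) → ℝ) × (Fin (L * M) → ℝ) => (∏ n, u n (q.1 n)) * ∏ n, v n (q.2 n)),
    integral_prod_mul (f := fun q : Fin (L * M) → ℝ => ∏ n, u n (q n))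
    (g := fun q : Fin (L * M) → ℝ => ∏ n, v n (q n)), integral_fintype_prod_eq_prod,
    integral_fintype_prod_eq_prod]

lemma integrable_ensemble_prod (E : ℝ) (L M : ℕ) {Γ : (Fin (L * M) → ℂ) → ℂ} (hΓ : Continuous Γ)
    {B : ℝ} (hB : ∀ β, ‖Γ β‖ ≤ B) {u v : Fin (L * M) → ℝ → ℂ} (hu : ∀ n, Continuous (u n))
    (hv : ∀ n, Continuous (v n)) :
    Integrable (fun p : Params L M => Γ p.1 * ((∏ n, u n (p.2.1 n)) * ∏ n, v n (p.2.2 n)))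
      (ensemble E L M) := by
  unfold ensemble
  refine Integrable.mul_prod (f := Γ)
    (g := fun q : (Fin (L * M) → ℝ) × (Fin (L * M) → ℝ) => (∏ n, u n (q.1 n)) * ∏ n, v n (q.2 n))
    ?_ ?_
  · exact Integrable.of_bound hΓ.aestronglyMeasurable B (Filter.Eventually.of_forall hB)
  · exact Integrable.mul_prod (f := fun q : Fin (L * M) → ℝ => ∏ n, u n (q n))
      (g := fun q : Fin (L * M) → ℝ => ∏ n, v n (q n))
      (Integrable.fintype_prod fun n => integrable_uniformAngle (hu n))
      (Integrable.fintype_prod fun n => integrable_uniformAngle (hv n))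

/-- The average over the angles of block `n` of the contribution of two pairs of paths. -/
def blockMean {N : ℕ} (k n : Fin N) (w : ((Fin N → Fin 2) × (Fin N → Fin 2)) ×
    ((Fin N → Fin 2) × (Fin N → Fin 2))) : ℂ :=
  (∫ t, gradFactor k n w.1.1 w.1.2 t * gradFactor k n w.2.1 w.2.2 t ∂uniformAngle) *
    ∫ t, phaseFactor n w.1.1 w.1.2 t * phaseFactor n w.2.1 w.2.2 t ∂uniformAngle

/-- The average of the path coefficients of two pairs of paths. -/
def pathCorrelator {L M : ℕ} (G : (Fin (L * M) → Fin 2) → (Fin (L * M) → ℂ) → ℂ) (E : ℝ)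
    (w : ((Fin (L * M) → Fin 2) × (Fin (L * M) → Fin 2)) ×
    ((Fin (L * M) → Fin 2) × (Fin (L * M) → Fin 2))) : ℂ :=
  ∫ β, (G w.1.1 β * starRingEnd ℂ (G w.1.2 β)) * (G w.2.1 β * starRingEnd ℂ (G w.2.2 β))
    ∂(Measure.pi fun _ => complexGaussian (E / L))

/-- The derivative of a trigonometric polynomial has no constant term. This is why the gradient has
mean zero. -/
lemma integral_gradFactor_self {N : ℕ} (k : Fin N) (b b' : Fin N → Fin 2) :
    ∫ t, gradFactor k k b b' t ∂uniformAngle = 0 := by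
  have h := integral_uniformAngle_trig 0 (trigSin (b k) (prevBit b k) (b' k) (prevBit b' k))
    (-trigCos (b k) (prevBit b k) (b' k) (prevBit b' k)) 1 0 0
  rw [zero_mul, mul_zero, mul_zero, add_zero, zero_div, add_zero] at h
  rw [← h]
  congr 1
  funext t
  rw [gradFactor, if_pos rfl, trigPartDeriv]
  ring

/-- As the mean vanishes, the variance is the second moment. The square of the double sum runs over
quadruples of paths, and independence factors each term into one angular average per block and one
average over displacements. -/
lemma gradientVariance_eq_sum {L M : ℕ} {ψ : Wave M}
    {G : (Fin (L * M) → Fin 2) → (Fin (L * M) → ℂ) → ℂ}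
    (hG : ∀ p : Params L M, braket ψ (outputState L M p 0)
        = ∑ b, pathAmplitude (fun n => qubitRotation (p.2.1 n) (p.2.2 n)) b * G b p.1)
    (hc : ∀ b, Continuous (G b)) {B : ℝ} (hB : ∀ b β, ‖G b β‖ ≤ B) (k : Fin (L * M)) (E : ℝ) :
    (gradientVariance L M ψ k E : ℂ) = ∑ w, (∏ n, blockMean k n w) * pathCorrelator G E w := by
  have hB0 : 0 ≤ B := (norm_nonneg _).trans (hB 0 0)
  have hcc : ∀ b, Continuous fun β => starRingEnd ℂ (G b β) := fun b =>
    Complex.continuous_conj.comp (hc b)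
  have hpair : ∀ b b' β, ‖G b β * starRingEnd ℂ (G b' β)‖ ≤ B * B := fun b b' β => by
    rw [norm_mul, RCLike.norm_conj]
    exact mul_le_mul (hB b β) (hB b' β) (norm_nonneg _) hB0
  have hcont : Continuous (gradientSum G k) := by
    unfold gradientSum
    refine continuous_finsetSum _ fun b _ => continuous_finsetSum _ fun b' _ => ?_
    refine (((hc b).comp continuous_fst).mul ((hcc b').comp continuous_fst)).mul
      (Continuous.mul (continuous_finsetProd _ fun n _ => ?_)
        (continuous_finsetProd _ fun n _ => ?_))
    · exact (continuous_gradFactor k n b b').comp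
        ((continuous_apply n).comp (continuous_fst.comp continuous_snd))
    · exact (continuous_phaseFactor n b b').comp
        ((continuous_apply n).comp (continuous_snd.comp continuous_snd))
  have hre : ∀ p, costGradient ψ k p = (gradientSum G k p).re := fun p => by
    rw [← costGradient_eq hG, Complex.ofReal_re]
  have hint : ∀ b b', Integrable (fun p : Params L M => (G b p.1 * starRingEnd ℂ (G b' p.1)) *
      ((∏ n, gradFactor k n b b' (p.2.1 n)) * ∏ n, phaseFactor n b b' (p.2.2 n)))
      (ensemble E L M) := fun b b' =>
    integrable_ensemble_prod E L M (Γ := fun β => G b β * starRingEnd ℂ (G b' β))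
      ((hc b).mul (hcc b')) (hpair b b')
      (fun n => continuous_gradFactor k n b b') (fun n => continuous_phaseFactor n b b')
  have hmean : ∫ p, costGradient ψ k p ∂(ensemble E L M) = 0 := by
    rw [← Complex.ofReal_inj, ← integral_complex_ofReal]
    simp only [costGradient_eq hG, gradientSum]
    rw [integral_finsetSum _ fun b _ => integrable_finsetSum _ fun b' _ => hint b b',
      Complex.ofReal_zero]
    refine Finset.sum_eq_zero fun b _ => ?_
    rw [integral_finsetSum _ fun b' _ => hint b b']
    refine Finset.sum_eq_zero fun b' _ => ?_
    rw [integral_ensemble_prod E L M (fun β => G b β * starRingEnd ℂ (G b' β)),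
      Finset.prod_eq_zero (Finset.mem_univ k) (integral_gradFactor_self k b b'), zero_mul, mul_zero]
  have hmeas : AEMeasurable (fun p => costGradient ψ k p) (ensemble E L M) := by
    simp only [hre]
    exact (Complex.continuous_re.comp hcont).measurable.aemeasurable
  rw [gradientVariance, variance_of_integral_eq_zero hmeas hmean, ← integral_complex_ofReal]
  have hsq : ∀ p : Params L M, ((costGradient ψ k p ^ 2 : ℝ) : ℂ)
      = ∑ w : ((Fin (L * M) → Fin 2) × (Fin (L * M) → Fin 2)) ×
        ((Fin (L * M) → Fin 2) × (Fin (L * M) → Fin 2)),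
        ((G w.1.1 p.1 * starRingEnd ℂ (G w.1.2 p.1)) *
          (G w.2.1 p.1 * starRingEnd ℂ (G w.2.2 p.1))) *
        ((∏ n, gradFactor k n w.1.1 w.1.2 (p.2.1 n) * gradFactor k n w.2.1 w.2.2 (p.2.1 n)) *
          ∏ n, phaseFactor n w.1.1 w.1.2 (p.2.2 n) * phaseFactor n w.2.1 w.2.2 (p.2.2 n)) := by
    intro p
    rw [Complex.ofReal_pow, costGradient_eq hG, gradientSum, sq, ← Fintype.sum_prod_type',
      Fintype.sum_mul_sum, ← Fintype.sum_prod_type']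
    refine Finset.sum_congr rfl fun w _ => ?_
    rw [Finset.prod_mul_distrib, Finset.prod_mul_distrib]
    ring
  simp only [hsq]
  rw [integral_finsetSum]
  · refine Finset.sum_congr rfl fun w _ => ?_
    rw [integral_ensemble_prod E L M (fun β => (G w.1.1 β * starRingEnd ℂ (G w.1.2 β)) *
        (G w.2.1 β * starRingEnd ℂ (G w.2.2 β)))
      (fun n t => gradFactor k n w.1.1 w.1.2 t * gradFactor k n w.2.1 w.2.2 t)
      (fun n t => phaseFactor n w.1.1 w.1.2 t * phaseFactor n w.2.1 w.2.2 t),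
      ← Finset.prod_mul_distrib, mul_comm]
    rfl
  · intro w _
    refine integrable_ensemble_prod E L M
      (Γ := fun β => (G w.1.1 β * starRingEnd ℂ (G w.1.2 β)) *
        (G w.2.1 β * starRingEnd ℂ (G w.2.2 β)))
      (u := fun n t => gradFactor k n w.1.1 w.1.2 t * gradFactor k n w.2.1 w.2.2 t)
      (v := fun n t => phaseFactor n w.1.1 w.1.2 t * phaseFactor n w.2.1 w.2.2 t)
      (((hc _).mul (hcc _)).mul ((hc _).mul (hcc _)))
      (B := (B * B) * (B * B)) (fun β => ?_)
      (fun n => (continuous_gradFactor k n _ _).mul (continuous_gradFactor k n _ _))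
      (fun n => (continuous_phaseFactor n _ _).mul (continuous_phaseFactor n _ _))
    rw [norm_mul]
    exact mul_le_mul (hpair _ _ β) (hpair _ _ β) (norm_nonneg _) (by positivity)

/-! ### Reduction to patterns -/

/-- The bits of the four paths relative to the first one in the three relations
`s = s' = r = r'`, `s = s' ≠ r = r'`, `s = r' ≠ s' = r`. -/
def patternBit : Fin 4 → Fin 3 → Fin 2 := ![![0, 0, 0], ![0, 0, 1], ![0, 1, 1], ![0, 1, 0]]

/-- The `i`-th path for a pattern `p` and first path `u`. -/
def patternPath {N : ℕ} (i : Fin 4) (p : Fin N → Fin 3) (u : Fin N → Fin 2) : Fin N → Fin 2 :=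
  fun n => patternBit i (p n) + u n

/-- The quadruple of paths for a pattern and a first path. -/
def patternQuad {N : ℕ} (pu : (Fin N → Fin 3) × (Fin N → Fin 2)) :
    ((Fin N → Fin 2) × (Fin N → Fin 2)) × ((Fin N → Fin 2) × (Fin N → Fin 2)) :=
  ((patternPath 0 pu.1 pu.2, patternPath 1 pu.1 pu.2),
    (patternPath 2 pu.1 pu.2, patternPath 3 pu.1 pu.2))

/-- The sign of the contribution of block `n` if its symbol is `y` and the preceding one `x`. -/
def stepSign {N : ℕ} (k n : Fin N) (x y : Fin 3) : ℝ :=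
  if n = k then (if (x = 1 ↔ y = 1) then 1 else -1)
  else if (x = 1 ∧ y = 2) ∨ (x = 2 ∧ y = 1) then -1 else 1

/-- All four paths start from the same bit `1`, which is the pattern letter `0` together with first
bit `1`. -/
lemma patternPath_cons {N : ℕ} (i : Fin 4) (p : Fin N → Fin 3) (u : Fin N → Fin 2)
    (m : Fin (N + 1)) :
    (Fin.cons 1 (patternPath i p u) : Fin (N + 1) → Fin 2) m
      = patternBit i ((Fin.cons 0 p : Fin (N + 1) → Fin 3) m) +
        (Fin.cons 1 u : Fin (N + 1) → Fin 2) m := by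
  refine Fin.cases ?_ (fun n => ?_) m
  · revert i; simp only [Fin.cons_zero]; decide
  · simp only [Fin.cons_succ, patternPath]

lemma injective_patternQuad {N : ℕ} : Function.Injective (patternQuad (N := N)) := by
  rintro ⟨p, u⟩ ⟨p', u'⟩ h
  simp only [patternQuad, Prod.mk.injEq] at h
  have key : ∀ (a a' : Fin 3) (c c' : Fin 2), patternBit 0 a + c = patternBit 0 a' + c' →
      patternBit 1 a + c = patternBit 1 a' + c' → patternBit 3 a + c = patternBit 3 a' + c' →
      a = a' ∧ c = c' := by decide
  have h' : ∀ n, p n = p' n ∧ u n = u' n := fun n =>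
    key _ _ _ _ (congrFun h.1.1 n) (congrFun h.1.2 n) (congrFun h.2.2 n)
  exact Prod.ext (funext fun n => (h' n).1) (funext fun n => (h' n).2)

/-- The average over the angles of one block, in terms of the qubit values. -/
def blockValue (κ : Prop) [Decidable κ] (x z x' z' y w y' w' : Fin 2) : ℂ :=
  ((if κ then 0 else trigMean x z x' z' * trigMean y w y' w') +
    (trigCos x z x' z' * trigCos y w y' w' + trigSin x z x' z' * trigSin y w y' w') / 2) *
    if phaseIndex x z x' z' + phaseIndex y w y' w' = 0 then 1 else 0

lemma blockMean_eq {N : ℕ} (k n : Fin N) (w : ((Fin N → Fin 2) × (Fin N → Fin 2)) ×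
    ((Fin N → Fin 2) × (Fin N → Fin 2))) :
    blockMean k n w = blockValue (n = k) (w.1.1 n) (prevBit w.1.1 n) (w.1.2 n) (prevBit w.1.2 n)
      (w.2.1 n) (prevBit w.2.1 n) (w.2.2 n) (prevBit w.2.2 n) := by
  rw [blockMean, blockValue]
  congr 1
  · by_cases h : n = k
    · rw [if_pos h]
      have := integral_uniformAngle_trig
        0 (trigSin (w.1.1 n) (prevBit w.1.1 n) (w.1.2 n) (prevBit w.1.2 n))
        (-trigCos (w.1.1 n) (prevBit w.1.1 n) (w.1.2 n) (prevBit w.1.2 n))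
        0 (trigSin (w.2.1 n) (prevBit w.2.1 n) (w.2.2 n) (prevBit w.2.2 n))
        (-trigCos (w.2.1 n) (prevBit w.2.1 n) (w.2.2 n) (prevBit w.2.2 n))
      simp only [gradFactor, if_pos h, trigPartDeriv]
      rw [zero_mul, neg_mul_neg, add_comm (_ * _) (_ * _)] at this
      rw [← this]
      congr 1; funext t; ring
    · rw [if_neg h, ← integral_uniformAngle_trig]
      simp only [gradFactor, if_neg h, trigPart]
  · rw [← integral_uniformAngle_exp]
    congr 1; funext t
    rw [phaseFactor, phaseFactor, ← Complex.exp_add]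
    congr 1; push_cast; ring

/-- A finite check. The value does not depend on the bits `c, c'` of the first path, so that path
later contributes only a count. -/
lemma blockValue_pattern {N : ℕ} (k n : Fin N) (a a' : Fin 3) (c c' : Fin 2) :
    blockValue (n = k) (patternBit 0 a + c) (patternBit 0 a' + c') (patternBit 1 a + c)
      (patternBit 1 a' + c') (patternBit 2 a + c) (patternBit 2 a' + c') (patternBit 3 a + c)
      (patternBit 3 a' + c') = ((1 / 2 * (stepSign k n a' a * stepWeight k n a' a) : ℝ) : ℂ) := by
  have hI : Complex.I * Complex.I = -1 := Complex.I_mul_I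
  by_cases h : n = k <;>
  fin_cases a <;> fin_cases a' <;> fin_cases c <;> fin_cases c' <;>
  simp [blockValue, patternBit, trigMean, trigCos, trigSin, phaseIndex, stepSign, stepWeight, h] <;>
  first | done | (ring_nf; done) | (ring_nf; simp; ring)

lemma blockMean_patternQuad {N : ℕ} (k n : Fin N) (pu : (Fin N → Fin 3) × (Fin N → Fin 2)) :
    blockMean k n (patternQuad pu)
      = ((1 / 2 * (stepSign k n ((Fin.cons 0 pu.1 : Fin (N + 1) → Fin 3) n.castSucc) (pu.1 n) *
        stepWeight k n ((Fin.cons 0 pu.1 : Fin (N + 1) → Fin 3) n.castSucc) (pu.1 n)) : ℝ) : ℂ) := by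
  rw [blockMean_eq, ← blockValue_pattern k n _ _ (pu.2 n)
    ((Fin.cons 1 pu.2 : Fin (N + 1) → Fin 2) n.castSucc)]
  simp only [patternQuad, prevBit, patternPath_cons]
  rfl

/-- A nonzero `φ` average requires the alternating sums of the four bits at consecutive blocks to be
opposite. They vanish initially, hence everywhere, and the six balanced quadruples of bits are the
three relations with either value of the first bit. -/
lemma mem_range_patternQuad {N : ℕ} (k : Fin N) (w : ((Fin N → Fin 2) × (Fin N → Fin 2)) ×
    ((Fin N → Fin 2) × (Fin N → Fin 2))) (h : ∀ n, blockMean k n w ≠ 0) :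
    w ∈ Set.range (patternQuad (N := N)) := by
  have hph : ∀ n, phaseIndex (w.1.1 n) (prevBit w.1.1 n) (w.1.2 n) (prevBit w.1.2 n) +
      phaseIndex (w.2.1 n) (prevBit w.2.1 n) (w.2.2 n) (prevBit w.2.2 n) = 0 := fun n => by
    by_contra hne
    apply h n
    rw [blockMean_eq, blockValue, if_neg hne, mul_zero]
  have hbal : ∀ m : Fin (N + 1),
      (((Fin.cons 1 w.1.1 : Fin (N + 1) → Fin 2) m : ℕ) : ℤ) -
      (((Fin.cons 1 w.1.2 : Fin (N + 1) → Fin 2) m : ℕ) : ℤ) +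
      (((Fin.cons 1 w.2.1 : Fin (N + 1) → Fin 2) m : ℕ) : ℤ) -
      (((Fin.cons 1 w.2.2 : Fin (N + 1) → Fin 2) m : ℕ) : ℤ) = 0 := by
    intro m
    induction m using Fin.induction with
    | zero => simp
    | succ n ih =>
      have := hph n
      simp only [phaseIndex, prevBit] at this
      simp only [Fin.cons_succ]
      linarith
  have key : ∀ x x' y y' : Fin 2,
      ((x : ℕ) : ℤ) - ((x' : ℕ) : ℤ) + ((y : ℕ) : ℤ) - ((y' : ℕ) : ℤ) = 0 →
      ∃ (a : Fin 3) (c : Fin 2), patternBit 0 a + c = x ∧ patternBit 1 a + c = x' ∧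
        patternBit 2 a + c = y ∧ patternBit 3 a + c = y' := by decide
  have hex : ∀ n : Fin N, ∃ (a : Fin 3) (c : Fin 2), patternBit 0 a + c = w.1.1 n ∧
      patternBit 1 a + c = w.1.2 n ∧ patternBit 2 a + c = w.2.1 n ∧
      patternBit 3 a + c = w.2.2 n := fun n => by
    have := hbal n.succ
    simp only [Fin.cons_succ] at this
    exact key _ _ _ _ this
  choose p u h0 h1 h2 h3 using hex
  exact ⟨(p, u), Prod.ext (Prod.ext (funext h0) (funext h1)) (Prod.ext (funext h2) (funext h3))⟩

/-- The sign of the contribution of a pattern. -/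
def patternSign {L M : ℕ} (k : Fin (L * M)) (p : Fin (L * M) → Fin 3) : ℝ :=
  ∏ n, stepSign k n (p ((finRotate (L * M)).symm n)) (p n)

lemma sum_pathCorrelator_eq {L M : ℕ} (G : (Fin (L * M) → Fin 2) → (Fin (L * M) → ℂ) → ℂ)
    (hG : ∀ b, (Fin.cons 1 b : Fin (L * M + 1) → Fin 2) (Fin.last _) ≠ 1 → G b = 0)
    (k : Fin (L * M)) (E : ℝ) :
    ∑ w, (∏ n, blockMean k n w) * pathCorrelator G E w
      = ∑ p ∈ patterns L M 3, ∑ u : Fin (L * M) → Fin 2 with u (lastBlock k.pos) = 1,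
        (((1 / 2) ^ (L * M) * (patternSign k p * weight k p) : ℝ) : ℂ) *
          pathCorrelator G E (patternQuad (p, u)) := by
  have hzero : ∀ w, (G w.1.1 = 0 ∨ G w.1.2 = 0 ∨ G w.2.1 = 0 ∨ G w.2.2 = 0) →
      pathCorrelator G E w = 0 := fun w hw => by
    rw [pathCorrelator]
    rcases hw with h | h | h | h <;> simp [h]
  rw [← Fintype.sum_of_injective patternQuad injective_patternQuad
    (fun pu => (∏ n, blockMean k n (patternQuad pu)) * pathCorrelator G E (patternQuad pu)) _
    (fun w hw => ?_) fun pu => rfl]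
  · rw [Fintype.sum_prod_type, patterns_eq k.pos, Finset.sum_filter]
    refine Finset.sum_congr rfl fun p _ => ?_
    rw [Finset.sum_filter]
    split_ifs with hp
    · refine Finset.sum_congr rfl fun u _ => ?_
      split_ifs with hu
      · congr 1
        simp only [blockMean_patternQuad]
        rw [← Complex.ofReal_prod, Finset.prod_mul_distrib, Finset.prod_mul_distrib,
          Finset.prod_const, Finset.card_univ, Fintype.card_fin, weight_eq_prod, patternSign]
        simp only [cyclic_pred_eq k.pos p 0 hp]
      · rw [hzero, mul_zero]
        refine Or.inl (hG _ ?_)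
        rw [cons_last_eq k.pos]
        have : patternBit 0 (p (lastBlock k.pos)) = 0 := by generalize p _ = a; revert a; decide
        rwa [show (patternQuad (p, u)).1.1 (lastBlock k.pos) = u (lastBlock k.pos) by
          rw [← zero_add (u _), ← this]; rfl]
    · refine Finset.sum_eq_zero fun u _ => ?_
      rw [hzero, mul_zero]
      -- If the last letter is not `0`, the first and third paths end in different bits, so one of
      -- them violates the final condition.
      by_cases hu : u (lastBlock k.pos) = 1
      · refine Or.inr (Or.inr (Or.inl (hG _ ?_)))
        rw [cons_last_eq k.pos]
        change patternBit 2 (p (lastBlock k.pos)) + u (lastBlock k.pos) ≠ 1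
        rw [hu]
        generalize p _ = a at hp ⊢
        revert a; decide
      · refine Or.inl (hG _ ?_)
        rw [cons_last_eq k.pos]
        have : patternBit 0 (p (lastBlock k.pos)) = 0 := by generalize p _ = a; revert a; decide
        rwa [show (patternQuad (p, u)).1.1 (lastBlock k.pos) = u (lastBlock k.pos) by
          rw [← zero_add (u _), ← this]; rfl]
  · by_contra hne
    apply hw
    refine mem_range_patternQuad k w fun n hn => hne ?_
    rw [Finset.prod_eq_zero (Finset.mem_univ n) hn, zero_mul]

/-! ### Sums of independent complex Gaussians -/

lemma complexGaussian_charFunDual {v : ℝ} (hv : 0 ≤ v) (ℓ : StrongDual ℝ ℂ) :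
    charFunDual (complexGaussian v) ℓ
      = Complex.exp ((-(v / 4 * (ℓ 1 ^ 2 + ℓ Complex.I ^ 2)) : ℝ) : ℂ) := by
  have hre : ∀ t : ℝ, ∫ x, Complex.exp ((x * t : ℝ) * Complex.I)
      ∂(gaussianReal 0 (v / 2).toNNReal) = Complex.exp ((-(v / 4 * t ^ 2) : ℝ) : ℂ) := fun t => by
    have h := charFun_gaussianReal (μ := 0) (v := (v / 2).toNNReal) t
    rw [charFun_apply_real] at h
    have e : ∀ x : ℝ, ((x * t : ℝ) : ℂ) * Complex.I = t * x * Complex.I := fun x => by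
      push_cast; ring
    simp only [e]
    rw [h]
    congr 1
    rw [show (((v / 2).toNNReal : ℝ)) = v / 2 from Real.coe_toNNReal _ (by positivity)]
    push_cast
    ring
  rw [charFunDual_apply, complexGaussian, integral_map (by fun_prop)
    (by fun_prop : Continuous fun z : ℂ => Complex.exp (ℓ z * Complex.I)).aestronglyMeasurable]
  have e : ∀ t : ℝ × ℝ, Complex.exp ((ℓ ((t.1 : ℂ) + (t.2 : ℂ) * Complex.I) : ℝ) * Complex.I)
      = Complex.exp ((t.1 * ℓ 1 : ℝ) * Complex.I) *
        Complex.exp ((t.2 * ℓ Complex.I : ℝ) * Complex.I) := fun t => by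
    rw [← Complex.exp_add, ← add_mul, ← Complex.ofReal_add]
    congr 3
    rw [map_add, ← Complex.real_smul, map_smul, smul_eq_mul]
    congr 1
    rw [show (t.1 : ℂ) = t.1 • (1 : ℂ) by rw [Complex.real_smul, mul_one], map_smul, smul_eq_mul]
  simp only [e]
  rw [integral_prod_mul (f := fun x : ℝ => Complex.exp ((x * ℓ 1 : ℝ) * Complex.I))
    (g := fun x : ℝ => Complex.exp ((x * ℓ Complex.I : ℝ) * Complex.I)), hre, hre,
    ← Complex.exp_add]
  congr 1
  push_cast
  ring

/-- The signed sums of the displacements of each mode over the blocks with a given symbol. -/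
def groupSums {N M : ℕ} {ι : Type*} [DecidableEq ι] (μ : Fin N → Fin M) (p : Fin N → ι)
    (ε : Fin N → ℝ) (β : Fin N → ℂ) (a : ι) (j : Fin M) : ℂ :=
  ∑ n, if μ n = j ∧ p n = a then (ε n : ℂ) * β n else 0

instance {M : ℕ} (E : ℝ) (z : Fin M → ℝ) : IsProbabilityMeasure (gaussianVector E z) := by
  unfold gaussianVector; infer_instance

lemma continuous_groupSums {N M : ℕ} {ι : Type*} [DecidableEq ι] (μ : Fin N → Fin M)
    (p : Fin N → ι) (ε : Fin N → ℝ) : Continuous (groupSums μ p ε) := by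
  refine continuous_pi fun a => continuous_pi fun j => continuous_finsetSum _ fun n _ => ?_
  split_ifs
  · fun_prop
  · exact continuous_const

/-- Different symbols and modes involve disjoint sets of displacements, so the sums are independent,
each with variance the number of its terms times `E / L`. The characteristic function sees the signs
`ε` only through their squares. -/
lemma map_groupSums {L M : ℕ} {ι : Type*} [Fintype ι] [DecidableEq ι] (p : Fin (L * M) → ι)
    {ε : Fin (L * M) → ℝ} (hε : ∀ n, ε n ^ 2 = 1) {E : ℝ} (hE : 0 ≤ E) :
    (Measure.pi fun _ => complexGaussian (E / L)).map (groupSums Fin.modNat p ε)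
      = Measure.pi fun a : ι => gaussianVector E fun j =>
        (Finset.card {n : Fin (L * M) | n.modNat = j ∧ p n = a} : ℝ) / L := by
  let T : (Fin (L * M) → ℂ) →L[ℝ] (ι → Fin M → ℂ) :=
    { toFun := groupSums Fin.modNat p ε
      map_add' := fun β β' => by
        funext a j
        simp only [groupSums, Pi.add_apply, ← Finset.sum_add_distrib]
        exact Finset.sum_congr rfl fun n _ => by split_ifs <;> ring
      map_smul' := fun c β => by
        funext a j
        simp only [groupSums, Pi.smul_apply, RingHom.id_apply, Finset.smul_sum, Complex.real_smul]
        exact Finset.sum_congr rfl fun n _ => by split_ifs <;> ring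
      cont := continuous_groupSums _ _ _ }
  have hT : groupSums Fin.modNat p ε = T := rfl
  have := Measure.isProbabilityMeasure_map (μ := Measure.pi fun _ : Fin (L * M) =>
    complexGaussian (E / L)) (continuous_groupSums Fin.modNat p ε).aemeasurable
  refine Measure.ext_of_charFunDual (funext fun ℓ => ?_)
  rw [hT, charFunDual_map, charFunDual_pi, charFunDual_pi]
  set Q : ι → Fin M → ℝ := fun a j =>
    ℓ (Pi.single a (Pi.single j 1)) ^ 2 + ℓ (Pi.single a (Pi.single j Complex.I)) ^ 2 with hQ
  have hl : ∀ n, charFunDual (complexGaussian (E / L)) ((ℓ.comp T).comp (.single ℝ (fun _ => ℂ) n))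
      = Complex.exp ((-(E / L / 4 * Q (p n) n.modNat) : ℝ) : ℂ) := fun n => by
    rw [complexGaussian_charFunDual (by positivity)]
    have hs : ∀ z : ℂ, ((ℓ.comp T).comp (.single ℝ (fun _ => ℂ) n)) z
        = ε n * ℓ (Pi.single (p n) (Pi.single n.modNat z)) := fun z => by
      have : T (Pi.single n z : Fin (L * M) → ℂ)
          = ε n • (Pi.single (p n) (Pi.single n.modNat z) : ι → Fin M → ℂ) := by
        funext a j
        change (∑ m, if m.modNat = j ∧ p m = a then (ε m : ℂ) *
          (Pi.single n z : Fin (L * M) → ℂ) m else 0) = _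
        rw [Finset.sum_eq_single n (fun m _ hm => by simp [Pi.single_eq_of_ne hm]) (by simp)]
        simp only [Pi.single_eq_same, Pi.smul_apply, Complex.real_smul]
        by_cases h1 : p n = a
        · subst h1
          by_cases h2 : n.modNat = j
          · subst h2; simp
          · simp [h2]
        · simp [h1]
      change ℓ (T (Pi.single n z : Fin (L * M) → ℂ)) = _
      rw [this, map_smul, smul_eq_mul]
    rw [hs, hs, mul_pow, mul_pow, hε, one_mul, one_mul]
  have hr : ∀ a, charFunDual (gaussianVector E fun j =>
        (Finset.card {n : Fin (L * M) | n.modNat = j ∧ p n = a} : ℝ) / L) (ℓ.comp (.single ℝ (fun _ => Fin M → ℂ) a))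
      = Complex.exp ((-∑ j, ∑ n : Fin (L * M), if n.modNat = j ∧ p n = a then
          E / L / 4 * Q (p n) n.modNat else 0 : ℝ) : ℂ) := fun a => by
    rw [gaussianVector, charFunDual_pi]
    have : ∀ j, charFunDual (complexGaussian
        ((Finset.card {n : Fin (L * M) | n.modNat = j ∧ p n = a} : ℝ) / L * E))
        ((ℓ.comp (.single ℝ (fun _ => Fin M → ℂ) a)).comp (.single ℝ (fun _ => ℂ) j))
        = Complex.exp ((-∑ n : Fin (L * M), if n.modNat = j ∧ p n = a then
          E / L / 4 * Q (p n) n.modNat else 0 : ℝ) : ℂ) := fun j => by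
      rw [complexGaussian_charFunDual
        (mul_nonneg (div_nonneg (Nat.cast_nonneg _) (Nat.cast_nonneg _)) hE)]
      congr 3
      rw [← Finset.sum_filter, Finset.sum_congr rfl (g := fun _ => E / L / 4 * Q a j),
        Finset.sum_const, nsmul_eq_mul]
      · simp only [hQ, ContinuousLinearMap.comp_apply, ContinuousLinearMap.single_apply]
        ring
      · intro n hn
        rw [(Finset.mem_filter.1 hn).2.1, (Finset.mem_filter.1 hn).2.2]
    simp only [this]
    rw [← Complex.exp_sum, ← Complex.ofReal_sum, Finset.sum_neg_distrib]
  simp only [hl, hr]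
  rw [← Complex.exp_sum, ← Complex.exp_sum, ← Complex.ofReal_sum, ← Complex.ofReal_sum,
    Finset.sum_neg_distrib, Finset.sum_neg_distrib]
  congr 3
  simp_rw [Finset.sum_comm (s := Finset.univ (α := Fin M)) (t := Finset.univ (α := Fin (L * M)))]
  rw [Finset.sum_comm]
  refine Finset.sum_congr rfl fun n _ => ?_
  rw [Finset.sum_eq_single (p n), Finset.sum_eq_single n.modNat] <;> simp +contextual [eq_comm]

lemma complexGaussian_zero : complexGaussian 0 = Measure.dirac 0 := by
  rw [complexGaussian]
  simp only [zero_div, Real.toNNReal_zero, gaussianReal_zero_var, Measure.dirac_prod_dirac]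
  rw [Measure.map_dirac' (by fun_prop)]
  simp

lemma gaussianVector_zero {M : ℕ} (E : ℝ) :
    gaussianVector E (0 : Fin M → ℝ) = Measure.dirac 0 := by
  rw [gaussianVector]
  simp only [Pi.zero_apply, zero_mul, complexGaussian_zero]
  refine Measure.pi_eq fun s hs => ?_
  rw [Measure.dirac_apply' _ (MeasurableSet.univ_pi hs)]
  simp only [Measure.dirac_apply' _ (hs _)]
  by_cases h : ∀ i, (0 : ℂ) ∈ s i
  · simp [h]
  · obtain ⟨i, hi⟩ := not_forall.1 h
    rw [Set.indicator_of_notMem (by simpa using h), Finset.prod_eq_zero (Finset.mem_univ i)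
      (Set.indicator_of_notMem hi _)]

/-- The coherent-state amplitude `|⟨ψ|α⟩|`. -/
def amp {M : ℕ} (ψ : Wave M) (α : Fin M → ℂ) : ℝ := ‖braket ψ (coherent α)‖

lemma amp_nonneg {M : ℕ} (ψ : Wave M) (α : Fin M → ℂ) : 0 ≤ amp ψ α := norm_nonneg _

lemma C₂_eq {M : ℕ} (ψ : Wave M) (E : ℝ) (z : Fin M → ℝ) :
    C₂ ψ E z = ∫ α, amp ψ (α.1 + α.2) ^ 2 * amp ψ (α.1 - α.2) ^ 2
      ∂((gaussianVector E z).prod (gaussianVector E (1 - z))) := by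
  simp [C₂, amp, Fin.prod_univ_two, sub_eq_add_neg]

lemma C₃_eq {M : ℕ} (ψ : Wave M) (E : ℝ) (z z' : Fin M → ℝ) :
    C₃ ψ E z z' = ∫ α, (amp ψ (α.1 + α.2.1 + α.2.2) * amp ψ (α.1 + α.2.1 - α.2.2)) *
        (amp ψ (α.1 - α.2.1 - α.2.2) * amp ψ (α.1 - α.2.1 + α.2.2))
      ∂((gaussianVector E z).prod ((gaussianVector E z').prod (gaussianVector E (1 - z - z')))) := by
  simp [C₃, amp, Fin.prod_univ_two, sub_eq_add_neg]

/-- The second Gaussian vector is a point mass at `0`, so the two arguments coincide. -/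
lemma C₂_one {M : ℕ} (ψ : Wave M) (E : ℝ) (hc : Continuous fun α => braket ψ (coherent α)) :
    C₂ ψ E 1 = C₁ ψ E := by
  have hc' : Continuous fun α => amp ψ α := hc.norm
  rw [C₂_eq, C₁, sub_self, gaussianVector_zero, Measure.prod_dirac,
    integral_map (by fun_prop) (by fun_prop)]
  refine integral_congr_ae (.of_forall fun α => ?_)
  simp only [add_zero, sub_zero, amp]
  ring

lemma sum_fraction {L M q : ℕ} (hL : 0 < L) (p : Fin (L * M) → Fin q) (j : Fin M) :
    ∑ a, fraction p a j = 1 := by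
  have h := card_filter_modNat (L := L) j
  simp only [fraction]
  rw [← Finset.sum_div, ← Nat.cast_sum, div_eq_one_iff_eq (by positivity)]
  congr 1
  refine Eq.trans ?_ h
  rw [Finset.card_eq_sum_card_fiberwise (f := p) (t := Finset.univ) (by simp)]
  simp [Finset.filter_filter]

lemma map_groupSums_two {L M : ℕ} (hL : 0 < L) (p : Fin (L * M) → Fin 2)
    {ε : Fin (L * M) → ℝ} (hε : ∀ n, ε n ^ 2 = 1) {E : ℝ} (hE : 0 ≤ E) :
    MeasurePreserving (fun β => (groupSums Fin.modNat p ε β 0, groupSums Fin.modNat p ε β 1))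
      (Measure.pi fun _ => complexGaussian (E / L))
      ((gaussianVector E (fraction p 0)).prod (gaussianVector E (1 - fraction p 0))) := by
  have h1 : MeasurePreserving (groupSums Fin.modNat p ε)
      (Measure.pi fun _ => complexGaussian (E / L))
      (Measure.pi fun a => gaussianVector E (fraction p a)) :=
    ⟨(continuous_groupSums _ _ _).measurable, map_groupSums p hε hE⟩
  have h2 := (measurePreserving_piFinTwo fun a : Fin 2 => gaussianVector E (fraction p a)).comp h1
  have e : fraction p 1 = 1 - fraction p 0 := by
    funext j
    have := sum_fraction hL p j
    rw [Fin.sum_univ_two] at this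
    simp only [Pi.sub_apply, Pi.one_apply]
    linarith
  rw [e] at h2
  exact h2

lemma map_groupSums_three {L M : ℕ} (hL : 0 < L) (p : Fin (L * M) → Fin 3)
    {ε : Fin (L * M) → ℝ} (hε : ∀ n, ε n ^ 2 = 1) {E : ℝ} (hE : 0 ≤ E) :
    MeasurePreserving (fun β => (groupSums Fin.modNat p ε β 0, groupSums Fin.modNat p ε β 1,
        groupSums Fin.modNat p ε β 2))
      (Measure.pi fun _ => complexGaussian (E / L))
      ((gaussianVector E (fraction p 0)).prod ((gaussianVector E (fraction p 1)).prod
        (gaussianVector E (1 - fraction p 0 - fraction p 1)))) := by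
  have h1 : MeasurePreserving (groupSums Fin.modNat p ε)
      (Measure.pi fun _ => complexGaussian (E / L))
      (Measure.pi fun a => gaussianVector E (fraction p a)) :=
    ⟨(continuous_groupSums _ _ _).measurable, map_groupSums p hε hE⟩
  have h2 := (measurePreserving_piFinSuccAbove
    (fun a : Fin 3 => gaussianVector E (fraction p a)) 0).comp h1
  have h3 := ((MeasurePreserving.id (gaussianVector E (fraction p 0))).prod
    (measurePreserving_piFinTwo
      fun a : Fin 2 => gaussianVector E (fraction p ((0 : Fin 3).succAbove a)))).comp h2
  have e : fraction p 2 = 1 - fraction p 0 - fraction p 1 := by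
    funext j
    have := sum_fraction hL p j
    rw [Fin.sum_univ_three] at this
    simp only [Pi.sub_apply, Pi.one_apply]
    linarith
  rw [← e]
  exact h3

lemma bitSign_add (a b : Fin 2) : bitSign (a + b) = bitSign a * bitSign b := by
  fin_cases a <;> fin_cases b <;> simp [bitSign]

lemma bitSign_sq (a : Fin 2) : bitSign a ^ 2 = 1 := by
  fin_cases a <;> simp [bitSign]

lemma totalDisplacement_patternPath {N M : ℕ} (μ : Fin N → Fin M) (i : Fin 4)
    (p : Fin N → Fin 3) (u : Fin N → Fin 2) (β : Fin N → ℂ) :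
    totalDisplacement μ (fun n => bitSign (patternPath i p u n)) β
      = ∑ a, (bitSign (patternBit i a) : ℂ) • groupSums μ p (fun n => bitSign (u n)) β a := by
  funext j
  simp only [totalDisplacement, patternPath, Finset.sum_apply, Pi.smul_apply, groupSums,
    Finset.smul_sum, bitSign_add]
  rw [Finset.sum_comm]
  refine Finset.sum_congr rfl fun n _ => ?_
  rw [Finset.sum_eq_single (p n) (fun a _ ha => by simp [ha.symm]) (by simp)]
  by_cases h : μ n = j
  · simp [h, mul_assoc]
  · simp [h]

/-- A two-symbol pattern read as a three-symbol pattern with second symbol `c`. -/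
def embedPattern {N : ℕ} (c : Fin 3) (q : Fin N → Fin 2) (n : Fin N) : Fin 3 :=
  if q n = 0 then 0 else c

lemma totalDisplacement_embedPattern {N M : ℕ} (μ : Fin N → Fin M) (i : Fin 4) (c : Fin 3)
    (q u : Fin N → Fin 2) (β : Fin N → ℂ) :
    totalDisplacement μ (fun n => bitSign (patternPath i (embedPattern c q) u n)) β
      = groupSums μ q (fun n => bitSign (u n)) β 0
        + (bitSign (patternBit i c) : ℂ) • groupSums μ q (fun n => bitSign (u n)) β 1 := by
  have h0 : patternBit i 0 = 0 := by fin_cases i <;> rfl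
  funext j
  simp only [totalDisplacement, patternPath, Pi.smul_apply, groupSums, Pi.add_apply,
    Finset.smul_sum, bitSign_add, ← Finset.sum_add_distrib]
  refine Finset.sum_congr rfl fun n _ => ?_
  by_cases h : μ n = j
  · obtain h' | h' : q n = 0 ∨ q n = 1 := by omega
    · simp [h, embedPattern, h', h0, bitSign]
    · simp [h, embedPattern, h', mul_assoc]
  · simp [h]

/-- For second symbol `1` the paths pair up as first with second and third with fourth; for `2`, as
first with fourth and second with third. Each pair contributes a coefficient times its own
conjugate, so all phases drop out and equality holds. -/
lemma pathCorrelator_embedPattern {L M : ℕ} (hL : 0 < L) {ψ : Wave M} (hψ : MemLp ψ 2 volume)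
    {G : (Fin (L * M) → Fin 2) → (Fin (L * M) → ℂ) → ℂ} {q u : Fin (L * M) → Fin 2} {c : Fin 3}
    (hc : c ≠ 0)
    (hG : ∀ i β, ‖G (patternPath i (embedPattern c q) u) β‖ = amp ψ (totalDisplacement Fin.modNat
      (fun n => bitSign (patternPath i (embedPattern c q) u n)) β)) {E : ℝ} (hE : 0 ≤ E) :
    pathCorrelator G E (patternQuad (embedPattern c q, u))
      = ((C₂ ψ E (fraction q 0) : ℝ) : ℂ) := by
  have hcont : Continuous fun α => amp ψ α := (continuous_braket_coherent hψ).norm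
  have hmp := map_groupSums_two hL q (fun n => bitSign_sq (u n)) hE
  rw [pathCorrelator, C₂_eq, ← hmp.map_eq, integral_map hmp.aemeasurable (by fun_prop),
    ← integral_complex_ofReal]
  refine integral_congr_ae (.of_forall fun β => ?_)
  obtain rfl | rfl : c = 1 ∨ c = 2 := by omega
  · have h01 : patternPath 1 (embedPattern 1 q) u = patternPath 0 (embedPattern 1 q) u := by
      funext n
      simp only [patternPath, embedPattern]
      split_ifs <;> rfl
    have h23 : patternPath 3 (embedPattern 1 q) u = patternPath 2 (embedPattern 1 q) u := by
      funext n
      simp only [patternPath, embedPattern]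
      split_ifs <;> rfl
    simp only [patternQuad, h01, h23, Complex.mul_conj', hG, totalDisplacement_embedPattern]
    simp [patternBit, bitSign, sub_eq_add_neg]
  · have h03 : patternPath 3 (embedPattern 2 q) u = patternPath 0 (embedPattern 2 q) u := by
      funext n
      simp only [patternPath, embedPattern]
      split_ifs <;> rfl
    have h12 : patternPath 2 (embedPattern 2 q) u = patternPath 1 (embedPattern 2 q) u := by
      funext n
      simp only [patternPath, embedPattern]
      split_ifs <;> rfl
    have e : ∀ x y : ℂ, x * starRingEnd ℂ y * (y * starRingEnd ℂ x)
        = (x * starRingEnd ℂ x) * (y * starRingEnd ℂ y) := fun x y => by ring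
    simp only [patternQuad, h03, h12, e, Complex.mul_conj', hG, totalDisplacement_embedPattern]
    simp [patternBit, bitSign, sub_eq_add_neg]

/-- With three symbols the four paths need not pair up and the phases may survive, so only the
triangle inequality is available. -/
lemma norm_pathCorrelator_le {L M : ℕ} (hL : 0 < L) {ψ : Wave M} (hψ : MemLp ψ 2 volume)
    {G : (Fin (L * M) → Fin 2) → (Fin (L * M) → ℂ) → ℂ} {p : Fin (L * M) → Fin 3}
    {u : Fin (L * M) → Fin 2}
    (hG : ∀ i β, ‖G (patternPath i p u) β‖ = amp ψ (totalDisplacement Fin.modNat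
      (fun n => bitSign (patternPath i p u n)) β)) {E : ℝ} (hE : 0 ≤ E) :
    ‖pathCorrelator G E (patternQuad (p, u))‖ ≤ C₃ ψ E (fraction p 0) (fraction p 1) := by
  have hcont : Continuous fun α => amp ψ α := (continuous_braket_coherent hψ).norm
  have hmp := map_groupSums_three hL p (fun n => bitSign_sq (u n)) hE
  rw [pathCorrelator, C₃_eq, ← hmp.map_eq, integral_map hmp.aemeasurable (by fun_prop)]
  refine (norm_integral_le_integral_norm _).trans (le_of_eq ?_)
  refine integral_congr_ae (.of_forall fun β => ?_)
  simp only [patternQuad, norm_mul, RCLike.norm_conj, hG, totalDisplacement_patternPath,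
    Fin.sum_univ_three]
  simp [patternBit, bitSign, sub_eq_add_neg]

/-! ### Collecting the patterns into a formula for the variance -/

lemma card_bits {N : ℕ} (hN : 0 < N) :
    Finset.card {u : Fin N → Fin 2 | u (lastBlock hN) = 1} = 2 ^ (N - 1) := by
  have h2 : Finset.card {u : Fin N → Fin 2 | u (lastBlock hN) = 1}
      = Finset.card {u : Fin N → Fin 2 | ¬ u (lastBlock hN) = 1} := by
    refine Finset.card_nbij' (fun u => u + 1) (fun u => u + 1) ?_ ?_ ?_ ?_
    · intro u hu
      simp only [Finset.coe_filter, Finset.mem_univ, true_and, Set.mem_ofPred_eq] at hu ⊢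
      simp [hu]
    · intro u hu
      simp only [Finset.coe_filter, Finset.mem_univ, true_and, Set.mem_ofPred_eq] at hu ⊢
      have : u (lastBlock hN) = 0 := by omega
      simp [this]
    · intro u _
      funext n
      simp [add_assoc]
    · intro u _
      funext n
      simp [add_assoc]
  have h := Finset.card_filter_add_card_filter_not (s := (Finset.univ : Finset (Fin N → Fin 2)))
    (fun u => u (lastBlock hN) = 1)
  simp only [Finset.card_univ, Fintype.card_fun, Fintype.card_fin] at h
  obtain ⟨n, rfl⟩ : ∃ n, N = n + 1 := ⟨N - 1, by omega⟩
  rw [pow_succ] at h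
  simp only [Nat.add_sub_cancel]
  omega

lemma embedPattern_injective {N : ℕ} {c : Fin 3} (hc : c ≠ 0) :
    Function.Injective (embedPattern (N := N) c) := fun q q' h => by
  funext n
  have := congrFun h n
  simp only [embedPattern] at this
  split_ifs at this with h1 h2 h2
  · rw [h1, h2]
  · exact absurd this.symm hc
  · exact absurd this hc
  · omega

lemma embedPattern_eq_iff {N : ℕ} {c : Fin 3} (hc : c ≠ 0) (q : Fin N → Fin 2) (m n : Fin N) :
    embedPattern c q m = embedPattern c q n ↔ q m = q n := by
  simp only [embedPattern]
  split_ifs with h1 h2 h2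
  · simp [h1, h2]
  · simp [h1, hc.symm, Ne.symm h2]
  · simp [hc, h1, h2]
  · have : q m = q n := by omega
    simp [this]

lemma weight_embedPattern {L M : ℕ} (k : Fin (L * M)) {c : Fin 3} (hc : c ≠ 0)
    (q : Fin (L * M) → Fin 2) : weight k (embedPattern c q) = weight k q := by
  simp only [weight, embedPattern_eq_iff hc]

/-- A negative sign away from `k` requires a transition between `1` and `2`; without the letter `2`
only block `k` can contribute one. -/
lemma patternSign_embedPattern_one {L M : ℕ} (k : Fin (L * M)) (q : Fin (L * M) → Fin 2) :
    patternSign k (embedPattern 1 q) = if q k = q ((finRotate (L * M)).symm k) then 1 else -1 := by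
  have h : ∀ n, embedPattern 1 q n ≠ 2 := fun n => by
    simp only [embedPattern]; split_ifs <;> decide
  rw [patternSign, Finset.prod_eq_single k]
  · simp only [stepSign, if_true, ← embedPattern_eq_iff (c := 1) (by decide)]
    congr 1
    have h1 := h k
    have h2 := h ((finRotate (L * M)).symm k)
    have e1 : ∀ x y : Fin 3, x ≠ 2 → y ≠ 2 → ((x = 1 ↔ y = 1) = (y = x)) := by decide
    exact e1 _ _ h2 h1
  · intro n _ hn
    simp [stepSign, hn, h]
  · simp

lemma patternSign_embedPattern_two {L M : ℕ} (k : Fin (L * M)) (q : Fin (L * M) → Fin 2) :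
    patternSign k (embedPattern 2 q) = 1 := by
  have h : ∀ n, embedPattern 2 q n ≠ 1 := fun n => by
    simp only [embedPattern]; split_ifs <;> decide
  exact Finset.prod_eq_one fun n _ => by simp [stepSign, h]

lemma abs_patternSign {L M : ℕ} (k : Fin (L * M)) (p : Fin (L * M) → Fin 3) :
    |patternSign k p| = 1 := by
  rw [patternSign, Finset.abs_prod]
  exact Finset.prod_eq_one fun n _ => by unfold stepSign; split_ifs <;> simp

/-- Inclusion-exclusion: the last letter is `0`, so a pattern that is not surjective misses `1` or
`2`, and only the constant pattern misses both. -/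
lemma sum_patterns_three {L M : ℕ} (hN : 0 < L * M) (g : (Fin (L * M) → Fin 3) → ℝ) :
    ∑ p ∈ patterns L M 3, g p = ∑ q ∈ patterns L M 2, (g (embedPattern 1 q) + g (embedPattern 2 q))
      - g 0 + ∑ p ∈ patterns L M 3 with Function.Surjective p, g p := by
  classical
  have hm : ∀ c : Fin 3, c ≠ 0 → ∀ d : Fin 3, d ≠ 0 → c ≠ d →
      (patterns L M 2).image (embedPattern c) = {p ∈ patterns L M 3 | ∀ n, p n ≠ d} := by
    intro c hc d hd hcd
    ext p
    simp only [patterns_eq hN, Finset.mem_image, Finset.mem_filter, Finset.mem_univ, true_and]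
    constructor
    · rintro ⟨q, hq, rfl⟩
      refine ⟨by simp [embedPattern, hq], fun n => ?_⟩
      simp only [embedPattern]
      split_ifs
      · exact hd.symm
      · exact hcd
    · rintro ⟨h0, h⟩
      refine ⟨fun n => if p n = 0 then 0 else 1, by simp [h0], ?_⟩
      funext n
      have := h n
      simp only [embedPattern]
      by_cases h' : p n = 0
      · simp [h']
      · simp only [h', if_false, one_ne_zero]
        omega
  have hs : ∀ c : Fin 3, c ≠ 0 → ∑ q ∈ patterns L M 2, g (embedPattern c q)
      = ∑ p ∈ (patterns L M 2).image (embedPattern c), g p := fun c hc =>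
    (Finset.sum_image fun x _ y _ h => embedPattern_injective hc h).symm
  rw [Finset.sum_add_distrib, hs 1 (by decide), hs 2 (by decide), hm 1 (by decide) 2 (by decide)
    (by decide), hm 2 (by decide) 1 (by decide) (by decide), ← Finset.sum_union_inter]
  have hi : ({p ∈ patterns L M 3 | ∀ n, p n ≠ 2} ∩ {p ∈ patterns L M 3 | ∀ n, p n ≠ 1})
      = {0} := by
    ext p
    simp only [patterns_eq hN, Finset.mem_inter, Finset.mem_filter, Finset.mem_univ, true_and,
      Finset.mem_singleton]
    constructor
    · rintro ⟨⟨-, h2⟩, -, h1⟩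
      funext n
      have := h1 n
      have := h2 n
      simp only [Pi.zero_apply]
      omega
    · rintro rfl
      simp
  have hu : ({p ∈ patterns L M 3 | ∀ n, p n ≠ 2} ∪ {p ∈ patterns L M 3 | ∀ n, p n ≠ 1})
      = {p ∈ patterns L M 3 | ¬ Function.Surjective p} := by
    rw [← Finset.filter_or]
    refine Finset.filter_congr fun p hp => ?_
    rw [patterns_eq hN, Finset.mem_filter] at hp
    constructor
    · rintro (h | h) hsu
      · obtain ⟨n, hn⟩ := hsu 2
        exact h n hn
      · obtain ⟨n, hn⟩ := hsu 1
        exact h n hn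
    · intro h
      by_contra! h'
      refine h fun a => ?_
      fin_cases a
      · exact ⟨_, hp.2⟩
      · exact h'.2
      · exact h'.1
  rw [hi, hu, Finset.sum_singleton, add_sub_cancel_right, add_comm,
    Finset.sum_filter_add_sum_filter_not]

lemma weight_zero {L M q : ℕ} [NeZero q] (k : Fin (L * M)) :
    weight k (0 : Fin (L * M) → Fin q) = 3 ^ (L * M - 1) / 4 ^ (L * M) := by
  simp [weight]

/-- The exact part comes from the patterns with at most two symbols, the error from the surjective
ones. The factor `2` clears `(1/2)^(LM) · 2^(LM-1)`: one half per block from the angular averages,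
times the number of admissible first paths. -/
theorem abs_gradientVariance_sub_le {L M : ℕ} (hL : 0 < L) {ψ : Wave M}
    (hψ : MemLp ψ 2 volume) (k : Fin (L * M)) {E : ℝ} (hE : 0 ≤ E) :
    |2 * gradientVariance L M ψ k E
        - (∑ q ∈ patterns L M 2, pairWeight k q * C₂ ψ E (fraction q 0)
          - weight k (0 : Fin (L * M) → Fin 2) * C₁ ψ E)|
      ≤ ∑ p ∈ patterns L M 3 with Function.Surjective p,
        weight k p * C₃ ψ E (fraction p 0) (fraction p 1) := by
  obtain ⟨G, hGc, hGn, hGs⟩ := exists_pathCoefficients L M hψ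
  have hN := k.pos
  have hG0 : ∀ b : Fin (L * M) → Fin 2,
      (Fin.cons 1 b : Fin (L * M + 1) → Fin 2) (Fin.last _) ≠ 1 → G b = 0 := fun b hb => by
    funext β
    rw [Pi.zero_apply, ← norm_eq_zero, hGn, if_neg hb]
  have hB : ∀ b β, ‖G b β‖ ≤ amplitudeBound ψ := fun b β => by
    rw [hGn]
    split_ifs
    · exact norm_braket_coherent_le hψ _
    · exact (amplitudeBound_pos ψ).le
  have hv := (gradientVariance_eq_sum hGs hGc hB k E).trans (sum_pathCorrelator_eq G hG0 k E)
  have hamp : ∀ p ∈ patterns L M 3, ∀ u : Fin (L * M) → Fin 2, u (lastBlock hN) = 1 → ∀ i β,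
      ‖G (patternPath i p u) β‖ = amp ψ (totalDisplacement Fin.modNat
        (fun n => bitSign (patternPath i p u n)) β) := by
    intro p hp u hu i β
    rw [patterns_eq hN, Finset.mem_filter] at hp
    have h0 : patternBit i 0 = 0 := by fin_cases i <;> rfl
    rw [hGn, cons_last_eq hN, if_pos]
    · rfl
    · simp [patternPath, hp.2, hu, h0]
  set g : (Fin (L * M) → Fin 3) → ℝ := fun p => (∑ u : Fin (L * M) → Fin 2 with
    u (lastBlock hN) = 1, (((1 / 2) ^ (L * M) * (patternSign k p * weight k p) : ℝ) : ℂ) *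
      pathCorrelator G E (patternQuad (p, u))).re with hg
  have hv' : gradientVariance L M ψ k E = ∑ p ∈ patterns L M 3, g p := by
    rw [hg, ← Complex.re_sum, ← hv, Complex.ofReal_re]
  have hhalf : (1 / 2 : ℝ) ^ (L * M) * 2 ^ (L * M - 1) = 1 / 2 := by
    obtain ⟨n, hn⟩ : ∃ n, L * M = n + 1 := ⟨L * M - 1, by omega⟩
    rw [hn, Nat.add_sub_cancel, pow_succ, mul_right_comm, ← mul_pow]
    norm_num
  have hemb : ∀ c : Fin 3, c ≠ 0 → ∀ q ∈ patterns L M 2, g (embedPattern c q)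
      = 1 / 2 * (patternSign k (embedPattern c q) * (weight k q * C₂ ψ E (fraction q 0))) := by
    intro c hc q hq
    have hp : embedPattern c q ∈ patterns L M 3 := by
      rw [patterns_eq hN, Finset.mem_filter] at hq ⊢
      simp [embedPattern, hq.2]
    simp only [hg]
    rw [Finset.sum_congr rfl fun u hu => by
      rw [pathCorrelator_embedPattern hL hψ hc (hamp _ hp u (Finset.mem_filter.1 hu).2) hE],
      Finset.sum_const, card_bits, weight_embedPattern k hc, ← Complex.ofReal_mul,
      nsmul_eq_mul, ← Complex.ofReal_natCast, ← Complex.ofReal_mul, Complex.ofReal_re]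
    push_cast
    linear_combination (patternSign k (embedPattern c q) *
      (weight k q * C₂ ψ E (fraction q 0))) * hhalf
  have hpair : ∀ q ∈ patterns L M 2, g (embedPattern 1 q) + g (embedPattern 2 q)
      = 1 / 2 * (pairWeight k q * C₂ ψ E (fraction q 0)) := by
    intro q hq
    rw [hemb 1 (by decide) q hq, hemb 2 (by decide) q hq, patternSign_embedPattern_one,
      patternSign_embedPattern_two, pairWeight]
    split_ifs <;> ring
  have hzero : g 0 = 1 / 2 * (weight k (0 : Fin (L * M) → Fin 2) * C₁ ψ E) := by
    have e : embedPattern 2 (0 : Fin (L * M) → Fin 2) = 0 := by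
      funext n; simp [embedPattern]
    have h0 : (0 : Fin (L * M) → Fin 2) ∈ patterns L M 2 := by simp [patterns]
    have hf : fraction (0 : Fin (L * M) → Fin 2) 0 = (1 : Fin M → ℝ) := by
      funext j
      simp [fraction, card_filter_modNat, hL.ne']
    rw [← e, hemb 2 (by decide) _ h0, patternSign_embedPattern_two, hf,
      C₂_one ψ E (continuous_braket_coherent hψ), one_mul]
  have hrem : ∀ p ∈ patterns L M 3, |2 * g p|
      ≤ weight k p * C₃ ψ E (fraction p 0) (fraction p 1) := by
    intro p hp
    have h1 : |g p| ≤ ∑ u : Fin (L * M) → Fin 2 with u (lastBlock hN) = 1,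
        (1 / 2) ^ (L * M) * (weight k p * C₃ ψ E (fraction p 0) (fraction p 1)) := by
      refine (Complex.abs_re_le_norm _).trans ((norm_sum_le _ _).trans
        (Finset.sum_le_sum fun u hu => ?_))
      rw [norm_mul, Complex.norm_real, Real.norm_eq_abs, abs_mul, abs_mul, abs_patternSign, one_mul,
        abs_of_pos (weight_pos k p), abs_of_nonneg (by positivity), mul_assoc]
      exact mul_le_mul_of_nonneg_left (mul_le_mul_of_nonneg_left
        (norm_pathCorrelator_le hL hψ (hamp p hp u (Finset.mem_filter.1 hu).2) hE)
        (weight_pos k p).le) (by positivity)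
    rw [Finset.sum_const, card_bits, nsmul_eq_mul] at h1
    push_cast at h1
    rw [abs_mul, abs_of_nonneg (by norm_num : (0 : ℝ) ≤ 2)]
    calc 2 * |g p| ≤ 2 * _ := mul_le_mul_of_nonneg_left h1 (by norm_num)
      _ = _ := by
        linear_combination (2 * (weight k p * C₃ ψ E (fraction p 0) (fraction p 1))) * hhalf
  rw [hv', sum_patterns_three hN, Finset.sum_congr rfl hpair, hzero, ← Finset.mul_sum]
  have : 2 * (1 / 2 * ∑ q ∈ patterns L M 2, pairWeight k q * C₂ ψ E (fraction q 0)
      - 1 / 2 * (weight k (0 : Fin (L * M) → Fin 2) * C₁ ψ E)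
      + ∑ p ∈ patterns L M 3 with Function.Surjective p, g p)
      - (∑ q ∈ patterns L M 2, pairWeight k q * C₂ ψ E (fraction q 0)
          - weight k (0 : Fin (L * M) → Fin 2) * C₁ ψ E)
      = ∑ p ∈ patterns L M 3 with Function.Surjective p, 2 * g p := by
    rw [← Finset.mul_sum]; ring
  rw [this]
  exact (Finset.abs_sum_le_sum_abs _ _).trans
    (Finset.sum_le_sum fun p hp => hrem p (Finset.mem_filter.1 hp).1)

/-! ### Comparison of Gaussian and Lebesgue measure -/

lemma complexGaussian_eq_withDensity {v : ℝ} (hv : 0 < v) :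
    complexGaussian v = (volume : Measure ℂ).withDensity
      fun z => ENNReal.ofReal ((Real.pi * v)⁻¹ * Real.exp (-‖z‖ ^ 2 / v)) := by
  have hv' : (v / 2).toNNReal ≠ 0 := by simpa using hv
  have hmp := Complex.volume_preserving_equiv_real_prod.symm
  rw [complexGaussian, gaussianReal_of_var_ne_zero 0 hv',
    prod_withDensity (measurable_gaussianPDF _ _) (measurable_gaussianPDF _ _),
    ← Measure.volume_eq_prod]
  have he : (fun t : ℝ × ℝ => (t.1 : ℂ) + (t.2 : ℂ) * Complex.I)
      = Complex.measurableEquivRealProd.symm := by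
    funext t
    apply Complex.ext <;> simp
  refine Measure.ext fun s hs => ?_
  rw [he, MeasurableEquiv.map_apply, withDensity_apply _ (Complex.measurableEquivRealProd.symm.measurable hs),
    withDensity_apply _ hs, ← hmp.setLIntegral_comp_preimage_emb
      Complex.measurableEquivRealProd.symm.measurableEmbedding]
  refine lintegral_congr fun t => ?_
  rw [gaussianPDF, gaussianPDF, ← ENNReal.ofReal_mul (gaussianPDFReal_nonneg _ _ _)]
  congr 1
  have hn : ‖Complex.measurableEquivRealProd.symm t‖ ^ 2 = t.1 ^ 2 + t.2 ^ 2 := by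
    rw [← Complex.normSq_eq_norm_sq, Complex.normSq_apply]
    simp [sq]
  have hs : √(2 * Real.pi * (v / 2).toNNReal) * √(2 * Real.pi * (v / 2).toNNReal)
      = Real.pi * v := by
    rw [Real.mul_self_sqrt (by positivity), Real.coe_toNNReal _ (by positivity)]
    ring
  rw [gaussianPDFReal, gaussianPDFReal, mul_mul_mul_comm, ← mul_inv, hs, ← Real.exp_add, hn,
    Real.coe_toNNReal _ (by positivity)]
  congr 2
  field_simp
  ring

lemma complexGaussian_le {v : ℝ} (hv : 0 < v) :
    complexGaussian v ≤ ENNReal.ofReal (Real.pi * v)⁻¹ • (volume : Measure ℂ) := by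
  rw [complexGaussian_eq_withDensity hv, ← withDensity_const]
  refine withDensity_mono (.of_forall fun z => ENNReal.ofReal_le_ofReal ?_)
  refine mul_le_of_le_one_right (by positivity) (Real.exp_le_one_iff.2 ?_)
  rw [neg_div]
  exact neg_nonpos.2 (by positivity)

lemma restrict_closedBall_le {v R : ℝ} (hv : 0 < v) :
    (volume : Measure ℂ).restrict (Metric.closedBall 0 R)
      ≤ ENNReal.ofReal (Real.pi * v * Real.exp (R ^ 2 / v)) • complexGaussian v := by
  have hpos : 0 < Real.pi * v * Real.exp (R ^ 2 / v) := by positivity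
  rw [complexGaussian_eq_withDensity hv, ← withDensity_smul' _ _ ENNReal.ofReal_ne_top,
    ← withDensity_indicator_one Metric.isClosed_closedBall.measurableSet]
  refine withDensity_mono (.of_forall fun z => ?_)
  by_cases hz : z ∈ Metric.closedBall (0 : ℂ) R
  · rw [Set.indicator_of_mem hz, Pi.smul_apply, smul_eq_mul, ← ENNReal.ofReal_mul hpos.le,
      Pi.one_apply, ENNReal.one_le_ofReal]
    rw [mem_closedBall_zero_iff] at hz
    have h1 : ‖z‖ ^ 2 ≤ R ^ 2 := pow_le_pow_left₀ (norm_nonneg z) hz 2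
    have : Real.pi * v * Real.exp (R ^ 2 / v) * ((Real.pi * v)⁻¹ * Real.exp (-‖z‖ ^ 2 / v))
        = Real.exp ((R ^ 2 - ‖z‖ ^ 2) / v) := by
      rw [mul_mul_mul_comm, mul_inv_cancel₀ (by positivity), one_mul, ← Real.exp_add]
      ring_nf
    rw [this]
    exact Real.one_le_exp (div_nonneg (by linarith) hv.le)
  · rw [Set.indicator_of_notMem hz]
    exact bot_le

/-- The product outer measure is the largest one bounded by the product on boxes, so a comparison on
boxes suffices. -/
lemma pi_le_smul_pi {ι : Type*} [Fintype ι] {α : ι → Type*} [∀ i, MeasurableSpace (α i)]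
    {μ ν : ∀ i, Measure (α i)} [∀ i, SigmaFinite (μ i)] [∀ i, SigmaFinite (ν i)] {c : ENNReal}
    (hc0 : c ≠ 0) (hc : c ≠ ⊤) (h : ∀ i, μ i ≤ c • ν i) :
    Measure.pi μ ≤ c ^ Fintype.card ι • Measure.pi ν := by
  have h0 : c ^ Fintype.card ι ≠ 0 := pow_ne_zero _ hc0
  have ht : c ^ Fintype.card ι ≠ ⊤ := ENNReal.pow_ne_top hc
  have hle : (c ^ Fintype.card ι)⁻¹ • (Measure.pi μ).toOuterMeasure
      ≤ OuterMeasure.pi fun i => (ν i).toOuterMeasure := by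
    refine OuterMeasure.le_pi.2 fun s _ => ?_
    change (c ^ Fintype.card ι)⁻¹ * (Measure.pi μ) (Set.univ.pi s) ≤ ∏ i, ν i (s i)
    rw [Measure.pi_pi, ENNReal.inv_mul_le_iff h0 ht, ← Finset.card_univ, ← Finset.prod_const,
      ← Finset.prod_mul_distrib]
    exact Finset.prod_le_prod' fun i _ => h i (s i)
  refine Measure.le_iff.2 fun s hs => ?_
  have := hle s
  change (c ^ Fintype.card ι)⁻¹ * (Measure.pi μ) s ≤ _ at this
  rw [ENNReal.inv_mul_le_iff h0 ht] at this
  refine this.trans (le_of_eq ?_)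
  rw [Measure.smul_apply, smul_eq_mul, Measure.pi, toMeasure_apply _ _ hs]

lemma gaussianVector_le {M : ℕ} {c E : ℝ} (hc : 0 < c) (hE : 0 < E) {z : Fin M → ℝ}
    (hz : ∀ j, c ≤ z j) :
    gaussianVector E z ≤ ENNReal.ofReal (Real.pi * (c * E))⁻¹ ^ M • volume := by
  have hpos : 0 < Real.pi * (c * E) := by positivity
  have := pi_le_smul_pi (μ := fun j => complexGaussian (z j * E))
    (ν := fun _ : Fin M => (volume : Measure ℂ)) (c := ENNReal.ofReal (Real.pi * (c * E))⁻¹)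
    (ENNReal.ofReal_pos.2 (inv_pos.2 hpos)).ne' ENNReal.ofReal_ne_top fun j => by
      have hj : 0 < z j := hc.trans_le (hz j)
      refine (complexGaussian_le (mul_pos hj hE)).trans ?_
      gcongr
      exact hz j
  rw [Fintype.card_fin] at this
  exact this

lemma restrict_closedBall_le_gaussianVector {M : ℕ} {R E : ℝ} (hR : 0 ≤ R) (hE : 0 < E) :
    (volume : Measure (Fin M → ℂ)).restrict (Metric.closedBall 0 R)
      ≤ ENNReal.ofReal (Real.pi * E * Real.exp (R ^ 2 / E)) ^ M •
        gaussianVector E (1 : Fin M → ℝ) := by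
  have hpos : 0 < Real.pi * E * Real.exp (R ^ 2 / E) := by positivity
  have := pi_le_smul_pi (μ := fun _ : Fin M => (volume : Measure ℂ).restrict (Metric.closedBall 0 R))
    (ν := fun _ : Fin M => complexGaussian E)
    (c := ENNReal.ofReal (Real.pi * E * Real.exp (R ^ 2 / E)))
    (by simpa using hpos) ENNReal.ofReal_ne_top fun j => restrict_closedBall_le hE
  rw [Fintype.card_fin] at this
  rw [closedBall_pi 0 hR, volume_pi, Measure.restrict_pi_pi, gaussianVector]
  simpa using this

/-- Lower bound of the Gaussian probability of a ball. -/
lemma complexGaussian_closedBall_ge {v : ℝ} (hv : 0 < v) (x : ℂ) {δ : ℝ} (hδ : 0 ≤ δ) :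
    ENNReal.ofReal (v⁻¹ * (δ ^ 2 * Real.exp (-(‖x‖ + δ) ^ 2 / v)))
      ≤ complexGaussian v (Metric.closedBall x δ) := by
  have h := restrict_closedBall_le (R := ‖x‖ + δ) hv (Metric.closedBall x δ)
  have hsub : Metric.closedBall x δ ⊆ Metric.closedBall 0 (‖x‖ + δ) :=
    Metric.closedBall_subset_closedBall' (by rw [dist_zero_right, add_comm])
  rw [Measure.restrict_apply Metric.isClosed_closedBall.measurableSet,
    Set.inter_eq_self_of_subset_left hsub, Complex.volume_closedBall, Measure.smul_apply,
    smul_eq_mul] at h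
  have hpos : 0 < Real.pi * v * Real.exp ((‖x‖ + δ) ^ 2 / v) := by positivity
  rw [← ENNReal.inv_mul_le_iff (by simpa using hpos) ENNReal.ofReal_ne_top] at h
  refine le_trans (le_of_eq ?_) h
  rw [← ENNReal.ofReal_inv_of_pos hpos, ← ENNReal.ofReal_coe_nnreal, ← ENNReal.ofReal_pow hδ,
    ← ENNReal.ofReal_mul (by positivity), ← ENNReal.ofReal_mul (by positivity)]
  congr 1
  rw [NNReal.coe_real_pi, neg_div, Real.exp_neg]
  field_simp

/-! ### The Husimi function is integrable -/

/-- The integral over `Im α` is a Gaussian characteristic function at frequency `√2 (x - y)`. In the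
integral over `Re α`, the Gaussian density is bounded by its maximum and one vacuum factor by its
value at `0`, and the other is integrated. -/
lemma norm_integral_displace_le {v : ℝ} (hv : 0 < v) (x y : ℝ) :
    ‖∫ α, displace α vacuum x * starRingEnd ℂ (displace α vacuum y) ∂complexGaussian v‖
      ≤ (√(Real.pi * v))⁻¹ * Real.exp (-(v / 2) * (x - y) ^ 2) := by
  have hv' : (v / 2).toNNReal ≠ 0 := by simpa using hv
  have hcont : ∀ x, Continuous fun α : ℂ => displace α vacuum x := fun x => by
    unfold displace vacuum
    fun_prop
  have hcont' : Continuous fun α : ℂ => displace α vacuum x * starRingEnd ℂ (displace α vacuum y) :=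
    (hcont x).mul (Complex.continuous_conj.comp (hcont y))
  rw [complexGaussian, integral_map (by fun_prop) hcont'.aestronglyMeasurable]
  have e : ∀ t : ℝ × ℝ, displace ((t.1 : ℂ) + (t.2 : ℂ) * Complex.I) vacuum x *
      starRingEnd ℂ (displace ((t.1 : ℂ) + (t.2 : ℂ) * Complex.I) vacuum y)
      = (vacuum (x - √2 * t.1) * vacuum (y - √2 * t.1)) *
        Complex.exp ((√2 * (x - y) : ℝ) * t.2 * Complex.I) := fun t => by
    have hvac : ∀ s, starRingEnd ℂ (vacuum s) = vacuum s := fun s => Complex.conj_ofReal _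
    simp only [displace, map_mul, hvac, ← Complex.exp_conj, Complex.conj_I, Complex.conj_ofReal]
    rw [mul_mul_mul_comm, ← Complex.exp_add]
    simp only [Complex.add_re, Complex.add_im, Complex.ofReal_re, Complex.ofReal_im,
      Complex.mul_re, Complex.mul_im, Complex.I_re, Complex.I_im]
    rw [mul_comm]
    congr 1
    · simp
    · congr 1
      push_cast
      ring
  simp only [e]
  rw [integral_prod_mul (f := fun q : ℝ => vacuum (x - √2 * q) * vacuum (y - √2 * q))
    (g := fun p : ℝ => Complex.exp ((√2 * (x - y) : ℝ) * p * Complex.I)), ← charFun_apply_real,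
    charFun_gaussianReal, norm_mul]
  have h1 : ‖∫ q, vacuum (x - √2 * q) * vacuum (y - √2 * q) ∂gaussianReal 0 (v / 2).toNNReal‖
      ≤ (√(Real.pi * v))⁻¹ := by
    rw [integral_gaussianReal_eq_integral_smul hv']
    have hint : ∫ q : ℝ, (√(Real.pi * v))⁻¹ * ((√Real.pi)⁻¹ *
        Real.exp (-1 * (q - x / √2) ^ 2)) = (√(Real.pi * v))⁻¹ := by
      rw [integral_const_mul, integral_const_mul,
        integral_sub_right_eq_self (fun q : ℝ => Real.exp (-1 * q ^ 2)), integral_gaussian, div_one,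
        inv_mul_cancel₀ (by positivity), mul_one]
    have hI : Integrable fun q : ℝ => (√(Real.pi * v))⁻¹ * ((√Real.pi)⁻¹ *
        Real.exp (-1 * (q - x / √2) ^ 2)) :=
      Integrable.of_integral_ne_zero (by rw [hint]; positivity)
    rw [← hint]
    refine norm_integral_le_of_norm_le hI (.of_forall fun q => ?_)
    rw [norm_smul, norm_mul, vacuum, vacuum, Complex.norm_real, Complex.norm_real,
      Real.norm_of_nonneg (gaussianPDFReal_nonneg _ _ _), Real.norm_of_nonneg (by positivity),
      Real.norm_of_nonneg (by positivity), gaussianPDFReal, Real.coe_toNNReal _ (by positivity)]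
    have hpi : Real.pi ^ (-(1 / 4) : ℝ) * Real.pi ^ (-(1 / 4) : ℝ) = (√Real.pi)⁻¹ := by
      rw [← Real.rpow_add Real.pi_pos, Real.sqrt_eq_rpow, ← Real.rpow_neg Real.pi_pos.le]
      norm_num
    have hx : -(x - √2 * q) ^ 2 / 2 = -1 * (q - x / √2) ^ 2 := by
      have h2 : √2 ^ 2 = 2 := Real.sq_sqrt (by norm_num)
      have h0 : √2 ≠ 0 := by positivity
      field_simp
      rw [h2]
      ring
    rw [mul_mul_mul_comm (Real.pi ^ (-(1 / 4) : ℝ)), hpi, hx]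
    refine mul_le_mul ?_ ?_ (by positivity) (by positivity)
    · rw [show 2 * Real.pi * (v / 2) = Real.pi * v by ring]
      refine mul_le_of_le_one_right (by positivity) (Real.exp_le_one_iff.2 ?_)
      rw [neg_div]
      exact neg_nonpos.2 (by positivity)
    · refine mul_le_mul_of_nonneg_left ?_ (by positivity)
      refine mul_le_of_le_one_right (by positivity) (Real.exp_le_one_iff.2 ?_)
      rw [neg_div]
      exact neg_nonpos.2 (by positivity)
  have h2 : ‖Complex.exp ((√2 * (x - y) : ℝ) * (0 : ℝ) * Complex.I
      - ((v / 2).toNNReal : ℝ) * (√2 * (x - y) : ℝ) ^ 2 / 2)‖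
      = Real.exp (-(v / 2) * (x - y) ^ 2) := by
    rw [Complex.norm_exp, Real.coe_toNNReal _ (by positivity)]
    congr 1
    rw [Complex.ofReal_zero, mul_zero, zero_mul, zero_sub, Complex.neg_re]
    have : (((v / 2 : ℝ) : ℂ) * ((√2 * (x - y) : ℝ) : ℂ) ^ 2 / 2)
        = ((v / 2 * (x - y) ^ 2 : ℝ) : ℂ) := by
      rw [← Complex.ofReal_pow, mul_pow, Real.sq_sqrt (by norm_num)]
      push_cast
      ring
    rw [this, Complex.ofReal_re]
    ring
  exact mul_le_mul h1 h2.le (norm_nonneg _) (by positivity)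

lemma norm_integral_coherent_le {M : ℕ} {v : ℝ} (hv : 0 < v) (x y : Fin M → ℝ) :
    ‖∫ α, coherent α x * starRingEnd ℂ (coherent α y) ∂gaussianVector v (1 : Fin M → ℝ)‖
      ≤ (√(Real.pi * v))⁻¹ ^ M * ∏ j, Real.exp (-(v / 2) * (x j - y j) ^ 2) := by
  have e : ∀ α : Fin M → ℂ, coherent α x * starRingEnd ℂ (coherent α y)
      = ∏ j, (displace (α j) vacuum (x j) * starRingEnd ℂ (displace (α j) vacuum (y j))) :=
    fun α => by rw [coherent, coherent, map_prod, Finset.prod_mul_distrib]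
  simp only [e, gaussianVector, Pi.one_apply, one_mul]
  rw [integral_fintype_prod_eq_prod (fun j (α : ℂ) => displace α vacuum (x j) *
    starRingEnd ℂ (displace α vacuum (y j))), norm_prod]
  calc _ ≤ ∏ j, (√(Real.pi * v))⁻¹ * Real.exp (-(v / 2) * (x j - y j) ^ 2) :=
        Finset.prod_le_prod (fun _ _ => norm_nonneg _)
          fun j _ => norm_integral_displace_le hv (x j) (y j)
    _ = _ := by
      rw [Finset.prod_mul_distrib, Finset.prod_const, Finset.card_univ, Fintype.card_fin]

lemma lintegral_prod_exp {M : ℕ} {v : ℝ} (hv : 0 < v) (x : Fin M → ℝ) :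
    ∫⁻ y : Fin M → ℝ, ENNReal.ofReal (∏ j, Real.exp (-(v / 2) * (x j - y j) ^ 2))
      = ENNReal.ofReal (√(2 * Real.pi / v) ^ M) := by
  have h1 : ∫ y : Fin M → ℝ, ∏ j, Real.exp (-(v / 2) * (x j - y j) ^ 2)
      = √(2 * Real.pi / v) ^ M := by
    rw [integral_fintype_prod_volume_eq_prod
      (fun j (t : ℝ) => Real.exp (-(v / 2) * (x j - t) ^ 2))]
    have : ∀ j, ∫ t : ℝ, Real.exp (-(v / 2) * (x j - t) ^ 2) = √(2 * Real.pi / v) := fun j => by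
      rw [integral_sub_left_eq_self (fun t : ℝ => Real.exp (-(v / 2) * t ^ 2)), integral_gaussian]
      congr 1
      field_simp
    simp only [this, Finset.prod_const, Finset.card_univ, Fintype.card_fin]
  rw [← h1, ofReal_integral_eq_lintegral_ofReal]
  · exact Integrable.of_integral_ne_zero (by rw [h1]; positivity)
  · exact .of_forall fun y => Finset.prod_nonneg fun _ _ => (Real.exp_pos _).le

lemma integral_norm_mul_coherent_le {M : ℕ} {ψ : Wave M} (hψ : MemLp ψ 2 volume)
    (α : Fin M → ℂ) : ∫ x, ‖starRingEnd ℂ (ψ x) * coherent α x‖ ≤ amplitudeBound ψ := by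
  have h2 : Integrable fun x => ‖ψ x‖ ^ 2 := hψ.norm.integrable_sq
  calc ∫ x, ‖starRingEnd ℂ (ψ x) * coherent α x‖
      ≤ ∫ x, (‖ψ x‖ ^ 2 + ‖coherent α x‖ ^ 2) / 2 := by
        refine integral_mono (integrable_conj_mul_coherent hψ α).norm
          ((h2.add (integrable_norm_coherent_sq α)).div_const 2) fun x => ?_
        simp only [norm_mul, RCLike.norm_conj]
        nlinarith [sq_nonneg (‖ψ x‖ - ‖coherent α x‖)]
    _ = amplitudeBound ψ := by
        rw [integral_div, integral_add h2 (integrable_norm_coherent_sq α),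
          integral_norm_coherent_sq, amplitudeBound]

/-- Schur's test: `2ab ≤ a² + b²`, and both resulting terms agree by symmetry of the kernel. -/
lemma lintegral_kernel_le {M : ℕ} {ψ : Wave M} (hψ : MemLp ψ 2 volume)
    {k : (Fin M → ℝ) → (Fin M → ℝ) → ENNReal} (hk : Measurable (Function.uncurry k))
    (hsymm : ∀ x y, k x y = k y x) {K : ENNReal} (hK : ∀ x, ∫⁻ y, k x y = K) :
    ∫⁻ t : (Fin M → ℝ) × (Fin M → ℝ), ‖ψ t.1‖ₑ * ‖ψ t.2‖ₑ * k t.1 t.2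
      ≤ K * ∫⁻ x, ‖ψ x‖ₑ ^ 2 := by
  have hm : AEMeasurable (fun x => ‖ψ x‖ₑ ^ 2) volume := hψ.1.enorm.pow_const 2
  have hm1 : AEMeasurable (fun t : (Fin M → ℝ) × (Fin M → ℝ) => ‖ψ t.1‖ₑ ^ 2 * k t.1 t.2)
      (Measure.prod volume volume) := hm.comp_fst.mul hk.aemeasurable
  have h1 : ∫⁻ t : (Fin M → ℝ) × (Fin M → ℝ), ‖ψ t.1‖ₑ ^ 2 * k t.1 t.2
      = K * ∫⁻ x, ‖ψ x‖ₑ ^ 2 := by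
    rw [Measure.volume_eq_prod, lintegral_prod _ hm1]
    have : ∀ x, ∫⁻ y, ‖ψ x‖ₑ ^ 2 * k x y = ‖ψ x‖ₑ ^ 2 * K := fun x => by
      rw [lintegral_const_mul _ (hk.of_uncurry_left (x := x)), hK]
    simp only [this]
    rw [lintegral_mul_const'' _ hm, mul_comm]
  have h2 : ∫⁻ t : (Fin M → ℝ) × (Fin M → ℝ), ‖ψ t.2‖ₑ ^ 2 * k t.1 t.2
      = K * ∫⁻ x, ‖ψ x‖ₑ ^ 2 := by
    rw [← h1, Measure.volume_eq_prod, ← lintegral_prod_swap]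
    refine lintegral_congr fun t => ?_
    rw [Prod.snd_swap, Prod.fst_swap, hsymm]
  have h3 : 2 * ∫⁻ t : (Fin M → ℝ) × (Fin M → ℝ), ‖ψ t.1‖ₑ * ‖ψ t.2‖ₑ * k t.1 t.2
      ≤ 2 * (K * ∫⁻ x, ‖ψ x‖ₑ ^ 2) := by
    rw [← lintegral_const_mul' _ _ (by simp)]
    calc _ ≤ ∫⁻ t : (Fin M → ℝ) × (Fin M → ℝ),
          (‖ψ t.1‖ₑ ^ 2 * k t.1 t.2 + ‖ψ t.2‖ₑ ^ 2 * k t.1 t.2) := by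
          refine lintegral_mono fun t => ?_
          simp only
          rw [← mul_assoc, ← mul_assoc, ← add_mul]
          gcongr
          simp only [enorm_eq_nnnorm]
          exact_mod_cast two_mul_le_add_sq ‖ψ t.1‖₊ ‖ψ t.2‖₊
      _ = 2 * (K * ∫⁻ x, ‖ψ x‖ₑ ^ 2) := by
          rw [Measure.volume_eq_prod] at h1 h2 ⊢
          rw [lintegral_add_left' hm1, h1, h2, two_mul]
  exact (ENNReal.mul_le_mul_iff_right (by simp) (by simp)).1 h3

/-- The squared overlap is a double integral over positions. Averaging over `α` first leaves a
kernel dominated by a Gaussian in the difference of the positions, to which Schur's test applies. -/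
lemma lintegral_braket_gaussian_le {M : ℕ} {ψ : Wave M} (hψ : MemLp ψ 2 volume) {v : ℝ}
    (hv : 0 < v) :
    ∫⁻ α, ‖braket ψ (coherent α)‖ₑ ^ 2 ∂gaussianVector v (1 : Fin M → ℝ)
      ≤ ENNReal.ofReal ((√(Real.pi * v))⁻¹ ^ M * √(2 * Real.pi / v) ^ M) * ∫⁻ x, ‖ψ x‖ₑ ^ 2 := by
  set γ := gaussianVector v (1 : Fin M → ℝ) with hγ
  set F : (Fin M → ℂ) → (Fin M → ℝ) → ℂ := fun α x => starRingEnd ℂ (ψ x) * coherent α x with hF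
  have hFi : ∀ α, Integrable (F α) := integrable_conj_mul_coherent hψ
  have hFm : AEStronglyMeasurable (fun p : (Fin M → ℂ) × (Fin M → ℝ) => F p.1 p.2)
      (γ.prod volume) :=
    (Complex.continuous_conj.comp_aestronglyMeasurable hψ.1).comp_snd.mul
      continuous_coherent_uncurry.aestronglyMeasurable
  set H : (Fin M → ℂ) → (Fin M → ℝ) × (Fin M → ℝ) → ℂ :=
    fun α t => F α t.1 * starRingEnd ℂ (F α t.2) with hH
  have hHint : ∀ α, ∫ t, H α t = ((‖braket ψ (coherent α)‖ ^ 2 : ℝ) : ℂ) := fun α => by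
    rw [hH, Measure.volume_eq_prod, integral_prod_mul (F α) (fun y => starRingEnd ℂ (F α y)),
      integral_conj, Complex.mul_conj', Complex.ofReal_pow]
    rfl
  have hc1 : AEStronglyMeasurable (fun t : (Fin M → ℝ) × (Fin M → ℝ) => starRingEnd ℂ (ψ t.1))
      volume := (Complex.continuous_conj.comp_aestronglyMeasurable hψ.1).comp_fst
  have hc2 : AEStronglyMeasurable (fun t : (Fin M → ℝ) × (Fin M → ℝ) => ψ t.2) volume :=
    hψ.1.comp_snd
  have hHm : AEStronglyMeasurable (Function.uncurry H) (γ.prod volume) := by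
    have h1 : AEStronglyMeasurable (fun p : (Fin M → ℂ) × ((Fin M → ℝ) × (Fin M → ℝ)) =>
        starRingEnd ℂ (ψ p.2.1)) (γ.prod volume) :=
      AEStronglyMeasurable.comp_snd (f := fun t : (Fin M → ℝ) × (Fin M → ℝ) =>
        starRingEnd ℂ (ψ t.1)) hc1
    have h2 : AEStronglyMeasurable (fun p : (Fin M → ℂ) × ((Fin M → ℝ) × (Fin M → ℝ)) =>
        ψ p.2.2) (γ.prod volume) :=
      AEStronglyMeasurable.comp_snd (f := fun t : (Fin M → ℝ) × (Fin M → ℝ) => ψ t.2) hc2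
    have h3 : Continuous fun p : (Fin M → ℂ) × ((Fin M → ℝ) × (Fin M → ℝ)) =>
        coherent p.1 p.2.1 :=
      continuous_coherent_uncurry.comp (g := fun q : (Fin M → ℂ) × (Fin M → ℝ) =>
        coherent q.1 q.2) (f := fun p : (Fin M → ℂ) × ((Fin M → ℝ) × (Fin M → ℝ)) =>
        (p.1, p.2.1)) (by fun_prop)
    have h4 : Continuous fun p : (Fin M → ℂ) × ((Fin M → ℝ) × (Fin M → ℝ)) =>
        coherent p.1 p.2.2 :=
      continuous_coherent_uncurry.comp (g := fun q : (Fin M → ℂ) × (Fin M → ℝ) =>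
        coherent q.1 q.2) (f := fun p : (Fin M → ℂ) × ((Fin M → ℝ) × (Fin M → ℝ)) =>
        (p.1, p.2.2)) (by fun_prop)
    refine ((h1.mul h3.aestronglyMeasurable).mul (h2.mul
      (Complex.continuous_conj.comp h4).aestronglyMeasurable)).congr (.of_forall fun p => ?_)
    simp [hH, hF, Function.uncurry]
  have hHI : Integrable (Function.uncurry H) (γ.prod volume) := by
    rw [integrable_prod_iff hHm]
    refine ⟨.of_forall fun α => ?_, ?_⟩
    · exact (hFi α).mul_prod (Complex.conjLIE.integrable_comp_iff.2 (hFi α))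
    · refine Integrable.of_bound hHm.norm.integral_prod_right' (amplitudeBound ψ ^ 2)
        (.of_forall fun α => ?_)
      have : ∫ t, ‖Function.uncurry H (α, t)‖ = (∫ x, ‖F α x‖) ^ 2 := by
        simp only [Function.uncurry, hH, norm_mul, RCLike.norm_conj]
        rw [Measure.volume_eq_prod, integral_prod_mul (fun x => ‖F α x‖) (fun x => ‖F α x‖), sq]
      rw [this, Real.norm_of_nonneg (by positivity)]
      exact pow_le_pow_left₀ (integral_nonneg fun x => norm_nonneg _)
        (integral_norm_mul_coherent_le hψ α) 2
  have hcont := continuous_braket_coherent hψ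
  have hsq : Integrable (fun α => ‖braket ψ (coherent α)‖ ^ 2) γ :=
    Integrable.of_bound (hcont.norm.pow 2).aestronglyMeasurable (amplitudeBound ψ ^ 2) (.of_forall fun α => by
      rw [Real.norm_of_nonneg (by positivity)]
      exact pow_le_pow_left₀ (norm_nonneg _) (norm_braket_coherent_le hψ α) 2)
  have hL : ∫⁻ α, ‖braket ψ (coherent α)‖ₑ ^ 2 ∂γ = ‖∫ t, ∫ α, H α t ∂γ‖ₑ := by
    rw [← integral_integral_swap hHI]
    simp only [hHint]
    rw [integral_complex_ofReal, ← ofReal_norm, Complex.norm_real,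
      Real.norm_of_nonneg (integral_nonneg fun α => by positivity),
      ofReal_integral_eq_lintegral_ofReal hsq (.of_forall fun α => by positivity)]
    refine lintegral_congr fun α => ?_
    rw [ENNReal.ofReal_pow (norm_nonneg _), ofReal_norm]
  rw [hL]
  set k : (Fin M → ℝ) → (Fin M → ℝ) → ENNReal := fun x y =>
    ENNReal.ofReal ((√(Real.pi * v))⁻¹ ^ M * ∏ j, Real.exp (-(v / 2) * (x j - y j) ^ 2)) with hk
  refine (enorm_integral_le_lintegral_enorm _).trans (le_trans (lintegral_mono fun t => ?_)
    (lintegral_kernel_le hψ (k := k) ?_ ?_ ?_))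
  · have : ∫ α, H α t ∂γ = (starRingEnd ℂ (ψ t.1) * ψ t.2) *
        ∫ α, coherent α t.1 * starRingEnd ℂ (coherent α t.2) ∂γ := by
      rw [← integral_const_mul]
      refine integral_congr_ae (.of_forall fun α => ?_)
      simp only [hH, hF, map_mul, Complex.conj_conj]
      ring
    rw [this, enorm_mul, enorm_mul, ← ofReal_norm (starRingEnd ℂ (ψ t.1)),
      RCLike.norm_conj, ofReal_norm]
    gcongr
    rw [← ofReal_norm]
    exact ENNReal.ofReal_le_ofReal (norm_integral_coherent_le hv _ _)
  · refine ENNReal.measurable_ofReal.comp (Continuous.measurable ?_)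
    exact continuous_const.mul (continuous_finsetProd _ fun j _ => by fun_prop)
  · intro x y
    simp only [hk]
    congr 2
    exact Finset.prod_congr rfl fun j _ => by rw [← neg_sub (y j) (x j), neg_sq]
  · intro x
    simp only [hk]
    rw [ENNReal.ofReal_mul (by positivity), ← lintegral_prod_exp hv x,
      ← lintegral_const_mul' _ _ ENNReal.ofReal_ne_top]
    exact lintegral_congr fun y => ENNReal.ofReal_mul (by positivity)

/-- The Husimi function `|⟨ψ|α⟩|²` is Lebesgue integrable. -/
theorem lintegral_braket_sq_lt_top {M : ℕ} {ψ : Wave M} (hψ : MemLp ψ 2 volume) :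
    ∫⁻ α, ‖braket ψ (coherent α)‖ₑ ^ 2 < ⊤ := by
  have hS : ∫⁻ x, ‖ψ x‖ₑ ^ 2 < ⊤ := by
    have := hψ.norm.integrable_sq.hasFiniteIntegral
    refine lt_of_le_of_lt (lintegral_mono fun x => ?_) this
    simp [enorm_pow]
  set C : ENNReal := ENNReal.ofReal ((Real.exp 1 * Real.pi * √2) ^ M) * ∫⁻ x, ‖ψ x‖ₑ ^ 2 with hC
  have hb : ∀ R : ℝ, 0 < R → ∫⁻ α in Metric.closedBall 0 R, ‖braket ψ (coherent α)‖ₑ ^ 2 ≤ C := by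
    intro R hR
    -- With Gaussian variance `R²`, the cost of replacing Lebesgue measure on the ball is `(π e
    -- R²)^M`, which cancels the decay of the Gaussian average; the bound is uniform in `R`.
    have hE : 0 < R ^ 2 := by positivity
    refine (lintegral_mono' (restrict_closedBall_le_gaussianVector hR.le hE) le_rfl).trans ?_
    rw [lintegral_smul_measure, smul_eq_mul]
    refine (mul_le_mul_right (lintegral_braket_gaussian_le hψ hE) _).trans (le_of_eq ?_)
    rw [← mul_assoc, ← ENNReal.ofReal_pow (by positivity), ← ENNReal.ofReal_mul (by positivity), hC]
    congr 2
    rw [← mul_pow, ← mul_pow, div_self hE.ne', Real.sqrt_div (by positivity),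
      Real.sqrt_mul Real.pi_pos.le, Real.sqrt_mul (by norm_num), Real.sqrt_sq hR.le]
    congr 1
    have : √Real.pi ≠ 0 := by positivity
    field_simp
  have ht := (aecover_closedBall (μ := (volume : Measure (Fin M → ℂ))) (x := 0)
    Filter.tendsto_id).lintegral_tendsto_of_countably_generated
    (f := fun α => ‖braket ψ (coherent α)‖ₑ ^ 2)
    ((continuous_braket_coherent hψ).enorm.measurable.pow_const 2).aemeasurable
  refine lt_of_le_of_lt (b := C) (le_of_tendsto ht ?_) (ENNReal.mul_lt_top ENNReal.ofReal_lt_top hS)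
  filter_upwards [Filter.eventually_gt_atTop 0] with R hR using hb R hR

/-! ### Coherent states are total, and amplitudes are analytic -/

/-- The finite measures with densities `r⁺` and `r⁻` have the same characteristic function, so they
are equal, and so are their densities almost everywhere. -/
lemma ae_eq_zero_of_integral_exp_eq_zero {V : Type*} [NormedAddCommGroup V] [NormedSpace ℝ V]
    [CompleteSpace V] [SecondCountableTopology V] [MeasurableSpace V] [BorelSpace V]
    {μ : Measure V} {r : V → ℝ} (hr : Integrable r μ)
    (h : ∀ ℓ : StrongDual ℝ V, ∫ x, (r x : ℂ) * Complex.exp (ℓ x * Complex.I) ∂μ = 0) :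
    r =ᵐ[μ] 0 := by
  have hfin : ∀ s : V → ℝ, Integrable s μ →
      IsFiniteMeasure (μ.withDensity fun x => ENNReal.ofReal (s x)) := fun s hs =>
    isFiniteMeasure_withDensity_ofReal hs.2
  have := hfin r hr
  have := hfin _ hr.neg
  have hm : AEMeasurable (fun x => ENNReal.ofReal (r x)) μ := hr.1.aemeasurable.ennreal_ofReal
  have hm' : AEMeasurable (fun x => ENNReal.ofReal (-r x)) μ :=
    hr.1.aemeasurable.neg.ennreal_ofReal
  have hexp : ∀ (ℓ : StrongDual ℝ V) x, ‖Complex.exp (ℓ x * Complex.I)‖ ≤ 1 := fun ℓ x => by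
    rw [Complex.norm_exp_ofReal_mul_I]
  have hint : ∀ (ℓ : StrongDual ℝ V) (s : V → ℝ), Integrable s μ →
      Integrable (fun x => (max (s x) 0) • Complex.exp (ℓ x * Complex.I)) μ := fun ℓ s hs =>
    (hs.pos_part).smul_bdd 1
      (by fun_prop : Continuous fun x => Complex.exp (ℓ x * Complex.I)).aestronglyMeasurable
      (.of_forall (hexp ℓ))
  have heq : (μ.withDensity fun x => ENNReal.ofReal (r x))
      = μ.withDensity fun x => ENNReal.ofReal (-r x) := by
    refine Measure.ext_of_charFunDual (funext fun ℓ => ?_)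
    rw [charFunDual_apply, charFunDual_apply,
      integral_withDensity_eq_integral_toReal_smul₀ hm (.of_forall fun _ => ENNReal.ofReal_lt_top),
      integral_withDensity_eq_integral_toReal_smul₀ hm' (.of_forall fun _ => ENNReal.ofReal_lt_top),
      ← sub_eq_zero]
    simp only [ENNReal.toReal_ofReal']
    rw [← integral_sub (hint ℓ r hr) (hint ℓ (fun x => -r x) hr.neg), ← h ℓ]
    refine integral_congr_ae (.of_forall fun x => ?_)
    simp only
    rw [← sub_smul, Complex.real_smul]
    congr 2
    rcases le_total (r x) 0 with h0 | h0
    · rw [max_eq_right h0, max_eq_left (by linarith)]; ring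
    · rw [max_eq_left h0, max_eq_right (by linarith)]; ring
  have hlt : ∫⁻ x, ENNReal.ofReal (r x) ∂μ ≠ ⊤ :=
    (lt_of_le_of_lt (lintegral_mono fun x => Real.ofReal_le_enorm _) hr.2).ne
  filter_upwards [(withDensity_eq_iff hm hm' hlt).1 heq] with x hx
  rcases le_total (r x) 0 with h0 | h0
  · rw [ENNReal.ofReal_of_nonpos h0] at hx
    have := ENNReal.ofReal_eq_zero.1 hx.symm
    exact le_antisymm h0 (by simpa using this)
  · rw [ENNReal.ofReal_of_nonpos (by linarith : -r x ≤ 0)] at hx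
    exact le_antisymm (ENNReal.ofReal_eq_zero.1 hx) h0

lemma ae_eq_zero_of_complex_integral_exp_eq_zero {V : Type*} [NormedAddCommGroup V]
    [NormedSpace ℝ V] [CompleteSpace V] [SecondCountableTopology V] [MeasurableSpace V]
    [BorelSpace V] {μ : Measure V} {r : V → ℂ} (hr : Integrable r μ)
    (h : ∀ ℓ : StrongDual ℝ V, ∫ x, r x * Complex.exp (ℓ x * Complex.I) ∂μ = 0) :
    r =ᵐ[μ] 0 := by
  have hint : ∀ (ℓ : StrongDual ℝ V) (s : V → ℂ), Integrable s μ →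
      Integrable (fun x => s x * Complex.exp (ℓ x * Complex.I)) μ := fun ℓ s hs =>
    hs.mul_bdd (c := 1)
      (by fun_prop : Continuous fun x => Complex.exp (ℓ x * Complex.I)).aestronglyMeasurable
      (.of_forall fun x => by rw [Complex.norm_exp_ofReal_mul_I])
  have hc : Integrable (fun x => starRingEnd ℂ (r x)) μ := Complex.conjLIE.integrable_comp_iff.2 hr
  have h' : ∀ ℓ : StrongDual ℝ V,
      ∫ x, starRingEnd ℂ (r x) * Complex.exp (ℓ x * Complex.I) ∂μ = 0 := fun ℓ => by
    rw [← map_zero (starRingEnd ℂ), ← h (-ℓ), ← integral_conj]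
    refine integral_congr_ae (.of_forall fun x => ?_)
    simp [← Complex.exp_conj]
  have hre := ae_eq_zero_of_integral_exp_eq_zero hr.re fun ℓ => by
    have e : ∀ x, ((RCLike.re (r x) : ℝ) : ℂ) * Complex.exp (ℓ x * Complex.I)
        = 1 / 2 * (r x * Complex.exp (ℓ x * Complex.I)
          + starRingEnd ℂ (r x) * Complex.exp (ℓ x * Complex.I)) := fun x => by
      rw [← add_mul, Complex.add_conj]; simp; ring
    simp only [e]
    rw [integral_const_mul, integral_add (hint ℓ _ hr) (hint ℓ _ hc), h, h', add_zero, mul_zero]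
  have him := ae_eq_zero_of_integral_exp_eq_zero hr.im fun ℓ => by
    have e : ∀ x, ((RCLike.im (r x) : ℝ) : ℂ) * Complex.exp (ℓ x * Complex.I)
        = -Complex.I / 2 * (r x * Complex.exp (ℓ x * Complex.I)
          - starRingEnd ℂ (r x) * Complex.exp (ℓ x * Complex.I)) := fun x => by
      rw [← sub_mul, Complex.sub_conj]
      simp only [RCLike.im_to_complex]
      push_cast
      linear_combination (((r x).im : ℂ) * Complex.exp (ℓ x * Complex.I)) * Complex.I_mul_I
    simp only [e]
    rw [integral_const_mul, integral_sub (hint ℓ _ hr) (hint ℓ _ hc), h, h', sub_zero, mul_zero]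
  filter_upwards [hre, him] with x h1 h2
  exact Complex.ext h1 h2

/-- Overlaps with purely imaginary displacements are the Fourier transform of `conj ψ` times the
vacuum. If they all vanish, that product is zero almost everywhere, and the vacuum has no zeros. -/
lemma exists_braket_coherent_ne_zero {M : ℕ} {ψ : Wave M} (hψ : MemLp ψ 2 volume)
    (hne : ¬ ψ =ᵐ[volume] 0) : ∃ α, braket ψ (coherent α) ≠ 0 := by
  by_contra! h
  refine hne ?_
  have h0 : (fun x => starRingEnd ℂ (ψ x) * coherent 0 x) =ᵐ[volume] 0 := by
    refine ae_eq_zero_of_complex_integral_exp_eq_zero (integrable_conj_mul_coherent hψ 0)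
      fun ℓ => ?_
    rw [← h fun j => ((ℓ (Pi.single j 1) / √2 : ℝ) : ℂ) * Complex.I, braket]
    refine integral_congr_ae (.of_forall fun x => ?_)
    simp only
    rw [mul_assoc]
    congr 1
    have hl : ℓ x = ∑ j, x j * ℓ (Pi.single j 1) := by
      conv_lhs => rw [← Finset.univ_sum_single x]
      rw [map_sum]
      refine Finset.sum_congr rfl fun j _ => ?_
      rw [← smul_eq_mul, ← map_smul, ← Pi.single_smul, smul_eq_mul, mul_one]
    rw [coherent, coherent, hl, Complex.ofReal_sum, Finset.sum_mul, Complex.exp_sum,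
      ← Finset.prod_mul_distrib]
    refine Finset.prod_congr rfl fun j _ => ?_
    have h2 : √2 ≠ 0 := by positivity
    simp only [displace, Pi.zero_apply, Complex.zero_re, Complex.zero_im, Complex.mul_re,
      Complex.mul_im, Complex.ofReal_re, Complex.ofReal_im, Complex.I_re, Complex.I_im]
    simp only [mul_zero, zero_mul, mul_one, sub_zero, add_zero, Complex.ofReal_zero,
      Complex.exp_zero, one_mul]
    rw [mul_comm, mul_div_cancel₀ _ h2, mul_comm Complex.I, mul_comm (x j)]
  filter_upwards [h0] with x hx
  have hc : coherent 0 x ≠ 0 := by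
    rw [← norm_ne_zero_iff, norm_coherent]
    exact Finset.prod_ne_zero_iff.2 fun j _ => by positivity
  have := (mul_eq_zero.1 hx).resolve_right hc
  simpa using this

/-- The unnormalized coherent state `exp(∑_j (-x_j²/2 + √2 α_j x_j))`, holomorphic in `α`. -/
def bargmannKernel {M : ℕ} (α : Fin M → ℂ) (x : Fin M → ℝ) : ℂ :=
  Complex.exp (∑ j, (-(x j : ℂ) ^ 2 / 2 + √2 * α j * x j))

lemma coherent_eq_mul_bargmannKernel {M : ℕ} (α : Fin M → ℂ) :
    ∃ c : ℂ, c ≠ 0 ∧ ∀ x, coherent α x = c * bargmannKernel α x := by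
  refine ⟨∏ j, ((Real.pi ^ (-(1 / 4) : ℝ) : ℝ) : ℂ) *
    Complex.exp (-(α j).re ^ 2 - Complex.I * (α j).re * (α j).im),
    Finset.prod_ne_zero_iff.2 fun j _ => mul_ne_zero
      (Complex.ofReal_ne_zero.2 (Real.rpow_pos_of_pos Real.pi_pos _).ne') (Complex.exp_ne_zero _),
    fun x => ?_⟩
  rw [coherent, bargmannKernel, Complex.exp_sum, ← Finset.prod_mul_distrib]
  refine Finset.prod_congr rfl fun j _ => ?_
  rw [displace, vacuum, mul_assoc, Complex.ofReal_mul, mul_left_comm, Complex.ofReal_exp,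
    ← Complex.exp_add, mul_assoc, ← Complex.exp_add]
  congr 2
  have h2 : ((√2 : ℝ) : ℂ) ^ 2 = 2 := by
    rw [← Complex.ofReal_pow, Real.sq_sqrt (by norm_num)]; norm_num
  conv_rhs => rw [← Complex.re_add_im (α j)]
  simp only [Complex.add_re, Complex.add_im, Complex.ofReal_re, Complex.ofReal_im, Complex.mul_re,
    Complex.mul_im, Complex.I_re, Complex.I_im]
  push_cast
  linear_combination (-((α j).re : ℂ) ^ 2 / 2) * h2

lemma norm_bargmannKernel_mul_le {M : ℕ} (α w : Fin M → ℂ) {T : ℝ} {t : ℂ}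
    (ht : ‖t‖ ≤ T) (x : Fin M → ℝ) :
    ‖bargmannKernel (α + t • w) x * ∑ j, √2 * w j * x j‖
      ≤ Real.exp (∑ j, 2 * (‖α j‖ + (T + 1) * ‖w j‖) ^ 2) * gaussEnvelope x := by
  have hs : ‖∑ j, (√2 * w j * x j : ℂ)‖ ≤ Real.exp (∑ j, √2 * ‖w j‖ * |x j|) := by
    refine (norm_sum_le _ _).trans (le_trans (le_of_eq ?_) ((le_add_of_nonneg_right zero_le_one).trans
      (Real.add_one_le_exp _)))
    refine Finset.sum_congr rfl fun j _ => ?_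
    rw [norm_mul, norm_mul, Complex.norm_real, Complex.norm_real, Real.norm_eq_abs, Real.norm_eq_abs,
      abs_of_nonneg (Real.sqrt_nonneg 2)]
  rw [norm_mul, bargmannKernel, Complex.norm_exp, gaussEnvelope, ← Real.exp_sum, ← Real.exp_add]
  refine (mul_le_mul_of_nonneg_left hs (Real.exp_pos _).le).trans ?_
  rw [← Real.exp_add, Complex.re_sum, ← Finset.sum_add_distrib, ← Finset.sum_add_distrib]
  refine Real.exp_le_exp.2 (Finset.sum_le_sum fun j _ => ?_)
  have h1 : (-(x j : ℂ) ^ 2 / 2 + √2 * (α + t • w) j * x j).re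
      = -(x j) ^ 2 / 2 + √2 * ((α + t • w) j).re * x j := by
    have : (-(x j : ℂ) ^ 2 / 2 + √2 * (α + t • w) j * x j)
        = ((-(x j) ^ 2 / 2 : ℝ) : ℂ) + ((√2 * x j : ℝ) : ℂ) * (α + t • w) j := by
      push_cast; ring
    rw [this, Complex.add_re, Complex.ofReal_re, Complex.re_ofReal_mul]
    ring
  have h2 : ((α + t • w) j).re * x j ≤ (‖α j‖ + T * ‖w j‖) * |x j| := by
    refine (le_abs_self _).trans ?_
    rw [abs_mul]
    refine mul_le_mul_of_nonneg_right ((Complex.abs_re_le_norm _).trans ?_) (abs_nonneg _)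
    simp only [Pi.add_apply, Pi.smul_apply, smul_eq_mul]
    refine (norm_add_le _ _).trans (add_le_add_right ?_ _)
    rw [norm_mul]
    exact mul_le_mul_of_nonneg_right ht (norm_nonneg _)
  have h3 : (√2) ^ 2 = 2 := Real.sq_sqrt (by norm_num)
  have h4 := mul_le_mul_of_nonneg_left h2 (Real.sqrt_nonneg 2)
  rw [h1]
  have h5 : |x j| ^ 2 = x j ^ 2 := sq_abs _
  nlinarith [sq_nonneg (|x j| / 2 - √2 * (‖α j‖ + (T + 1) * ‖w j‖))]

lemma continuous_bargmannKernel {M : ℕ} (α : Fin M → ℂ) : Continuous (bargmannKernel α) := by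
  unfold bargmannKernel; fun_prop

/-- The normalization of a coherent state is not holomorphic in `α` but never vanishes, so zeros may
be studied on the holomorphic kernel. -/
lemma braket_coherent_ne_zero_iff {M : ℕ} (ψ : Wave M) (α : Fin M → ℂ) :
    braket ψ (coherent α) ≠ 0 ↔ ∫ x, starRingEnd ℂ (ψ x) * bargmannKernel α x ≠ 0 := by
  obtain ⟨c, hc, h⟩ := coherent_eq_mul_bargmannKernel α
  have : braket ψ (coherent α) = c * ∫ x, starRingEnd ℂ (ψ x) * bargmannKernel α x := by
    rw [braket, ← integral_const_mul]
    refine integral_congr_ae (.of_forall fun x => ?_)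
    simp only [h]
    ring
  rw [this, mul_ne_zero_iff, and_iff_right hc]

lemma differentiable_integral_bargmannKernel {M : ℕ} {ψ : Wave M} (hψ : MemLp ψ 2 volume)
    (α w : Fin M → ℂ) :
    Differentiable ℂ fun t : ℂ => ∫ x, starRingEnd ℂ (ψ x) * bargmannKernel (α + t • w) x := by
  intro t
  have hψc : AEStronglyMeasurable (fun x => starRingEnd ℂ (ψ x)) volume :=
    Complex.continuous_conj.comp_aestronglyMeasurable hψ.1
  have hint : Integrable fun x => starRingEnd ℂ (ψ x) * bargmannKernel (α + t • w) x := by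
    obtain ⟨c, hc, h⟩ := coherent_eq_mul_bargmannKernel (α + t • w)
    refine ((integrable_conj_mul_coherent hψ (α + t • w)).const_mul c⁻¹).congr
      (.of_forall fun x => ?_)
    simp only [h]
    field_simp
  refine (hasDerivAt_integral_of_dominated_loc_of_deriv_le (𝕜 := ℂ)
    (F := fun t x => starRingEnd ℂ (ψ x) * bargmannKernel (α + t • w) x)
    (F' := fun t x => starRingEnd ℂ (ψ x) *
      (bargmannKernel (α + t • w) x * ∑ j, √2 * w j * x j))
    (bound := fun x => Real.exp (∑ j, 2 * (‖α j‖ + ((‖t‖ + 1) + 1) * ‖w j‖) ^ 2) *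
      (‖ψ x‖ * gaussEnvelope x)) (Metric.ball_mem_nhds t one_pos)
    (.of_forall fun s => hψc.mul (continuous_bargmannKernel _).aestronglyMeasurable) hint
    (hψc.mul ((continuous_bargmannKernel _).mul (by fun_prop)).aestronglyMeasurable)
    (.of_forall fun x s hs => ?_) ((integrable_norm_mul_gaussEnvelope hψ).const_mul _)
    (.of_forall fun x s _ => ?_)).2.differentiableAt
  · rw [norm_mul, RCLike.norm_conj, mul_left_comm]
    refine mul_le_mul_of_nonneg_left (norm_bargmannKernel_mul_le α w ?_ x) (norm_nonneg _)
    have : ‖s - t‖ < 1 := by simpa [dist_eq_norm] using hs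
    linarith [norm_le_norm_add_norm_sub' s t]
  · refine HasDerivAt.const_mul _ ?_
    have e : ∀ s : ℂ, bargmannKernel (α + s • w) x
        = Complex.exp ((∑ j, (-(x j : ℂ) ^ 2 / 2 + √2 * α j * x j))
          + s * ∑ j, √2 * w j * x j) := fun s => by
      rw [bargmannKernel, Finset.mul_sum, ← Finset.sum_add_distrib]
      congr 1
      refine Finset.sum_congr rfl fun j _ => ?_
      simp only [Pi.add_apply, Pi.smul_apply, smul_eq_mul]
      ring
    simp only [e]
    refine HasDerivAt.cexp ?_
    simpa using ((hasDerivAt_id s).mul_const (∑ j, √2 * w j * x j)).const_add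
      (∑ j, (-(x j : ℂ) ^ 2 / 2 + √2 * α j * x j))

/-- The amplitude is nonzero at some point and at its image under a reflection. -/
lemma exists_braket_reflection_ne_zero {M : ℕ} {ψ : Wave M} (hψ : MemLp ψ 2 volume)
    (hne : ¬ ψ =ᵐ[volume] 0) {s : Fin M → ℂ} (hs : ∀ j, s j * s j = 1) :
    ∃ α, braket ψ (coherent α) ≠ 0 ∧ braket ψ (coherent fun j => s j * α j) ≠ 0 := by
  obtain ⟨α₀, h0⟩ := exists_braket_coherent_ne_zero hψ hne
  -- On the complex line through `α₀` and its reflection, the reflection acts as `t ↦ 1 - t`,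
  -- because `s j * s j = 1`. By the identity theorem the product `h t * h (1 - t)` of entire
  -- functions cannot vanish identically.
  set w : Fin M → ℂ := (fun j => s j * α₀ j) - α₀ with hw
  set h : ℂ → ℂ := fun t => ∫ x, starRingEnd ℂ (ψ x) * bargmannKernel (α₀ + t • w) x with hh
  have hd : Differentiable ℂ h := differentiable_integral_bargmannKernel hψ α₀ w
  have hd' : Differentiable ℂ fun t => h (1 - t) := hd.comp (by fun_prop)
  have hn : h 0 ≠ 0 := by
    have := (braket_coherent_ne_zero_iff ψ α₀).1 h0
    simpa [hh] using this
  have hex : ∃ t, h t ≠ 0 ∧ h (1 - t) ≠ 0 := by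
    by_contra! hc
    have han : ∀ {g : ℂ → ℂ}, Differentiable ℂ g → AnalyticOnNhd ℂ g Set.univ := fun hg =>
      hg.differentiableOn.analyticOnNhd isOpen_univ
    rcases (han hd).eq_zero_or_eq_zero_of_mul_eq_zero (han hd') (fun t _ => by
      by_cases ht : h t = 0
      · rw [ht, zero_mul]
      · rw [hc t ht, mul_zero]) isPreconnected_univ with h1 | h1
    · exact hn (h1 0 trivial)
    · refine hn ?_
      simpa using h1 1 trivial
  obtain ⟨t, ht1, ht2⟩ := hex
  refine ⟨α₀ + t • w, (braket_coherent_ne_zero_iff ψ _).2 ht1,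
    (braket_coherent_ne_zero_iff ψ _).2 ?_⟩
  have : (fun j => s j * (α₀ + t • w) j) = α₀ + (1 - t) • w := by
    funext j
    simp only [hw, Pi.add_apply, Pi.smul_apply, Pi.sub_apply, smul_eq_mul]
    linear_combination (t * α₀ j) * hs j
  rw [this]
  exact ht2

/-! ### Large-energy behaviour of the correlators -/

lemma sq_lintegral_mul_le {α : Type*} [MeasurableSpace α] {μ : Measure α} {f g : α → ENNReal}
    (hf : AEMeasurable f μ) (hg : AEMeasurable g μ) :
    (∫⁻ x, f x * g x ∂μ) ^ 2 ≤ (∫⁻ x, f x ^ 2 ∂μ) * ∫⁻ x, g x ^ 2 ∂μ := by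
  have h := ENNReal.lintegral_mul_le_Lp_mul_Lq μ Real.HolderConjugate.two_two hf hg
  have h2 := pow_le_pow_left₀ (zero_le (a := ∫⁻ x, (f * g) x ∂μ)) h 2
  refine h2.trans (le_of_eq ?_)
  rw [mul_pow, ← ENNReal.rpow_natCast, ← ENNReal.rpow_natCast, ← ENNReal.rpow_mul,
    ← ENNReal.rpow_mul]
  norm_num

/-- A shift of the first variable followed by a dilation by `2` of the second separates the
integrals; the Jacobian is at most `1`. -/
lemma lintegral_add_sub_le {V : Type*} [NormedAddCommGroup V] [NormedSpace ℝ V]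
    [FiniteDimensional ℝ V] [MeasurableSpace V] [BorelSpace V] (μ : Measure V)
    [μ.IsAddHaarMeasure] {g h : V → ENNReal} (hg : Measurable g) (hh : Measurable h) :
    ∫⁻ p, g (p.1 + p.2) * h (p.1 - p.2) ∂(μ.prod μ) ≤ (∫⁻ x, g x ∂μ) * ∫⁻ x, h x ∂μ := by
  have hm : Measurable fun p : V × V => g (p.1 + p.2) * h (p.1 - p.2) := by fun_prop
  have hm' : Measurable (Function.uncurry fun b a => g a * h (a - (2 : ℝ) • b)) := by
    exact (by fun_prop : Measurable fun p : V × V => g p.2 * h (p.2 - (2 : ℝ) • p.1))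
  rw [lintegral_prod_symm _ hm.aemeasurable]
  have h1 : ∀ b, ∫⁻ a, g (a + b) * h (a - b) ∂μ = ∫⁻ a, g a * h (a - (2 : ℝ) • b) ∂μ := fun b => by
    rw [← lintegral_add_right_eq_self (fun a => g a * h (a - (2 : ℝ) • b)) b]
    refine lintegral_congr fun a => ?_
    rw [two_smul, add_sub_add_right_eq_sub]
  simp only [h1]
  rw [lintegral_lintegral_swap hm'.aemeasurable]
  have h2 : ∀ a, ∫⁻ b, g a * h (a - (2 : ℝ) • b) ∂μ ≤ g a * ∫⁻ x, h x ∂μ := fun a => by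
    rw [lintegral_const_mul _ (by fun_prop)]
    refine mul_le_mul_right ?_ _
    have e : ∫⁻ b, h (a - (2 : ℝ) • b) ∂μ = ∫⁻ y, h (a - y) ∂(μ.map ((2 : ℝ) • ·)) := by
      rw [lintegral_map (by fun_prop) (by fun_prop)]
    rw [e, Measure.map_addHaar_smul μ two_ne_zero, lintegral_smul_measure,
      lintegral_sub_left_eq_self]
    refine mul_le_of_le_one_left' (ENNReal.ofReal_le_one.2 ?_)
    rw [abs_of_nonneg (by positivity)]
    exact inv_le_one_of_one_le₀ (one_le_pow₀ one_le_two)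
  refine (lintegral_mono h2).trans (le_of_eq ?_)
  rw [lintegral_mul_const _ hg]

/-- The amplitude `|⟨ψ|α⟩|` in `[0, ∞]`. -/
def eamp {M : ℕ} (ψ : Wave M) (α : Fin M → ℂ) : ENNReal := ‖braket ψ (coherent α)‖ₑ

lemma measurable_eamp {M : ℕ} {ψ : Wave M} (hψ : MemLp ψ 2 volume) : Measurable (eamp ψ) :=
  (continuous_braket_coherent hψ).enorm.measurable

lemma ofReal_amp {M : ℕ} (ψ : Wave M) (α : Fin M → ℂ) : ENNReal.ofReal (amp ψ α) = eamp ψ α :=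
  ofReal_norm _

lemma ofReal_C₂ {M : ℕ} {ψ : Wave M} (hψ : MemLp ψ 2 volume) (E : ℝ) (z : Fin M → ℝ) :
    ENNReal.ofReal (C₂ ψ E z) = ∫⁻ α, eamp ψ (α.1 + α.2) ^ 2 * eamp ψ (α.1 - α.2) ^ 2
      ∂((gaussianVector E z).prod (gaussianVector E (1 - z))) := by
  have hcont : Continuous fun α => amp ψ α := (continuous_braket_coherent hψ).norm
  have h0 := amp_nonneg ψ
  rw [C₂_eq, ofReal_integral_eq_lintegral_ofReal]
  · refine lintegral_congr fun α => ?_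
    rw [ENNReal.ofReal_mul (by positivity), ENNReal.ofReal_pow (h0 _), ENNReal.ofReal_pow (h0 _),
      ofReal_amp, ofReal_amp]
  · refine Integrable.of_bound (by fun_prop) (amplitudeBound ψ ^ 2 * amplitudeBound ψ ^ 2)
      (.of_forall fun α => ?_)
    rw [Real.norm_of_nonneg (by positivity)]
    have hb : ∀ α, amp ψ α ≤ amplitudeBound ψ := norm_braket_coherent_le hψ
    exact mul_le_mul (pow_le_pow_left₀ (h0 _) (hb _) 2) (pow_le_pow_left₀ (h0 _) (hb _) 2)
      (by positivity) (by positivity)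
  · exact .of_forall fun α => by positivity

lemma ofReal_C₃ {M : ℕ} {ψ : Wave M} (hψ : MemLp ψ 2 volume) (E : ℝ) (z z' : Fin M → ℝ) :
    ENNReal.ofReal (C₃ ψ E z z') = ∫⁻ α, (eamp ψ (α.1 + α.2.1 + α.2.2) *
        eamp ψ (α.1 + α.2.1 - α.2.2)) * (eamp ψ (α.1 - α.2.1 - α.2.2) *
        eamp ψ (α.1 - α.2.1 + α.2.2))
      ∂((gaussianVector E z).prod ((gaussianVector E z').prod
        (gaussianVector E (1 - z - z')))) := by
  have hcont : Continuous fun α => amp ψ α := (continuous_braket_coherent hψ).norm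
  have h0 := amp_nonneg ψ
  have hb : ∀ α, amp ψ α ≤ amplitudeBound ψ := norm_braket_coherent_le hψ
  have hB := (amplitudeBound_pos ψ).le
  have h2 : ∀ α β, 0 ≤ amp ψ α * amp ψ β := fun α β => mul_nonneg (h0 _) (h0 _)
  have hb2 : ∀ α β, amp ψ α * amp ψ β ≤ amplitudeBound ψ * amplitudeBound ψ := fun α β =>
    mul_le_mul (hb _) (hb _) (h0 _) hB
  rw [C₃_eq, ofReal_integral_eq_lintegral_ofReal]
  · refine lintegral_congr fun α => ?_
    rw [ENNReal.ofReal_mul (h2 _ _), ENNReal.ofReal_mul (h0 _), ENNReal.ofReal_mul (h0 _)]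
    simp only [ofReal_amp]
  · refine Integrable.of_bound (by fun_prop)
      (amplitudeBound ψ * amplitudeBound ψ * (amplitudeBound ψ * amplitudeBound ψ))
      (.of_forall fun α => ?_)
    rw [Real.norm_of_nonneg (mul_nonneg (h2 _ _) (h2 _ _))]
    exact mul_le_mul (hb2 _ _) (hb2 _ _) (h2 _ _) (by positivity)
  · exact .of_forall fun α => mul_nonneg (h2 _ _) (h2 _ _)

lemma C₂_nonneg {M : ℕ} (ψ : Wave M) (E : ℝ) (z : Fin M → ℝ) : 0 ≤ C₂ ψ E z := by
  rw [C₂_eq]; exact integral_nonneg fun α => by positivity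

lemma ofReal_inv_pow {c E : ℝ} (hc : 0 < c) (hE : 0 < E) (n : ℕ) :
    ENNReal.ofReal (Real.pi * (c * E))⁻¹ ^ n
      = ENNReal.ofReal ((Real.pi * c)⁻¹ ^ n * E⁻¹ ^ n) := by
  rw [← ENNReal.ofReal_pow (by positivity), ← mul_pow, ← mul_inv, mul_assoc]

/-- For nondegenerate `z`, the correlator `C₂(z)` decays as `E^{-2M}`. -/
lemma C₂_le {M : ℕ} {ψ : Wave M} (hψ : MemLp ψ 2 volume) {c : ℝ} (hc : 0 < c)
    {z : Fin M → ℝ} (h0 : ∀ j, c ≤ z j) (h1 : ∀ j, c ≤ 1 - z j) :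
    ∃ K, ∀ E, 0 < E → C₂ ψ E z ≤ K * E⁻¹ ^ (2 * M) := by
  have hm := (measurable_eamp hψ).pow_const 2
  set S := ∫⁻ α, eamp ψ α ^ 2 with hS
  have hSt : S < ⊤ := lintegral_braket_sq_lt_top hψ
  refine ⟨(Real.pi * c)⁻¹ ^ (2 * M) * (S * S).toReal, fun E hE => ?_⟩
  have key : ENNReal.ofReal (C₂ ψ E z)
      ≤ ENNReal.ofReal ((Real.pi * c)⁻¹ ^ (2 * M) * E⁻¹ ^ (2 * M)) * (S * S) := by
    rw [ofReal_C₂ hψ, ← ofReal_inv_pow hc hE, two_mul, pow_add]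
    refine (lintegral_mono' (Measure.prod_mono (gaussianVector_le hc hE h0)
      (gaussianVector_le hc hE h1)) le_rfl).trans ?_
    rw [Measure.prod_smul_left, Measure.prod_smul_right, lintegral_smul_measure,
      lintegral_smul_measure, smul_eq_mul, smul_eq_mul, ← mul_assoc]
    gcongr
    exact lintegral_add_sub_le _ hm hm
  have h := ENNReal.toReal_mono (by finiteness) key
  rw [ENNReal.toReal_ofReal (C₂_nonneg ψ E z), ENNReal.toReal_mul,
    ENNReal.toReal_ofReal (by positivity)] at h
  linarith

/-- Each mode of positive variance costs one factor `E⁻¹`; a mode of variance zero is a point mass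
at the center of its disc and costs nothing. -/
lemma gaussianVector_closedBall_ge {M : ℕ} {z : Fin M → ℝ} {x : Fin M → ℂ}
    (hz : ∀ j, 0 ≤ z j) (hx : ∀ j, z j = 0 → x j = 0) {δ : ℝ} (hδ : 0 < δ) :
    ∃ c, 0 < c ∧ ∀ E, 1 ≤ E →
      ENNReal.ofReal (c * E⁻¹ ^ (Finset.card {j | z j ≠ 0}))
        ≤ gaussianVector E z (Metric.closedBall x δ) := by
  set c : Fin M → ℝ := fun j => if z j = 0 then 1 else
    (z j)⁻¹ * (δ ^ 2 * Real.exp (-(‖x j‖ + δ) ^ 2 / z j)) with hc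
  have hcpos : ∀ j, 0 < c j := fun j => by
    simp only [hc]
    split_ifs with h
    · exact one_pos
    · have := (hz j).lt_of_ne' h
      positivity
  refine ⟨∏ j, c j, Finset.prod_pos fun j _ => hcpos j, fun E hE => ?_⟩
  have hE0 : 0 < E := by linarith
  rw [closedBall_pi x hδ.le, gaussianVector, Measure.pi_pi, ← Finset.prod_const,
    Finset.prod_filter, ← Finset.prod_mul_distrib, ENNReal.ofReal_prod_of_nonneg]
  · refine Finset.prod_le_prod' fun j _ => ?_
    by_cases h : z j = 0
    · rw [hx j h, h, zero_mul, complexGaussian_zero, Measure.dirac_apply' _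
        Metric.isClosed_closedBall.measurableSet, Set.indicator_of_mem]
      · simp [hc, h]
      · simpa using hδ.le
    · have hzj := (hz j).lt_of_ne' h
      refine le_trans (ENNReal.ofReal_le_ofReal ?_)
        (complexGaussian_closedBall_ge (mul_pos hzj hE0) (x j) hδ.le)
      simp only [hc, h, if_false, ne_eq, not_false_eq_true, if_true]
      rw [mul_inv, mul_right_comm]
      refine mul_le_mul_of_nonneg_left (mul_le_mul_of_nonneg_left (Real.exp_le_exp.2 ?_)
        (by positivity)) (by positivity)
      rw [neg_div, neg_div, neg_le_neg_iff]
      exact div_le_div_of_nonneg_left (by positivity) hzj (le_mul_of_one_le_right hzj.le hE)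
  · intro j _
    have := (hcpos j).le
    split_ifs <;> positivity

/-- A lower bound of `C₂(z)` by a power of the energy which depends on the degeneracy of `z`. -/
lemma le_C₂ {M : ℕ} {ψ : Wave M} (hψ : MemLp ψ 2 volume) (hne : ¬ ψ =ᵐ[volume] 0)
    {z : Fin M → ℝ} (h0 : ∀ j, 0 ≤ z j) (h1 : ∀ j, z j ≤ 1) :
    ∃ c, 0 < c ∧ ∀ E, 1 ≤ E →
      c * E⁻¹ ^ (Finset.card {j | z j ≠ 0} + Finset.card {j | z j ≠ 1}) ≤ C₂ ψ E z := by
  -- Modes with `z j = 0` must be carried by `b`, the others are put into `a`. Then `a + b = α`,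
  -- while `a - b` is `α` reflected in exactly the modes with `z j = 0`, so the integrand is
  -- positive at an admissible point.
  obtain ⟨α, hα, hα'⟩ := exists_braket_reflection_ne_zero hψ hne
    (s := fun j => if z j = 0 then -1 else 1) (fun j => by split_ifs <;> norm_num)
  set a : Fin M → ℂ := fun j => if z j = 0 then 0 else α j with ha
  set b : Fin M → ℂ := fun j => if z j = 0 then α j else 0 with hb
  have hab : a + b = α := by
    funext j; simp only [ha, hb, Pi.add_apply]; split_ifs <;> simp
  have hab' : a - b = fun j => (if z j = 0 then -1 else 1) * α j := by
    funext j; simp only [ha, hb, Pi.sub_apply]; split_ifs <;> simp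
  have hcont : Continuous fun α => amp ψ α := (continuous_braket_coherent hψ).norm
  set Φ : (Fin M → ℂ) × (Fin M → ℂ) → ℝ := fun p =>
    amp ψ (p.1 + p.2) ^ 2 * amp ψ (p.1 - p.2) ^ 2 with hΦ
  have hΦc : Continuous Φ := by simp only [hΦ]; fun_prop
  have hΦ0 : 0 < Φ (a, b) := by
    simp only [hΦ, hab, hab']
    exact mul_pos (pow_pos (norm_pos_iff.2 hα) 2) (pow_pos (norm_pos_iff.2 hα') 2)
  obtain ⟨δ, hδ, hball⟩ := Metric.nhds_basis_closedBall.mem_iff.1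
    (hΦc.continuousAt.eventually (lt_mem_nhds (half_lt_self hΦ0)))
  obtain ⟨c₁, hc₁, hl₁⟩ := gaussianVector_closedBall_ge (z := z) (x := a) h0
    (fun j hj => by simp [ha, hj]) hδ
  obtain ⟨c₂, hc₂, hl₂⟩ := gaussianVector_closedBall_ge (z := 1 - z) (x := b)
    (fun j => by simpa using h1 j)
    (fun j hj => by
      have : z j = 1 := by
        simp only [Pi.sub_apply, Pi.one_apply] at hj; linarith
      simp [hb, this]) hδ
  refine ⟨Φ (a, b) / 2 * (c₁ * c₂), by positivity, fun E hE => ?_⟩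
  have hE0 : 0 < E := by linarith
  have hcard : Finset.card {j | (1 - z) j ≠ 0} = Finset.card {j | z j ≠ 1} := by
    congr 1
    ext j
    have : (1 - z) j = 0 ↔ z j = 1 := by
      simp only [Pi.sub_apply, Pi.one_apply]
      constructor <;> intro h <;> linarith
    simp only [Finset.mem_filter, Finset.mem_univ, true_and, ne_eq, this]
  have hl₂' := hl₂ E hE
  rw [hcard] at hl₂'
  rw [← ENNReal.ofReal_le_ofReal_iff (C₂_nonneg ψ E z), ofReal_C₂ hψ]
  have hmeas : MeasurableSet (Metric.closedBall a δ ×ˢ Metric.closedBall b δ) :=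
    Metric.isClosed_closedBall.measurableSet.prod Metric.isClosed_closedBall.measurableSet
  calc ENNReal.ofReal (Φ (a, b) / 2 * (c₁ * c₂) *
        E⁻¹ ^ (Finset.card {j | z j ≠ 0} + Finset.card {j | z j ≠ 1}))
      = ENNReal.ofReal (Φ (a, b) / 2) * (ENNReal.ofReal (c₁ * E⁻¹ ^ Finset.card {j | z j ≠ 0}) *
          ENNReal.ofReal (c₂ * E⁻¹ ^ Finset.card {j | z j ≠ 1})) := by
        rw [← ENNReal.ofReal_mul (by positivity), ← ENNReal.ofReal_mul (by positivity), pow_add]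
        congr 1
        ring
    _ ≤ ENNReal.ofReal (Φ (a, b) / 2) * ((gaussianVector E z).prod (gaussianVector E (1 - z)))
          (Metric.closedBall a δ ×ˢ Metric.closedBall b δ) := by
        rw [Measure.prod_prod]
        gcongr
        exact hl₁ E hE
    _ = ∫⁻ _ in Metric.closedBall a δ ×ˢ Metric.closedBall b δ, ENNReal.ofReal (Φ (a, b) / 2)
          ∂((gaussianVector E z).prod (gaussianVector E (1 - z))) := by
        rw [setLIntegral_const]
    _ ≤ ∫⁻ p in Metric.closedBall a δ ×ˢ Metric.closedBall b δ,
          eamp ψ (p.1 + p.2) ^ 2 * eamp ψ (p.1 - p.2) ^ 2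
          ∂((gaussianVector E z).prod (gaussianVector E (1 - z))) := by
        refine setLIntegral_mono' hmeas fun p hp => ?_
        rw [closedBall_prod_same] at hp
        have : Φ (a, b) / 2 ≤ Φ p := le_of_lt (hball hp)
        rw [← ofReal_amp, ← ofReal_amp, ← ENNReal.ofReal_pow (amp_nonneg ψ _),
          ← ENNReal.ofReal_pow (amp_nonneg ψ _), ← ENNReal.ofReal_mul (by positivity)]
        exact ENNReal.ofReal_le_ofReal this
    _ ≤ _ := setLIntegral_le_lintegral _ _

/-- The part of the squared amplitude at distance at least `‖c‖` from the origin. -/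
def tailMass {M : ℕ} (ψ : Wave M) (c : Fin M → ℂ) : ENNReal :=
  ∫⁻ x, eamp ψ x ^ 2 * Set.indicator {x : Fin M → ℂ | ‖c‖ ≤ ‖x‖} 1 x

/-- The points `s + c` and `s - c` differ by `2c`, so one of them has norm at least `‖c‖`.
Cauchy-Schwarz then applies to each of the two cases. -/
lemma sq_lintegral_autocorrelation_le {M : ℕ} {ψ : Wave M} (hψ : MemLp ψ 2 volume)
    (c : Fin M → ℂ) :
    (∫⁻ s, eamp ψ (s + c) * eamp ψ (s - c)) ^ 2
      ≤ 4 * (∫⁻ x, eamp ψ x ^ 2) * tailMass ψ c := by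
  have hF := measurable_eamp hψ
  have hT : MeasurableSet {x : Fin M → ℂ | ‖c‖ ≤ ‖x‖} := measurableSet_le (by fun_prop) (by fun_prop)
  set t : (Fin M → ℂ) → ENNReal := Set.indicator {x | ‖c‖ ≤ ‖x‖} (eamp ψ) with ht
  have htm : Measurable t := hF.indicator hT
  have ht2 : ∫⁻ x, t x ^ 2 = tailMass ψ c := by
    refine lintegral_congr fun x => ?_
    by_cases hx : ‖c‖ ≤ ‖x‖
    · simp [ht, Set.indicator, hx]
    · simp [ht, Set.indicator, hx]
  have hle : ∫⁻ s, eamp ψ (s + c) * eamp ψ (s - c)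
      ≤ (∫⁻ s, t (s + c) * eamp ψ (s - c)) + ∫⁻ s, eamp ψ (s + c) * t (s - c) := by
    rw [← lintegral_add_left (by fun_prop)]
    refine lintegral_mono fun s => ?_
    by_cases h1 : ‖c‖ ≤ ‖s + c‖
    · refine le_add_right (le_of_eq ?_)
      simp [ht, h1]
    · by_cases h2 : ‖c‖ ≤ ‖s - c‖
      · refine le_add_left (le_of_eq ?_)
        simp [ht, h2]
      · exfalso
        have h3 : ‖(s + c) - (s - c)‖ ≤ ‖s + c‖ + ‖s - c‖ := norm_sub_le _ _
        have h4 : (s + c) - (s - c) = (2 : ℝ) • c := by rw [two_smul]; abel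
        rw [h4, norm_smul] at h3
        norm_num at h3
        linarith [not_le.1 h1, not_le.1 h2]
  have hA : (∫⁻ s, t (s + c) * eamp ψ (s - c)) ^ 2 ≤ (∫⁻ x, eamp ψ x ^ 2) * tailMass ψ c := by
    refine (sq_lintegral_mul_le (by fun_prop) (by fun_prop)).trans (le_of_eq ?_)
    rw [lintegral_add_right_eq_self (fun s => t s ^ 2),
      lintegral_sub_right_eq_self (fun s => eamp ψ s ^ 2), ht2, mul_comm]
  have hB : (∫⁻ s, eamp ψ (s + c) * t (s - c)) ^ 2 ≤ (∫⁻ x, eamp ψ x ^ 2) * tailMass ψ c := by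
    refine (sq_lintegral_mul_le (by fun_prop) (by fun_prop)).trans (le_of_eq ?_)
    rw [lintegral_add_right_eq_self (fun s => eamp ψ s ^ 2),
      lintegral_sub_right_eq_self (fun s => t s ^ 2), ht2]
  have hsum : ∀ x y X : ENNReal, x ^ 2 ≤ X → y ^ 2 ≤ X → (x + y) ^ 2 ≤ 4 * X := by
    intro x y X hx hy
    rcases le_total x y with h | h
    · calc (x + y) ^ 2 ≤ (y + y) ^ 2 := by gcongr
        _ = 4 * y ^ 2 := by ring
        _ ≤ 4 * X := by gcongr
    · calc (x + y) ^ 2 ≤ (x + x) ^ 2 := by gcongr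
        _ = 4 * x ^ 2 := by ring
        _ ≤ 4 * X := by gcongr
  rw [mul_assoc]
  exact (pow_le_pow_left₀ bot_le hle 2).trans (hsum _ _ _ hA hB)

lemma tendsto_gaussianVector_closedBall {M : ℕ} (hM : 0 < M) {c : ℝ} (hc : 0 < c)
    {z : Fin M → ℝ} (hz : ∀ j, c ≤ z j) (r : ℝ) :
    Filter.Tendsto (fun E => gaussianVector E z (Metric.closedBall 0 r)) Filter.atTop (nhds 0) := by
  have h1 : Filter.Tendsto (fun E : ℝ => ENNReal.ofReal (Real.pi * (c * E))⁻¹ ^ M *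
      volume (Metric.closedBall (0 : Fin M → ℂ) r)) Filter.atTop (nhds 0) := by
    have h2 : Filter.Tendsto (fun E : ℝ => (Real.pi * (c * E))⁻¹) Filter.atTop (nhds 0) :=
      Filter.Tendsto.inv_tendsto_atTop (Filter.Tendsto.const_mul_atTop Real.pi_pos
        (Filter.Tendsto.const_mul_atTop hc Filter.tendsto_id))
    have h3 := (ENNReal.tendsto_ofReal h2)
    have h4 := ENNReal.Tendsto.mul_const (b := volume (Metric.closedBall (0 : Fin M → ℂ) r))
      (ENNReal.Tendsto.pow (n := M) h3) (Or.inr measure_closedBall_lt_top.ne)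
    simpa [hM.ne'] using h4
  refine tendsto_of_tendsto_of_tendsto_of_le_of_le' tendsto_const_nhds h1
    (.of_forall fun _ => bot_le) ?_
  filter_upwards [Filter.eventually_gt_atTop 0] with E hE
  exact gaussianVector_le hc hE hz _

/-- After exchanging the integrals, the Husimi function at `x` is weighted by the Gaussian measure
of the ball of radius `‖x‖`. This tends to zero as the Gaussian spreads, and the integrable Husimi
function dominates. -/
lemma tendsto_lintegral_tailMass {M : ℕ} (hM : 0 < M) {ψ : Wave M} (hψ : MemLp ψ 2 volume)
    {c : ℝ} (hc : 0 < c) {z : Fin M → ℝ} (hz : ∀ j, c ≤ z j) :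
    Filter.Tendsto (fun E => ∫⁻ b, tailMass ψ b ∂gaussianVector E z) Filter.atTop (nhds 0) := by
  have hF := measurable_eamp hψ
  have hT : MeasurableSet {p : (Fin M → ℂ) × (Fin M → ℂ) | ‖p.1‖ ≤ ‖p.2‖} :=
    measurableSet_le (by fun_prop) (by fun_prop)
  set G : (Fin M → ℂ) → (Fin M → ℂ) → ENNReal := fun b x =>
    eamp ψ x ^ 2 * Set.indicator {x : Fin M → ℂ | ‖b‖ ≤ ‖x‖} 1 x with hG
  have hGm : Measurable (Function.uncurry G) := by
    have : Function.uncurry G = fun p => eamp ψ p.2 ^ 2 *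
        Set.indicator {p : (Fin M → ℂ) × (Fin M → ℂ) | ‖p.1‖ ≤ ‖p.2‖} 1 p := by
      funext p; rfl
    rw [this]
    exact ((hF.comp measurable_snd).pow_const 2).mul (measurable_one.indicator hT)
  have hin : ∀ E x, ∫⁻ b, G b x ∂gaussianVector E z
      = eamp ψ x ^ 2 * gaussianVector E z (Metric.closedBall 0 ‖x‖) := fun E x => by
    have : ∀ b, G b x = eamp ψ x ^ 2 * Set.indicator (Metric.closedBall 0 ‖x‖) 1 b := fun b => by
      simp [hG, Set.indicator]
    simp only [this]
    rw [lintegral_const_mul _ (measurable_one.indicator Metric.isClosed_closedBall.measurableSet),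
      lintegral_indicator_one Metric.isClosed_closedBall.measurableSet]
  have hswap : ∀ E, ∫⁻ b, tailMass ψ b ∂gaussianVector E z
      = ∫⁻ x, eamp ψ x ^ 2 * gaussianVector E z (Metric.closedBall 0 ‖x‖) := fun E => by
    simp only [← hin]
    exact lintegral_lintegral_swap hGm.aemeasurable
  simp only [hswap]
  have hzero : (0 : ENNReal) = ∫⁻ _ : Fin M → ℂ, 0 := by simp
  rw [hzero]
  refine tendsto_lintegral_filter_of_dominated_convergence (fun x => eamp ψ x ^ 2)
    (.of_forall fun E => ?_) (.of_forall fun E => .of_forall fun x => ?_)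
    (lintegral_braket_sq_lt_top hψ).ne (.of_forall fun x => ?_)
  · simp only [← hin]
    exact hGm.lintegral_prod_left'
  · exact mul_le_of_le_one_right' prob_le_one
  · have h := ENNReal.Tendsto.const_mul (a := eamp ψ x ^ 2)
      (tendsto_gaussianVector_closedBall hM hc hz ‖x‖)
      (Or.inr (ENNReal.pow_ne_top enorm_ne_top))
    simpa using h

/-- Only the laws of the first two vectors are replaced by Lebesgue measure. For a fixed third
vector `b`, the integrand is `g(x + y) g(x - y)` with `g(s) = |A(s + b)| |A(s - b)|`, `A` being the
amplitude, so the double integral is at most the squared autocorrelation. -/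
lemma ofReal_C₃_le {M : ℕ} {ψ : Wave M} (hψ : MemLp ψ 2 volume) {c : ℝ} (hc : 0 < c)
    {z z' : Fin M → ℝ} (h0 : ∀ j, c ≤ z j) (h1 : ∀ j, c ≤ z' j) {E : ℝ} (hE : 0 < E) :
    ENNReal.ofReal (C₃ ψ E z z')
      ≤ ENNReal.ofReal ((Real.pi * c)⁻¹ ^ (2 * M) * E⁻¹ ^ (2 * M)) *
        (4 * (∫⁻ x, eamp ψ x ^ 2) * ∫⁻ b, tailMass ψ b ∂gaussianVector E (1 - z - z')) := by
  have hF := measurable_eamp hψ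
  set γ := gaussianVector E (1 - z - z') with hγ
  have hH : Measurable fun α : (Fin M → ℂ) × (Fin M → ℂ) × (Fin M → ℂ) =>
      (eamp ψ (α.1 + α.2.1 + α.2.2) * eamp ψ (α.1 + α.2.1 - α.2.2)) *
        (eamp ψ (α.1 - α.2.1 - α.2.2) * eamp ψ (α.1 - α.2.1 + α.2.2)) := by fun_prop
  rw [ofReal_C₃ hψ, ← ofReal_inv_pow hc hE, two_mul, pow_add]
  refine (lintegral_mono' (Measure.prod_mono (gaussianVector_le hc hE h0)
    (Measure.prod_mono (gaussianVector_le hc hE h1) le_rfl)) le_rfl).trans ?_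
  rw [Measure.prod_smul_left, Measure.prod_smul_left, Measure.prod_smul_right,
    lintegral_smul_measure, lintegral_smul_measure, smul_eq_mul, smul_eq_mul, ← mul_assoc]
  gcongr
  have hH' : Measurable fun p : ((Fin M → ℂ) × (Fin M → ℂ)) × (Fin M → ℂ) =>
      (eamp ψ (p.1.1 + p.1.2 + p.2) * eamp ψ (p.1.1 + p.1.2 - p.2)) *
        (eamp ψ (p.1.1 - p.1.2 - p.2) * eamp ψ (p.1.1 - p.1.2 + p.2)) := by fun_prop
  rw [← (measurePreserving_prodAssoc volume volume γ).lintegral_comp hH]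
  change ∫⁻ p : ((Fin M → ℂ) × (Fin M → ℂ)) × (Fin M → ℂ),
      (eamp ψ (p.1.1 + p.1.2 + p.2) * eamp ψ (p.1.1 + p.1.2 - p.2)) *
        (eamp ψ (p.1.1 - p.1.2 - p.2) * eamp ψ (p.1.1 - p.1.2 + p.2)) ∂_ ≤ _
  have hSt : 4 * ∫⁻ x, eamp ψ x ^ 2 ≠ ⊤ :=
    ENNReal.mul_ne_top (by simp) (lintegral_braket_sq_lt_top hψ).ne
  rw [lintegral_prod_symm _ hH'.aemeasurable, ← lintegral_const_mul' _ _ hSt]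
  refine lintegral_mono fun b => (le_trans ?_ (sq_lintegral_autocorrelation_le hψ b))
  rw [sq]
  refine le_trans (lintegral_mono fun p => le_of_eq ?_) (lintegral_add_sub_le volume
    (g := fun s => eamp ψ (s + b) * eamp ψ (s - b)) (h := fun s => eamp ψ (s + b) * eamp ψ (s - b))
    (by fun_prop) (by fun_prop))
  rw [mul_comm (eamp ψ (p.1 - p.2 - b))]

/-- Nondegenerate correlators `C₃` decay faster than `E^{-2M}`. -/
lemma eventually_C₃_le {M : ℕ} (hM : 0 < M) {ψ : Wave M} (hψ : MemLp ψ 2 volume) {c : ℝ}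
    (hc : 0 < c) {z z' : Fin M → ℝ} (h0 : ∀ j, c ≤ z j) (h1 : ∀ j, c ≤ z' j)
    (h2 : ∀ j, c ≤ 1 - z j - z' j) {ε : ℝ} (hε : 0 < ε) :
    ∀ᶠ E in Filter.atTop, C₃ ψ E z z' ≤ ε * E⁻¹ ^ (2 * M) := by
  set K : ℝ := (Real.pi * c)⁻¹ ^ (2 * M) with hK
  have hKpos : 0 < K := by positivity
  have ht := ENNReal.Tendsto.const_mul (a := 4 * ∫⁻ x, eamp ψ x ^ 2)
    (tendsto_lintegral_tailMass hM hψ hc (z := 1 - z - z') h2)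
    (Or.inr (ENNReal.mul_ne_top (by simp) (lintegral_braket_sq_lt_top hψ).ne))
  rw [mul_zero] at ht
  have hpos : (0 : ENNReal) < ENNReal.ofReal (ε / K) := ENNReal.ofReal_pos.2 (by positivity)
  filter_upwards [ht.eventually_le_const hpos, Filter.eventually_gt_atTop 0] with E hE hE0
  rw [← ENNReal.ofReal_le_ofReal_iff (by positivity)]
  refine (ofReal_C₃_le hψ hc h0 h1 hE0).trans ((mul_le_mul_right hE _).trans (le_of_eq ?_))
  rw [← ENNReal.ofReal_mul (by positivity)]
  congr 1
  rw [← hK]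
  field_simp

/-! ### Degenerate and nondegenerate patterns at large energy -/

lemma inv_le_fraction {L M q : ℕ} {p : Fin (L * M) → Fin q} {a : Fin q} {j : Fin M}
    (h : ∃ n : Fin (L * M), n.modNat = j ∧ p n = a) : (L : ℝ)⁻¹ ≤ fraction p a j := by
  obtain ⟨n, hn⟩ := h
  rw [fraction, inv_eq_one_div]
  refine div_le_div_of_nonneg_right ?_ (Nat.cast_nonneg _)
  exact_mod_cast Finset.card_pos.2 ⟨n, Finset.mem_filter.2 ⟨Finset.mem_univ _, hn⟩⟩

lemma fraction_eq_zero {L M q : ℕ} {p : Fin (L * M) → Fin q} {a : Fin q} {j : Fin M}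
    (h : ∀ n : Fin (L * M), n.modNat = j → p n ≠ a) : fraction p a j = 0 := by
  rw [fraction, Finset.filter_false_of_mem fun n _ hn => h n hn.1 hn.2]
  simp

/-- A mode with `z j = 0` or `z j = 1` is missing from one of the two counts in `le_C₂`, so the
exponent there is at most `2M - 1`, which beats the decay `E^{-2M}` of the nondegenerate correlator.
-/
lemma eventually_C₂_le_C₂ {M : ℕ} {ψ : Wave M} (hψ : MemLp ψ 2 volume)
    (hne : ¬ ψ =ᵐ[volume] 0) {z z' : Fin M → ℝ} (h0 : ∀ j, 0 ≤ z j) (h1 : ∀ j, z j ≤ 1)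
    (hz : ∃ j, z j = 0 ∨ z j = 1) {c : ℝ} (hc : 0 < c) (h0' : ∀ j, c ≤ z' j)
    (h1' : ∀ j, c ≤ 1 - z' j) : ∀ᶠ E in Filter.atTop, C₂ ψ E z' ≤ C₂ ψ E z := by
  obtain ⟨K, hK⟩ := C₂_le hψ hc h0' h1'
  obtain ⟨b, hb, hl⟩ := le_C₂ hψ hne h0 h1
  have hlt : ∀ (P : Fin M → Prop) [DecidablePred P] (j : Fin M), ¬ P j →
      Finset.card {j | P j} + 1 ≤ M := fun P _ j hj => by
    have := Finset.card_lt_univ_of_notMem (s := {j | P j}) (x := j) (by simpa using hj)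
    rwa [Fintype.card_fin] at this
  have hle : ∀ (P : Fin M → Prop) [DecidablePred P], Finset.card {j | P j} ≤ M := fun P _ => by
    simpa using Finset.card_le_univ (s := ({j | P j} : Finset (Fin M)))
  have hcard : Finset.card {j | z j ≠ 0} + Finset.card {j | z j ≠ 1} + 1 ≤ 2 * M := by
    obtain ⟨j, hj | hj⟩ := hz
    · have h2 := hlt (fun j => z j ≠ 0) j (not_not.2 hj)
      have h3 := hle (fun j => z j ≠ 1)
      omega
    · have h2 := hlt (fun j => z j ≠ 1) j (not_not.2 hj)
      have h3 := hle (fun j => z j ≠ 0)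
      omega
  filter_upwards [Filter.eventually_ge_atTop 1, Filter.eventually_ge_atTop (K / b)] with E hE hE'
  have hE0 : 0 < E := by linarith
  refine (hK E hE0).trans (le_trans ?_ (hl E hE))
  have hpow : E⁻¹ ^ (2 * M) * E ≤ E⁻¹ ^ (Finset.card {j | z j ≠ 0} + Finset.card {j | z j ≠ 1}) := by
    refine le_trans ?_ (pow_le_pow_of_le_one (by positivity) (inv_le_one_of_one_le₀ hE)
      (Nat.le_sub_one_of_lt hcard))
    have : 2 * M = (2 * M - 1) + 1 := by omega
    rw [this, pow_succ, Nat.add_sub_cancel, mul_assoc, inv_mul_cancel₀ hE0.ne', mul_one]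
  calc K * E⁻¹ ^ (2 * M) ≤ b * E * E⁻¹ ^ (2 * M) := by
        refine mul_le_mul_of_nonneg_right ?_ (by positivity)
        rw [div_le_iff₀ hb] at hE'
        linarith
    _ = b * (E⁻¹ ^ (2 * M) * E) := by ring
    _ ≤ _ := mul_le_mul_of_nonneg_left hpow hb.le

lemma eventually_sum_C₃_le {L M : ℕ} (hL : 0 < L) (hM : 0 < M) {ψ : Wave M}
    (hψ : MemLp ψ 2 volume) (hne : ¬ ψ =ᵐ[volume] 0) (k : Fin (L * M)) {z : Fin M → ℝ}
    (h0 : ∀ j, 0 ≤ z j) (h1 : ∀ j, z j ≤ 1) {s : ℝ} (hs : 0 < s) :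
    ∀ᶠ E in Filter.atTop,
      ∑ p ∈ patterns L M 3 with Function.Surjective p,
          weight k p * C₃ ψ E (fraction p 0) (fraction p 1)
        ≤ boundaryC₃ ψ E k + s * C₂ ψ E z := by
  classical
  obtain ⟨b, hb, hl⟩ := le_C₂ hψ hne h0 h1
  set A : Finset (Fin (L * M) → Fin 3) := {p ∈ patterns L M 3 | Function.Surjective p} with hA
  -- The `+ 1` keeps `W` positive even when no surjective pattern exists.
  set W : ℝ := ∑ p ∈ A, weight k p + 1 with hW
  have hWpos : 0 < W := by
    have : 0 ≤ ∑ p ∈ A, weight k p := Finset.sum_nonneg fun p _ => (weight_pos k p).le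
    linarith
  have hLpos : (0 : ℝ) < (L : ℝ)⁻¹ := by positivity
  have hsub : degeneratePatterns L M 3 ⊆ A := fun p hp => by
    simp only [degeneratePatterns, Finset.mem_filter] at hp
    exact Finset.mem_filter.2 ⟨hp.1, hp.2.1⟩
  have hev : ∀ p ∈ A \ degeneratePatterns L M 3, ∀ᶠ E in Filter.atTop,
      C₃ ψ E (fraction p 0) (fraction p 1) ≤ s * b / W * E⁻¹ ^ (2 * M) := by
    intro p hp
    have hf : ∀ a j, (L : ℝ)⁻¹ ≤ fraction p a j := fun a j => inv_le_fraction (by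
      by_contra! h
      simp only [hA, degeneratePatterns, Finset.mem_sdiff, Finset.mem_filter] at hp
      exact hp.2 ⟨hp.1.1, hp.1.2, j, a, h⟩)
    refine eventually_C₃_le hM hψ hLpos (hf 0) (hf 1) (fun j => ?_) (by positivity)
    have h3 := sum_fraction hL p j
    rw [Fin.sum_univ_three] at h3
    have := hf 2 j
    linarith
  filter_upwards [(Filter.eventually_all_finset _).2 hev, Filter.eventually_ge_atTop 1] with E hE hE1
  have hE0 : 0 < E := by linarith
  rw [← Finset.sum_sdiff hsub, add_comm, boundaryC₃]
  refine add_le_add_right ?_ _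
  have hcard : Finset.card {j | z j ≠ 0} + Finset.card {j | z j ≠ 1} ≤ 2 * M := by
    have h2 := Finset.card_le_univ (s := ({j | z j ≠ 0} : Finset (Fin M)))
    have h3 := Finset.card_le_univ (s := ({j | z j ≠ 1} : Finset (Fin M)))
    rw [Fintype.card_fin] at h2 h3
    omega
  calc ∑ p ∈ A \ degeneratePatterns L M 3, weight k p * C₃ ψ E (fraction p 0) (fraction p 1)
      ≤ ∑ p ∈ A \ degeneratePatterns L M 3, weight k p * (s * b / W * E⁻¹ ^ (2 * M)) :=
        Finset.sum_le_sum fun p hp => mul_le_mul_of_nonneg_left (hE p hp) (weight_pos k p).le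
    _ ≤ ∑ p ∈ A, weight k p * (s * b / W * E⁻¹ ^ (2 * M)) :=
        Finset.sum_le_sum_of_subset_of_nonneg Finset.sdiff_subset fun p _ _ =>
          mul_nonneg (weight_pos k p).le (by positivity)
    _ ≤ W * (s * b / W * E⁻¹ ^ (2 * M)) := by
        rw [← Finset.sum_mul]
        exact mul_le_mul_of_nonneg_right (by linarith) (by positivity)
    _ = s * (b * E⁻¹ ^ (2 * M)) := by field_simp
    _ ≤ s * C₂ ψ E z := by
        refine mul_le_mul_of_nonneg_left (le_trans ?_ (hl E hE1)) hs.le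
        exact mul_le_mul_of_nonneg_left (pow_le_pow_of_le_one (by positivity)
          (inv_le_one_of_one_le₀ hE1) hcard) hb.le

lemma surjective_of_mem_patterns_two {L M : ℕ} (hN : 0 < L * M) {q : Fin (L * M) → Fin 2}
    (hq : q ∈ patterns L M 2) (h : q ≠ 0) : Function.Surjective q := by
  rw [patterns_eq hN, Finset.mem_filter] at hq
  obtain ⟨n, hn⟩ := Function.ne_iff.1 h
  intro a
  obtain rfl | rfl : a = 0 ∨ a = 1 := by omega
  · exact ⟨_, hq.2⟩
  · refine ⟨n, ?_⟩
    simp only [Pi.zero_apply] at hn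
    omega

lemma fraction_nonneg {L M q : ℕ} (p : Fin (L * M) → Fin q) (a : Fin q) (j : Fin M) :
    0 ≤ fraction p a j := by unfold fraction; positivity

lemma fraction_le_one {L M : ℕ} (hL : 0 < L) (p : Fin (L * M) → Fin 2) (j : Fin M) :
    fraction p 0 j ≤ 1 := by
  have h := sum_fraction hL p j
  rw [Fin.sum_univ_two] at h
  linarith [fraction_nonneg p 1 j]

/-- The symbol counts of a nondegenerate two-symbol pattern. -/
lemma exists_fraction_eq {L M : ℕ} (hL : 0 < L) {q : Fin (L * M) → Fin 2}
    (hq : q ∈ patterns L M 2) (hs : Function.Surjective q) (hd : q ∉ degeneratePatterns L M 2) :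
    ∃ l : Fin M → Finset.Icc 1 (L - 1), fraction q 0 = fun j => ((l j : ℕ) : ℝ) / L := by
  classical
  have hf : ∀ a j, (L : ℝ)⁻¹ ≤ fraction q a j := fun a j => inv_le_fraction (by
    by_contra! h
    exact hd (Finset.mem_filter.2 ⟨hq, hs, j, a, h⟩))
  have hLpos : (0 : ℝ) < L := by positivity
  refine ⟨fun j => ⟨Finset.card {n : Fin (L * M) | n.modNat = j ∧ q n = 0}, ?_⟩, rfl⟩
  have h := sum_fraction hL q j
  rw [Fin.sum_univ_two] at h
  have h0 := hf 0 j
  have h1 : fraction q 0 j ≤ 1 - (L : ℝ)⁻¹ := by linarith [hf 1 j]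
  simp only [fraction] at h0 h1
  rw [inv_eq_one_div, div_le_div_iff_of_pos_right hLpos] at h0
  rw [div_le_iff₀ hLpos, sub_mul, one_mul, inv_mul_cancel₀ hLpos.ne', le_sub_iff_add_le] at h1
  rw [Finset.mem_Icc]
  have h0' : 1 ≤ Finset.card {n : Fin (L * M) | n.modNat = j ∧ q n = 0} := by exact_mod_cast h0
  have h1' : Finset.card {n : Fin (L * M) | n.modNat = j ∧ q n = 0} + 1 ≤ L := by
    exact_mod_cast h1
  exact ⟨h0', by omega⟩

lemma exists_fraction_eq_zero_or_one {L M : ℕ} (hL : 0 < L) {q : Fin (L * M) → Fin 2}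
    (hd : q ∈ degeneratePatterns L M 2) : ∃ j, fraction q 0 j = 0 ∨ fraction q 0 j = 1 := by
  simp only [degeneratePatterns, Finset.mem_filter] at hd
  obtain ⟨-, -, j, a, h⟩ := hd
  refine ⟨j, ?_⟩
  obtain rfl | rfl : a = 0 ∨ a = 1 := by omega
  · exact Or.inl (fraction_eq_zero h)
  · have h2 := sum_fraction hL q j
    rw [Fin.sum_univ_two, fraction_eq_zero h, add_zero] at h2
    exact Or.inr h2

lemma pairWeight_zero {L M : ℕ} (k : Fin (L * M)) :
    pairWeight k (0 : Fin (L * M) → Fin 2) = 2 * (3 ^ (L * M - 1) / 4 ^ (L * M)) := by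
  simp [pairWeight, weight_zero]

/-- The constant pattern has pair weight twice its weight, so removing the double count leaves `C₁`
with coefficient one weight. -/
lemma sum_pairWeight_mul {L M : ℕ} (hL : 0 < L) {ψ : Wave M} (hψ : MemLp ψ 2 volume)
    (k : Fin (L * M)) (E : ℝ) :
    ∑ q ∈ patterns L M 2, pairWeight k q * C₂ ψ E (fraction q 0)
        - weight k (0 : Fin (L * M) → Fin 2) * C₁ ψ E
      = 3 ^ (L * M - 1) / 4 ^ (L * M) * C₁ ψ E
        + ∑ q ∈ (patterns L M 2).erase 0, pairWeight k q * C₂ ψ E (fraction q 0) := by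
  have h0 : (0 : Fin (L * M) → Fin 2) ∈ patterns L M 2 := by simp [patterns]
  have hf : fraction (0 : Fin (L * M) → Fin 2) 0 = (1 : Fin M → ℝ) := by
    funext j
    simp [fraction, card_filter_modNat, hL.ne']
  rw [← Finset.add_sum_erase _ _ h0, pairWeight_zero, weight_zero, hf,
    C₂_one ψ E (continuous_braket_coherent hψ)]
  ring

lemma sum_pairWeight_erase {L M : ℕ} (k : Fin (L * M)) :
    ∑ q ∈ (patterns L M 2).erase 0, pairWeight k q
      = 1 / 4 + 2 ^ (L * M - 1) / 4 ^ (L * M) - 2 * (3 ^ (L * M - 1) / 4 ^ (L * M)) := by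
  have h0 : (0 : Fin (L * M) → Fin 2) ∈ patterns L M 2 := by simp [patterns]
  rw [← sum_pairWeight_patterns k, ← Finset.add_sum_erase _ _ h0, pairWeight_zero]
  ring

lemma C₂_le_maxC₂ {M : ℕ} (ψ : Wave M) (E : ℝ) {L : ℕ} (l : Fin M → Finset.Icc 1 (L - 1)) :
    C₂ ψ E (fun j => ((l j : ℕ) : ℝ) / L) ≤ maxC₂ ψ E L :=
  le_ciSup (f := fun l : Fin M → Finset.Icc 1 (L - 1) => C₂ ψ E fun j => ((l j : ℕ) : ℝ) / L)
    (Set.finite_range _).bddAbove l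

lemma minC₂_le_C₂ {M : ℕ} (ψ : Wave M) (E : ℝ) {L : ℕ} (l : Fin M → Finset.Icc 1 (L - 1)) :
    minC₂ ψ E L ≤ C₂ ψ E (fun j => ((l j : ℕ) : ℝ) / L) :=
  ciInf_le (f := fun l : Fin M → Finset.Icc 1 (L - 1) => C₂ ψ E fun j => ((l j : ℕ) : ℝ) / L)
    (Set.finite_range _).bddBelow l

lemma exists_C₂_eq_minC₂ {M : ℕ} (ψ : Wave M) (E : ℝ) {L : ℕ} (hL : 2 ≤ L) :
    ∃ l : Fin M → Finset.Icc 1 (L - 1), C₂ ψ E (fun j => ((l j : ℕ) : ℝ) / L) = minC₂ ψ E L := by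
  have : Nonempty (Finset.Icc 1 (L - 1)) := ⟨⟨1, Finset.mem_Icc.2 ⟨le_rfl, by omega⟩⟩⟩
  exact exists_eq_ciInf_of_finite

lemma inv_le_div_of_mem_Icc {L : ℕ} (hL : 0 < L) (l : Finset.Icc 1 (L - 1)) :
    (L : ℝ)⁻¹ ≤ ((l : ℕ) : ℝ) / L ∧ (L : ℝ)⁻¹ ≤ 1 - ((l : ℕ) : ℝ) / L := by
  have hLpos : (0 : ℝ) < L := by positivity
  obtain ⟨h1, h2⟩ := Finset.mem_Icc.1 l.2
  have h1' : (1 : ℝ) ≤ (l : ℕ) := by exact_mod_cast h1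
  have h2' : ((l : ℕ) : ℝ) + 1 ≤ L := by exact_mod_cast (by omega : (l : ℕ) + 1 ≤ L)
  refine ⟨?_, ?_⟩
  · rw [inv_eq_one_div]
    exact div_le_div_of_nonneg_right h1' hLpos.le
  · rw [le_sub_iff_add_le, inv_eq_one_div, ← add_div, div_le_one hLpos]
    linarith

/-- With `s` the weight of the constant pattern and `t = 2^(LM-1)/4^(LM)`, the nonconstant pair
weights sum to `1/4 + t - 2s`. Nondegenerate `C₃` terms cost at most `s` times the minimal `C₂`.
This leaves at least `1/4 - 3s` below and at most `1/4 + t` above. -/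
theorem eventually_gradientVariance_bounds {L M : ℕ} (hL : 2 ≤ L) (hM : 0 < M) {ψ : Wave M}
    (hψ : MemLp ψ 2 volume) (hne : ¬ ψ =ᵐ[volume] 0) (k : Fin (L * M)) :
    ∀ᶠ E : ℝ in Filter.atTop,
      (1 / 2 * ((3 : ℝ) ^ (L * M - 1) / 4 ^ (L * M) * C₁ ψ E
            + (1 / 4 - (3 : ℝ) ^ (L * M) / 4 ^ (L * M)) * minC₂ ψ E L)
          - 1 / 2 * boundaryC₃ ψ E k
        ≤ gradientVariance L M ψ k E) ∧
      (gradientVariance L M ψ k E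
        ≤ 1 / 2 * ((3 : ℝ) ^ (L * M - 1) / 4 ^ (L * M) * C₁ ψ E
            + (1 / 4 + (2 : ℝ) ^ (L * M - 1) / 4 ^ (L * M)) * maxC₂ ψ E L)
          + 1 / 2 * (boundaryC₂ ψ E k + boundaryC₃ ψ E k)) := by
  classical
  have hL0 : 0 < L := by omega
  have hLinv : (0 : ℝ) < (L : ℝ)⁻¹ := by positivity
  have hN := k.pos
  set s : ℝ := 3 ^ (L * M - 1) / 4 ^ (L * M) with hs
  set t : ℝ := 2 ^ (L * M - 1) / 4 ^ (L * M) with ht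
  have hspos : 0 < s := by positivity
  have htpos : 0 < t := by positivity
  have h3s : (3 : ℝ) ^ (L * M) / 4 ^ (L * M) = 3 * s := by
    rw [hs, ← mul_div_assoc, mul_comm (3 : ℝ), ← pow_succ, Nat.sub_add_cancel hN]
  -- The threshold has to serve all `l` at once, because the minimizer of `C₂` may change with `E`.
  have hrem : ∀ᶠ E in Filter.atTop, ∀ l : Fin M → Finset.Icc 1 (L - 1),
      ∑ p ∈ patterns L M 3 with Function.Surjective p,
          weight k p * C₃ ψ E (fraction p 0) (fraction p 1)
        ≤ boundaryC₃ ψ E k + s * C₂ ψ E fun j => ((l j : ℕ) : ℝ) / L :=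
    Filter.eventually_all.2 fun l => eventually_sum_C₃_le hL0 hM hψ hne k
      (fun j => by positivity)
      (fun j => by linarith [(inv_le_div_of_mem_Icc hL0 (l j)).2]) hspos
  have hdeg : ∀ᶠ E in Filter.atTop, ∀ l : Fin M → Finset.Icc 1 (L - 1),
      ∀ q ∈ degeneratePatterns L M 2,
        C₂ ψ E (fun j => ((l j : ℕ) : ℝ) / L) ≤ C₂ ψ E (fraction q 0) :=
    Filter.eventually_all.2 fun l => (Filter.eventually_all_finset _).2 fun q hq =>
      eventually_C₂_le_C₂ hψ hne (fraction_nonneg q 0) (fraction_le_one hL0 q)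
        (exists_fraction_eq_zero_or_one hL0 hq) hLinv
        (fun j => (inv_le_div_of_mem_Icc hL0 (l j)).1)
        (fun j => (inv_le_div_of_mem_Icc hL0 (l j)).2)
  filter_upwards [hrem, hdeg, Filter.eventually_ge_atTop 0] with E hrem hdeg hE
  obtain ⟨l₀, hl₀⟩ := exists_C₂_eq_minC₂ ψ E hL
  have hmin0 : 0 ≤ minC₂ ψ E L := hl₀ ▸ C₂_nonneg ψ E _
  have hmax : minC₂ ψ E L ≤ maxC₂ ψ E L := hl₀ ▸ C₂_le_maxC₂ ψ E l₀
  have hR := hrem l₀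
  rw [hl₀] at hR
  have hvar := abs_le.1 ((abs_gradientVariance_sub_le hL0 hψ k hE).trans hR)
  rw [sum_pairWeight_mul hL0 hψ] at hvar
  have hsum := sum_pairWeight_erase k
  rw [← hs, ← ht] at hsum
  have hlow : (1 / 4 + t - 2 * s) * minC₂ ψ E L
      ≤ ∑ q ∈ (patterns L M 2).erase 0, pairWeight k q * C₂ ψ E (fraction q 0) := by
    rw [← hsum, Finset.sum_mul]
    refine Finset.sum_le_sum fun q hq => mul_le_mul_of_nonneg_left ?_ (pairWeight_nonneg k q)
    obtain ⟨hq0, hq⟩ := Finset.mem_erase.1 hq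
    by_cases hd : q ∈ degeneratePatterns L M 2
    · rw [← hl₀]
      exact hdeg l₀ q hd
    · obtain ⟨l, hl⟩ := exists_fraction_eq hL0 hq (surjective_of_mem_patterns_two hN hq hq0) hd
      rw [hl]
      exact minC₂_le_C₂ ψ E l
  have hup : ∑ q ∈ (patterns L M 2).erase 0, pairWeight k q * C₂ ψ E (fraction q 0)
      ≤ (1 / 4 + t - 2 * s) * maxC₂ ψ E L + boundaryC₂ ψ E k := by
    have hsub : degeneratePatterns L M 2 ⊆ (patterns L M 2).erase 0 := fun q hq => by
      simp only [degeneratePatterns, Finset.mem_filter] at hq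
      refine Finset.mem_erase.2 ⟨fun h => ?_, hq.1⟩
      obtain ⟨n, hn⟩ := hq.2.1 1
      rw [h] at hn
      exact absurd hn (by simp)
    rw [← Finset.sum_sdiff hsub, boundaryC₂]
    refine add_le_add_left ?_ _
    calc ∑ q ∈ (patterns L M 2).erase 0 \ degeneratePatterns L M 2,
          pairWeight k q * C₂ ψ E (fraction q 0)
        ≤ ∑ q ∈ (patterns L M 2).erase 0 \ degeneratePatterns L M 2,
          pairWeight k q * maxC₂ ψ E L := by
          refine Finset.sum_le_sum fun q hq => mul_le_mul_of_nonneg_left ?_ (pairWeight_nonneg k q)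
          obtain ⟨hq, hd⟩ := Finset.mem_sdiff.1 hq
          obtain ⟨hq0, hq⟩ := Finset.mem_erase.1 hq
          obtain ⟨l, hl⟩ := exists_fraction_eq hL0 hq
            (surjective_of_mem_patterns_two hN hq hq0) hd
          rw [hl]
          exact C₂_le_maxC₂ ψ E l
      _ ≤ ∑ q ∈ (patterns L M 2).erase 0, pairWeight k q * maxC₂ ψ E L :=
          Finset.sum_le_sum_of_subset_of_nonneg Finset.sdiff_subset fun q _ _ =>
            mul_nonneg (pairWeight_nonneg k q) (hmin0.trans hmax)
      _ = _ := by rw [← Finset.sum_mul, hsum]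
  have hsm := mul_le_mul_of_nonneg_left hmax hspos.le
  have hsm0 := mul_nonneg hspos.le hmin0
  have htm0 := mul_nonneg htpos.le hmin0
  rw [h3s]
  constructor
  · linarith [hvar.1]
  · linarith [hvar.2]

end CVCircuit

end

theorem mainTheorem3 (L M : ℕ) (hL : 2 ≤ L) (hM : 1 ≤ M) (k : Fin (L * M))
    (ψ : Lp ℂ 2 (volume : Measure (Fin M → ℝ))) (hψ : ‖ψ‖ = 1) :
    (∀ᶠ E : ℝ in Filter.atTop,
      (1 / 2 * ((3 : ℝ) ^ (M * L - 1) / 4 ^ (M * L) * C₁ ψ E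
            + (1 / 4 - (3 : ℝ) ^ (M * L) / 4 ^ (M * L)) * minC₂ ψ E L)
          - 1 / 2 * boundaryC₃ ψ E k
        ≤ gradientVariance L M ψ k E) ∧
      (gradientVariance L M ψ k E
        ≤ 1 / 2 * ((3 : ℝ) ^ (M * L - 1) / 4 ^ (M * L) * C₁ ψ E
            + (1 / 4 + (2 : ℝ) ^ (M * L - 1) / 4 ^ (M * L)) * maxC₂ ψ E L)
          + 1 / 2 * (boundaryC₂ ψ E k + boundaryC₃ ψ E k))) ∧
    (M = 1 → ∀ E : ℝ, boundaryC₂ ψ E k = 0 ∧ boundaryC₃ ψ E k = 0) ∧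
    (∑ p ∈ degeneratePatterns L M 2, pairWeight k p ≤ M * (3 / 4 : ℝ) ^ L) ∧
    (∑ p ∈ degeneratePatterns L M 3, weight k p
      ≤ 8 * M * (4 / 5 : ℝ) ^ L * ∑ p ∈ patterns L M 3, weight k p) := by
  have hne : ¬ ψ =ᵐ[volume] 0 := fun h => by
    rw [Lp.eq_zero_iff_ae_eq_zero.2 h, norm_zero] at hψ
    exact zero_ne_one hψ
  refine ⟨?_, ?_, sum_pairWeight_degeneratePatterns_le k, sum_weight_degeneratePatterns_le k⟩
  · rw [mul_comm M L]
    exact eventually_gradientVariance_bounds hL hM (Lp.memLp ψ) hne k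
  · rintro rfl E
    simp [boundaryC₂, boundaryC₃, degeneratePatterns_one]
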